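/- Let $\mathbb{R}^2_+ := \{x=(x_1,x_2)\in\mathbb{R}^2 : x_1>0\}$ and $\partial_\theta := x_1\partial_{x_2}-x_2\partial_{x_1}$, and let $$H^+ := \Bigl\{u\in H^1_0(\mathbb{R}^2_+) : \int_{\mathbb{R}^2_+}|\partial_\theta u|^2\,dx<\infty\Bigr\}$$ with the norm given by $\|u\|^2=\int_{\mathbb{R}^2_+}(|\nabla u|^2+|\partial_\theta u|^2+u^2)\,dx$. Let $p>2$, $\lambda>0$, and let $f:\mathbb{R}\to\mathbb{R}$ be a continuous function such that - $(A_1)$ there exists $C>0$ with $|f(t)|\le C(|t|+|t|^p)$ for all $t\in\mathbb{R}$; - $(A_2)$ $t\mapsto f(t)/t$ is strictly increasing on $(0,\infty)$ and strictly decreasing on $(-\infty,0)$ (that is, $t \mapsto f(t)/|t|$ is strictly increasing on each of the two half-lines), the limit $\lim_{t\to0}f(t)/t$ exists and is $\le 0$, and $\lim_{t\to\pm\infty}f(t)/t=+\infty$. Put $F(t)=\int_0^t f(s)\,ds$ and, for $u\in H^+$, $$E_\lambda^+(u)=\frac12\int_{\mathbb{R}^2_+}\Bigl(|\nabla u|^2+\frac1{\lambda^2}|\partial_\theta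 u|^2\Bigr)dx-\int_{\mathbb{R}^2_+}F(u)\,dx .$$ Let $\mathcal{N}_\lambda^+=\{u\in H^+\setminus\{0\} : [E_\lambda^+]'(u)u=0\}$ be the Nehari manifold and $c_\lambda=\inf_{u\in\mathcal{N}_\lambda^+}E_\lambda^+(u)$. Then $$c_\lambda=\inf_{u\in H^+\setminus\{0\}}\ \sup_{t\ge0}E_\lambda^+(tu).$$ Moreover, the problem $$-\Delta u-\frac1{\lambda^2}\partial_\theta^2u=f(u)\ \text{ in }\mathbb{R}^2_+,\qquad u=0\ \text{ on }\partial\mathbb{R}^2_+$$ admits a ground state solution, i.e. there is $v\in H^+\setminus\{0\}$ with $E_\lambda^+(v)=c_\lambda$ that solves the problem in the weak sense: $$\int_{\mathbb{R}^2_+}\Bigl(\nabla v\cdot\nabla w+\frac1{\lambda^2}\,\partial_\theta v\,\partial_\theta w\Bigr)dx=\int_{\mathbb{R}^2_+}f(v)\,w\,dx\qquad\text{for all }w\in H^+ .$$ -/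

import Mathlib

open MeasureTheory Filter Topology Set

noncomputable section

namespace SpiralingHalfPlane

/-- The Euclidean plane; the coordinates `x₁, x₂` are `x 0, x 1`. -/
abbrev Plane : Type := EuclideanSpace ℝ (Fin 2)

/-- The open half-plane `{x : x₁ > 0}`. -/
def halfPlane : Set Plane := {x | 0 < x 0}

/-- Lebesgue measure on the half-plane. -/
abbrev halfVol : Measure Plane := volume.restrict halfPlane

/-- The real Hilbert space `L²` of the half-plane. -/
abbrev L2Half : Type := Lp ℝ 2 halfVol

/-- The classical partial derivative in the direction of the `i`-th coordinate. -/
def classicalPartial (i : Fin 2) (φ : Plane → ℝ) (x : Plane) : ℝ :=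
  fderiv ℝ φ x (EuclideanSpace.single i 1)

/-- Test functions: smooth, with compact support contained in the open half-plane. -/
structure IsTestFunction (φ : Plane → ℝ) : Prop where
  smooth : ContDiff ℝ (⊤ : ℕ∞) φ
  compact : HasCompactSupport φ
  support : tsupport φ ⊆ halfPlane

/-- `g` is the weak partial derivative of `u` in direction `i` on the half-plane. -/
def HasWeakPartial (i : Fin 2) (u g : L2Half) : Prop :=
  ∀ φ : Plane → ℝ, IsTestFunction φ →
    ∫ x, u x * classicalPartial i φ x ∂halfVol = - ∫ x, g x * φ x ∂halfVol

/-- `u ∈ H¹` of the half-plane, with weak gradient `(g 0, g 1)`. -/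
def IsH1 (u : L2Half) (g : Fin 2 → L2Half) : Prop :=
  ∀ i, HasWeakPartial i u (g i)

/-- `u ∈ H¹₀` of the half-plane, with weak gradient `(g 0, g 1)`: the function `u` lies in `H¹`
and is a limit of test functions in the `H¹` norm. -/
def IsH10 (u : L2Half) (g : Fin 2 → L2Half) : Prop :=
  IsH1 u g ∧ ∃ φ : ℕ → Plane → ℝ, (∀ n, IsTestFunction (φ n)) ∧
    Tendsto (fun n => eLpNorm (fun x => φ n x - u x) 2 halfVol) atTop (𝓝 0) ∧
    ∀ i, Tendsto (fun n => eLpNorm (fun x => classicalPartial i (φ n) x - g i x) 2 halfVol)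
      atTop (𝓝 0)

theorem IsTestFunction.continuous_partial {φ : Plane → ℝ} (h : IsTestFunction φ) (i : Fin 2) :
    Continuous (classicalPartial i φ) :=
  (h.smooth.continuous_fderiv (by simp)).clm_apply continuous_const

theorem IsTestFunction.compact_partial {φ : Plane → ℝ} (h : IsTestFunction φ) (i : Fin 2) :
    HasCompactSupport (classicalPartial i φ) :=
  h.compact.fderiv_apply (𝕜 := ℝ) _

theorem IsTestFunction.memLp {φ : Plane → ℝ} (h : IsTestFunction φ) : MemLp φ 2 halfVol :=
  h.smooth.continuous.memLp_of_hasCompactSupport h.compact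

theorem IsTestFunction.memLp_partial {φ : Plane → ℝ} (h : IsTestFunction φ) (i : Fin 2) :
    MemLp (classicalPartial i φ) 2 halfVol :=
  (h.continuous_partial i).memLp_of_hasCompactSupport (h.compact_partial i)

theorem IsTestFunction.zero : IsTestFunction (fun _ => 0) :=
  ⟨contDiff_const, HasCompactSupport.zero, by
    have h : tsupport (fun _ : Plane => (0 : ℝ)) = ∅ := by
      rw [tsupport_eq_empty_iff]; rfl
    rw [h]; exact empty_subset _⟩

theorem IsTestFunction.add {φ ψ : Plane → ℝ} (h : IsTestFunction φ) (k : IsTestFunction ψ) :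
    IsTestFunction (fun x => φ x + ψ x) :=
  ⟨h.smooth.add k.smooth, h.compact.add k.compact,
    (tsupport_add φ ψ).trans (union_subset h.support k.support)⟩

theorem IsTestFunction.const_mul {φ : Plane → ℝ} (h : IsTestFunction φ) (c : ℝ) :
    IsTestFunction (fun x => c * φ x) :=
  ⟨contDiff_const.mul h.smooth, h.compact.mul_left,
    (tsupport_mul_subset_right (f := fun _ => c) (g := φ)).trans h.support⟩

theorem classicalPartial_add {φ ψ : Plane → ℝ} (h : IsTestFunction φ) (k : IsTestFunction ψ)
    (i : Fin 2) (x : Plane) :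
    classicalPartial i (fun x => φ x + ψ x) x
      = classicalPartial i φ x + classicalPartial i ψ x := by
  unfold classicalPartial
  rw [fderiv_fun_add (h.smooth.differentiable (by simp) x) (k.smooth.differentiable (by simp) x)]
  rfl

theorem classicalPartial_const_mul {φ : Plane → ℝ} (h : IsTestFunction φ) (c : ℝ)
    (i : Fin 2) (x : Plane) :
    classicalPartial i (fun x => c * φ x) x = c * classicalPartial i φ x := by
  unfold classicalPartial
  rw [fderiv_const_mul (h.smooth.differentiable (by simp) x)]
  rfl

theorem integral_add_mul (u v : L2Half) {ψ : Plane → ℝ} (h : MemLp ψ 2 halfVol) :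
    ∫ x, (u + v : L2Half) x * ψ x ∂halfVol
      = ∫ x, u x * ψ x ∂halfVol + ∫ x, v x * ψ x ∂halfVol := by
  have h1 : Integrable (fun x => u x * ψ x) halfVol := (Lp.memLp u).integrable_mul h
  have h2 : Integrable (fun x => v x * ψ x) halfVol := (Lp.memLp v).integrable_mul h
  rw [← integral_add h1 h2]
  refine integral_congr_ae ?_
  filter_upwards [Lp.coeFn_add u v] with x hx
  rw [hx, Pi.add_apply, add_mul]

theorem integral_smul_mul (c : ℝ) (u : L2Half) (ψ : Plane → ℝ) :
    ∫ x, (c • u : L2Half) x * ψ x ∂halfVol = c * ∫ x, u x * ψ x ∂halfVol := by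
  rw [← integral_const_mul]
  refine integral_congr_ae ?_
  filter_upwards [Lp.coeFn_smul c u] with x hx
  rw [hx, Pi.smul_apply, smul_eq_mul, mul_assoc]

theorem HasWeakPartial.add {i : Fin 2} {u v g h : L2Half} (hu : HasWeakPartial i u g)
    (hv : HasWeakPartial i v h) : HasWeakPartial i (u + v) (g + h) := by
  intro φ hφ
  rw [integral_add_mul _ _ (hφ.memLp_partial i), integral_add_mul _ _ hφ.memLp, hu φ hφ, hv φ hφ,
    neg_add]

theorem HasWeakPartial.smul {i : Fin 2} {u g : L2Half} (c : ℝ) (hu : HasWeakPartial i u g) :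
    HasWeakPartial i (c • u) (c • g) := by
  intro φ hφ
  rw [integral_smul_mul, integral_smul_mul, hu φ hφ, mul_neg]

theorem tendsto_add_aux {φ ψ : ℕ → Plane → ℝ} {u v : L2Half}
    (mφ : ∀ n, MemLp (φ n) 2 halfVol) (mψ : ∀ n, MemLp (ψ n) 2 halfVol)
    (hφ : Tendsto (fun n => eLpNorm (fun x => φ n x - u x) 2 halfVol) atTop (𝓝 0))
    (hψ : Tendsto (fun n => eLpNorm (fun x => ψ n x - v x) 2 halfVol) atTop (𝓝 0)) :
    Tendsto (fun n => eLpNorm (fun x => φ n x + ψ n x - (u + v : L2Half) x) 2 halfVol)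
      atTop (𝓝 0) := by
  have hs := hφ.add hψ
  rw [add_zero] at hs
  refine tendsto_of_tendsto_of_tendsto_of_le_of_le tendsto_const_nhds hs (fun _ => zero_le) ?_
  intro n
  have h1 := eLpNorm_add_le ((mφ n).sub (Lp.memLp u)).aestronglyMeasurable
    ((mψ n).sub (Lp.memLp v)).aestronglyMeasurable (p := 2) (by norm_num)
  refine le_trans (le_of_eq (eLpNorm_congr_ae ?_)) h1
  filter_upwards [Lp.coeFn_add u v] with x hx
  simp only [hx, Pi.add_apply, Pi.sub_apply]
  ring

theorem tendsto_smul_aux {φ : ℕ → Plane → ℝ} {u : L2Half} (c : ℝ)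
    (hφ : Tendsto (fun n => eLpNorm (fun x => φ n x - u x) 2 halfVol) atTop (𝓝 0)) :
    Tendsto (fun n => eLpNorm (fun x => c * φ n x - (c • u : L2Half) x) 2 halfVol)
      atTop (𝓝 0) := by
  have hs := ENNReal.Tendsto.const_mul (a := ‖c‖ₑ) hφ (Or.inr (by simp))
  rw [mul_zero] at hs
  refine hs.congr fun n => ?_
  rw [← eLpNorm_const_smul]
  refine eLpNorm_congr_ae ?_
  filter_upwards [Lp.coeFn_smul c u] with x hx
  simp only [hx, Pi.smul_apply, smul_eq_mul]
  ring

theorem IsH10.zero : IsH10 0 (fun _ => 0) := by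
  refine ⟨fun i φ _ => ?_, fun _ _ => 0, fun _ => IsTestFunction.zero, ?_, fun i => ?_⟩
  · have h : ∀ ψ : Plane → ℝ, ∫ x, (0 : L2Half) x * ψ x ∂halfVol = 0 := fun ψ => by
      have h1 := integral_smul_mul 0 0 ψ
      rwa [zero_smul, zero_mul] at h1
    rw [h, h, neg_zero]
  · refine tendsto_const_nhds.congr fun n => ?_
    rw [eq_comm, ← eLpNorm_zero (μ := halfVol) (p := 2) (α := Plane) (ε := ℝ)]
    refine eLpNorm_congr_ae ?_
    filter_upwards [Lp.coeFn_zero ℝ 2 halfVol] with x hx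
    rw [hx]; simp
  · refine tendsto_const_nhds.congr fun n => ?_
    rw [eq_comm, ← eLpNorm_zero (μ := halfVol) (p := 2) (α := Plane) (ε := ℝ)]
    refine eLpNorm_congr_ae ?_
    filter_upwards [Lp.coeFn_zero ℝ 2 halfVol] with x hx
    rw [hx]; simp [classicalPartial]

theorem IsH10.add {u v : L2Half} {g h : Fin 2 → L2Half} (hu : IsH10 u g) (hv : IsH10 v h) :
    IsH10 (u + v) (fun i => g i + h i) := by
  obtain ⟨hu1, φ, hφ, hφ0, hφ1⟩ := hu
  obtain ⟨hv1, ψ, hψ, hψ0, hψ1⟩ := hv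
  refine ⟨fun i => (hu1 i).add (hv1 i), fun n x => φ n x + ψ n x, fun n => (hφ n).add (hψ n),
    tendsto_add_aux (fun n => (hφ n).memLp) (fun n => (hψ n).memLp) hφ0 hψ0, fun i => ?_⟩
  simp only [classicalPartial_add (hφ _) (hψ _)]
  exact tendsto_add_aux (fun n => (hφ n).memLp_partial i) (fun n => (hψ n).memLp_partial i)
    (hφ1 i) (hψ1 i)

theorem IsH10.smul {u : L2Half} {g : Fin 2 → L2Half} (c : ℝ) (hu : IsH10 u g) :
    IsH10 (c • u) (fun i => c • g i) := by
  obtain ⟨hu1, φ, hφ, hφ0, hφ1⟩ := hu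
  refine ⟨fun i => (hu1 i).smul c, fun n x => c * φ n x, fun n => (hφ n).const_mul c,
    tendsto_smul_aux c hφ0, fun i => ?_⟩
  simp only [classicalPartial_const_mul (hφ _)]
  exact tendsto_smul_aux c (hφ1 i)

/-- The space `H⁺` of all `u ∈ H¹₀` of the half-plane whose angular derivative
`∂_θ u = x₁ ∂₂ u - x₂ ∂₁ u` is square integrable. A function `u` is stored together with its weak
derivatives, which it determines, as the quadruple `(u, ∂₁ u, ∂₂ u, ∂_θ u)` in `(L²)⁴`; the norm
that `H⁺` inherits from there is the Hilbert norm with square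
`∫ (|∇ u|² + |∂_θ u|² + u²)`. -/
def HPlus : Submodule ℝ (PiLp 2 (fun _ : Fin 4 => L2Half)) where
  carrier := {U | IsH10 (U 0) ![U 1, U 2] ∧
    (U 3 : Plane → ℝ) =ᵐ[halfVol] fun x => x 0 * U 2 x - x 1 * U 1 x}
  zero_mem' := by
    refine ⟨?_, ?_⟩
    · have h : (![0, 0] : Fin 2 → L2Half) = fun _ => 0 := by
        funext i; fin_cases i <;> rfl
      simpa [h] using IsH10.zero
    · filter_upwards [Lp.coeFn_zero ℝ 2 halfVol] with x hx
      change (0 : L2Half) x = x 0 * (0 : L2Half) x - x 1 * (0 : L2Half) x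
      rw [hx]; simp
  add_mem' := by
    rintro U V ⟨hU, hU'⟩ ⟨hV, hV'⟩
    refine ⟨?_, ?_⟩
    · have h : ![(U + V) 1, (U + V) 2]
          = fun i => (![U 1, U 2] : Fin 2 → L2Half) i + (![V 1, V 2] : Fin 2 → L2Half) i := by
        funext i; fin_cases i <;> rfl
      rw [h]
      exact hU.add hV
    · filter_upwards [hU', hV', Lp.coeFn_add (U 1) (V 1), Lp.coeFn_add (U 2) (V 2),
        Lp.coeFn_add (U 3) (V 3)] with x h1 h2 h3 h4 h5
      simp only [PiLp.add_apply, h3, h4, h5, Pi.add_apply, h1, h2]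
      ring
  smul_mem' := by
    rintro c U ⟨hU, hU'⟩
    refine ⟨?_, ?_⟩
    · have h : ![(c • U) 1, (c • U) 2]
          = fun i => c • (![U 1, U 2] : Fin 2 → L2Half) i := by
        funext i; fin_cases i <;> rfl
      rw [h]
      exact hU.smul c
    · filter_upwards [hU', Lp.coeFn_smul c (U 1), Lp.coeFn_smul c (U 2),
        Lp.coeFn_smul c (U 3)] with x h1 h3 h4 h5
      simp only [PiLp.smul_apply, h3, h4, h5, Pi.smul_apply, h1, smul_eq_mul]
      ring

/-- The underlying function `u`. -/
def fn (U : HPlus) : L2Half := U.1 0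

/-- The weak partial derivative `∂₁ u`. -/
def fnD1 (U : HPlus) : L2Half := U.1 1

/-- The weak partial derivative `∂₂ u`. -/
def fnD2 (U : HPlus) : L2Half := U.1 2

/-- The angular derivative `∂_θ u`. -/
def fnAngle (U : HPlus) : L2Half := U.1 3

/-- The bilinear form `⟨u, v⟩ = ∫ (∇ u · ∇ v + λ⁻² ∂_θ u ∂_θ v)` over the half-plane. -/
def energyForm (lam : ℝ) (U V : HPlus) : ℝ :=
  ∫ x, (fnD1 U x * fnD1 V x + fnD2 U x * fnD2 V x
    + 1 / lam ^ 2 * (fnAngle U x * fnAngle V x)) ∂halfVol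

/-- The primitive `F(t) = ∫₀ᵗ f`. -/
def primitive (f : ℝ → ℝ) (t : ℝ) : ℝ := ∫ s in (0 : ℝ)..t, f s

/-- The energy functional on `H⁺`. -/
def energy (f : ℝ → ℝ) (lam : ℝ) (U : HPlus) : ℝ :=
  1 / 2 * energyForm lam U U - ∫ x, primitive f (fn U x) ∂halfVol

/-- The Nehari manifold: nonzero `u ∈ H⁺` with `E'(u) u = 0`, where `E'` is the Fréchet
derivative. -/
def nehari (f : ℝ → ℝ) (lam : ℝ) : Set HPlus :=
  {U | U ≠ 0 ∧ ∃ L : HPlus →L[ℝ] ℝ, HasFDerivAt (energy f lam) L U ∧ L U = 0}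

/-- The ground state level: the infimum of the energy over the Nehari manifold, taken in the
extended reals. -/
def groundLevel (f : ℝ → ℝ) (lam : ℝ) : EReal :=
  ⨅ U ∈ nehari f lam, (energy f lam U : EReal)

/-- Weak solutions `u ∈ H⁺` of `-Δ u - λ⁻² ∂_θ² u = f(u)` in the half-plane, `u = 0` on its
boundary; the boundary condition is contained in `u ∈ H⁺`. -/
def IsWeakSolution (f : ℝ → ℝ) (lam : ℝ) (U : HPlus) : Prop :=
  ∀ V : HPlus, Integrable (fun x => f (fn U x) * fn V x) halfVol ∧
    energyForm lam U V = ∫ x, f (fn U x) * fn V x ∂halfVol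

/-- The growth bound `|f(t)| ≤ C (|t| + |t|ᵖ)`. -/
def GrowthBound (p : ℝ) (f : ℝ → ℝ) : Prop :=
  ∃ C : ℝ, 0 < C ∧ ∀ t : ℝ, |f t| ≤ C * (|t| + |t| ^ p)

/-- The quotient `f(t)/t` strictly increases with `|t|` on each of the two half-lines, has a limit
`≤ 0` at `0`, and tends to `∞` at `±∞`. -/
structure QuotientCondition (f : ℝ → ℝ) : Prop where
  strictMono_pos : StrictMonoOn (fun t => f t / t) (Ioi 0)
  strictAnti_neg : StrictAntiOn (fun t => f t / t) (Iio 0)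
  limit_zero : ∃ l : ℝ, l ≤ 0 ∧ Tendsto (fun t => f t / t) (𝓝[≠] 0) (𝓝 l)
  limit_top : Tendsto (fun t => f t / t) atTop atTop
  limit_bot : Tendsto (fun t => f t / t) atBot atTop

end SpiralingHalfPlane

end

/-! Let `-b ≤ 0` be the limit of `f(t)/t` at `0` and put `g(t) = f(t) + b t`. Adding `b u²/2` to
both parts of the energy gives `E(u) = B(u,u)/2 - J(u)`, where `B` is the energy form plus `b` times
the `L²` product and `J(u) = ∫ G(u)` with `G' = g`. Now `g(t)/t` tends to `0` at the origin,
increases with `|t|` and is unbounded, so the Nehari method applies once three facts about `H⁺` are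
known.

Coercivity. Every circle about the origin leaves the half-plane, so a test function, extended by
zero, vanishes somewhere on it. Integrating the derivative of `φ²` along the circle gives `‖u‖ ≤ 4π
‖∂_θ u‖` in `L²` (`norm_fn_le_norm_fnAngle`), hence `B` is coercive even for `b = 0`.

Compactness. Bounding `φ²` once along the circle and once along the ray from infinity, and
multiplying, gives `∫_{|x|>R} u⁴ ≤ (8/R) ‖u‖⁴` (`lintegral_tail_le`). With Rellich's theorem on
balls, obtained from a Poincaré inequality on small squares, this makes `H⁺ → L⁴` compact
(`tendsto_lintegral_pow_four`). Together with the embeddings into all even `L^q` and `g(t) = o(t)`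
at `0`, it yields that `J` is weakly continuous (`tendsto_potential`). All of this is proved for
test functions and transferred to `H⁺` by density (`coe_HPlus_eq_closure`).

Convexity along rays. The derivative of `r ↦ G(√r τ)` is `τ²/2` times `g(s)/s` at `s = √r τ`, which
increases in `r`. So `r ↦ E(√r u)` is strictly concave, and each ray meets the Nehari manifold in
exactly one point, the maximum of `E` on the ray. This is the minimax formula for the level.

Existence (`NehariSetting.exists_ground_state`). Take rays whose maxima tend to the infimum `c`,
normalize their directions `z_n` by `B(z_n,z_n) = 1`, and let `w` be a weak limit. For every `t ≥ 0`
the inequality `t²/2 - J(t z_n) ≤ max E` on the ray passes to the limit, `t²/2 - J(t w) ≤ c`. This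
excludes `w = 0`, and since `B(w,w) ≤ 1` the maximum of `E` on the ray of `w` is at most `c`. A
minimizer is critical because perturbed rays have their maxima nearby
(`NehariSetting.deriv_eq_zero`); this uses strict differentiability of `E` but no second
derivatives. -/

noncomputable section

namespace SpiralingHalfPlane

open scoped ENNReal NNReal BoundedContinuousFunction ContDiff

/-! ### Coordinates of the plane and calculus of test functions -/

/-- The point of the plane with the given coordinates. -/
def point (z : ℝ × ℝ) : Plane := !₂[z.1, z.2]

@[simp] theorem point_zero (z : ℝ × ℝ) : point z 0 = z.1 := rfl
@[simp] theorem point_one (z : ℝ × ℝ) : point z 1 = z.2 := rfl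

/-- The coordinates of a point of the plane, as a measurable equivalence. -/
def pointEquiv : ℝ × ℝ ≃ᵐ Plane :=
  (MeasurableEquiv.finTwoArrow (α := ℝ)).symm.trans (MeasurableEquiv.toLp 2 (Fin 2 → ℝ))

theorem pointEquiv_apply (z : ℝ × ℝ) : pointEquiv z = point z := by
  ext i; fin_cases i <;> rfl

theorem measurePreserving_pointEquiv : MeasurePreserving pointEquiv volume volume :=
  (PiLp.volume_preserving_toLp (Fin 2)).comp (volume_preserving_finTwoArrow ℝ).symm

theorem lintegral_point (h : Plane → ℝ≥0∞) : ∫⁻ z, h (point z) = ∫⁻ x, h x := by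
  rw [← measurePreserving_pointEquiv.lintegral_comp_emb pointEquiv.measurableEmbedding]
  simp [pointEquiv_apply]

theorem continuous_point : Continuous point := by
  unfold point
  fun_prop

theorem hasDerivAt_point {a b : ℝ → ℝ} {a' b' s : ℝ} (ha : HasDerivAt a a' s)
    (hb : HasDerivAt b b' s) : HasDerivAt (fun s => point (a s, b s)) (point (a', b')) s := by
  have h : HasDerivAt (fun s => (![a s, b s] : Fin 2 → ℝ)) ![a', b'] s := by
    rw [hasDerivAt_pi]
    intro i; fin_cases i
    · exact ha
    · exact hb
  have := ((PiLp.continuousLinearEquiv 2 ℝ (fun _ : Fin 2 => ℝ)).symm.toContinuousLinearMap.hasFDerivAt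
    (x := (![a s, b s] : Fin 2 → ℝ))).comp_hasDerivAt s h
  exact this

theorem point_eq_sum (z : ℝ × ℝ) :
    point z = z.1 • EuclideanSpace.single (0 : Fin 2) (1 : ℝ)
      + z.2 • EuclideanSpace.single (1 : Fin 2) (1 : ℝ) := by
  ext i; fin_cases i <;> simp [point]

theorem IsTestFunction.hasDerivAt_comp {φ : Plane → ℝ} (h : IsTestFunction φ) {a b : ℝ → ℝ}
    {a' b' s : ℝ} (ha : HasDerivAt a a' s) (hb : HasDerivAt b b' s) :
    HasDerivAt (fun s => φ (point (a s, b s)))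
      (a' * classicalPartial 0 φ (point (a s, b s)) + b' * classicalPartial 1 φ (point (a s, b s)))
      s := by
  have h1 := ((h.smooth.differentiable (by simp) (point (a s, b s))).hasFDerivAt).comp_hasDerivAt s
    (hasDerivAt_point ha hb)
  rw [point_eq_sum (a', b'), map_add, map_smul, map_smul] at h1
  exact h1

theorem IsTestFunction.eq_zero_of_nonpos {φ : Plane → ℝ} (h : IsTestFunction φ) {x : Plane}
    (hx : x 0 ≤ 0) : φ x = 0 :=
  image_eq_zero_of_notMem_tsupport fun hm => absurd (h.support hm) (not_lt.2 hx)

theorem IsTestFunction.partial_eq_zero_of_nonpos {φ : Plane → ℝ} (h : IsTestFunction φ)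
    (i : Fin 2) {x : Plane} (hx : x 0 ≤ 0) : classicalPartial i φ x = 0 := by
  have : x ∉ tsupport φ := fun hm => absurd (h.support hm) (not_lt.2 hx)
  unfold classicalPartial
  rw [fderiv_of_notMem_tsupport ℝ this]; rfl

/-- The angular derivative `x₁ ∂₂ φ - x₂ ∂₁ φ`. -/
def angularPartial (φ : Plane → ℝ) (x : Plane) : ℝ :=
  x 0 * classicalPartial 1 φ x - x 1 * classicalPartial 0 φ x

theorem IsTestFunction.continuous_angular {φ : Plane → ℝ} (h : IsTestFunction φ) :
    Continuous (angularPartial φ) := by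
  have h0 := h.continuous_partial 0
  have h1 := h.continuous_partial 1
  unfold angularPartial
  fun_prop

theorem IsTestFunction.compact_angular {φ : Plane → ℝ} (h : IsTestFunction φ) :
    HasCompactSupport (angularPartial φ) :=
  (HasCompactSupport.mul_left (f := fun x : Plane => x 0) (h.compact_partial 1)).sub
    (HasCompactSupport.mul_left (f := fun x : Plane => x 1) (h.compact_partial 0))

theorem IsTestFunction.memLp_angular {φ : Plane → ℝ} (h : IsTestFunction φ) :
    MemLp (angularPartial φ) 2 halfVol :=
  h.continuous_angular.memLp_of_hasCompactSupport h.compact_angular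

theorem measurableSet_halfPlane : MeasurableSet halfPlane :=
  measurableSet_lt measurable_const (by fun_prop)

theorem lintegral_halfVol_eq {h : Plane → ℝ≥0∞} (hh : ∀ x : Plane, x 0 ≤ 0 → h x = 0) :
    ∫⁻ x, h x ∂halfVol = ∫⁻ x, h x := by
  rw [← lintegral_indicator measurableSet_halfPlane]
  congr 1; ext x
  by_cases hx : x ∈ halfPlane
  · simp [hx]
  · simp [hx, hh x (not_lt.1 hx)]

/-! ### One-dimensional estimates and the Gagliardo–Nirenberg inequality -/

/-- If a function on a product is bounded by the product of a partial integral in each of the two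
variables, then its integral is at most the product of the two full integrals. -/
theorem lintegral_le_mul_of_sections {α β : Type*} [MeasurableSpace α] [MeasurableSpace β]
    {μ : Measure α} {ν : Measure β} [SFinite μ] [SFinite ν] {F A B : α × β → ℝ≥0∞}
    (hA : Measurable A) (hB : Measurable B)
    (hF : ∀ᵐ z ∂(μ.prod ν), F z ≤ (∫⁻ t, A (z.1, t) ∂ν) * ∫⁻ s, B (s, z.2) ∂μ) :
    ∫⁻ z, F z ∂(μ.prod ν) ≤ (∫⁻ z, A z ∂(μ.prod ν)) * ∫⁻ z, B z ∂(μ.prod ν) := by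
  refine (lintegral_mono_ae hF).trans (le_of_eq ?_)
  rw [lintegral_prod_mul (f := fun s => ∫⁻ t, A (s, t) ∂ν) (g := fun t => ∫⁻ s, B (s, t) ∂μ)
    hA.lintegral_prod_right'.aemeasurable hB.lintegral_prod_left'.aemeasurable,
    lintegral_prod _ hA.aemeasurable, lintegral_prod_symm' _ hB]

theorem enorm_le_lintegral_of_hasCompactSupport {h h' : ℝ → ℝ} (hd : ∀ s, HasDerivAt h (h' s) s)
    (hc : Continuous h') (hs : HasCompactSupport h) (x : ℝ) : ‖h x‖ₑ ≤ ∫⁻ s, ‖h' s‖ₑ := by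
  have e : deriv h = h' := funext fun s => (hd s).deriv
  have hC : ContDiff ℝ 1 h := contDiff_one_iff_deriv.2 ⟨fun s => (hd s).differentiableAt, e ▸ hc⟩
  refine (hs.enorm_le_lintegral_Ici_deriv hC x).trans ?_
  rw [e]
  exact setLIntegral_le_lintegral _ _

theorem enorm_le_lintegral_Ioi_of_hasCompactSupport {h h' : ℝ → ℝ}
    (hd : ∀ s, HasDerivAt h (h' s) s)
    (hc : Continuous h') (hs : HasCompactSupport h) (x : ℝ) : ‖h x‖ₑ ≤ ∫⁻ s in Ioi x, ‖h' s‖ₑ := by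
  have e : deriv h = h' := funext fun s => (hd s).deriv
  have hC : ContDiff ℝ 1 h := contDiff_one_iff_deriv.2 ⟨fun s => (hd s).differentiableAt, e ▸ hc⟩
  have := hs.integral_Ioi_deriv_eq hC x
  rw [e] at this
  calc ‖h x‖ₑ = ‖∫ s in Ioi x, h' s‖ₑ := by rw [this, enorm_neg]
    _ ≤ _ := enorm_integral_le_lintegral_enorm _

theorem enorm_sub_le_lintegral_Ioo {h h' : ℝ → ℝ} (hd : ∀ s, HasDerivAt h (h' s) s)
    (hc : Continuous h') {a b x y : ℝ} (hx : x ∈ Icc a b) (hy : y ∈ Icc a b) :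
    ‖h x - h y‖ₑ ≤ ∫⁻ s in Ioo a b, ‖h' s‖ₑ := by
  rw [← intervalIntegral.integral_eq_sub_of_hasDerivAt (fun s _ => hd s)
    (hc.intervalIntegrable _ _)]
  calc ‖∫ s in y..x, h' s‖ₑ = ‖∫ s in uIoc y x, h' s‖ₑ := by
        rw [enorm_eq_nnnorm, enorm_eq_nnnorm]; congr 1; ext
        simpa using intervalIntegral.norm_intervalIntegral_eq h' y x volume
    _ ≤ ∫⁻ s in uIoc y x, ‖h' s‖ₑ := enorm_integral_le_lintegral_enorm _
    _ ≤ ∫⁻ s in Ioc a b, ‖h' s‖ₑ := by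
        refine lintegral_mono_set ?_
        exact Ioc_subset_Ioc (le_min hy.1 hx.1) (max_le hy.2 hx.2)
    _ = _ := by rw [restrict_Ioo_eq_restrict_Ioc]

theorem norm_point (z : ℝ × ℝ) : ‖point z‖ = √(z.1 ^ 2 + z.2 ^ 2) := by
  simp [EuclideanSpace.norm_eq]

theorem abs_fst_le_norm_point (z : ℝ × ℝ) : |z.1| ≤ ‖point z‖ := by
  rw [norm_point]; exact Real.abs_le_sqrt (by nlinarith [sq_nonneg z.2])

theorem abs_snd_le_norm_point (z : ℝ × ℝ) : |z.2| ≤ ‖point z‖ := by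
  rw [norm_point]; exact Real.abs_le_sqrt (by nlinarith [sq_nonneg z.1])

theorem IsTestFunction.exists_radius {φ : Plane → ℝ} (h : IsTestFunction φ) :
    ∃ R : ℝ, ∀ x, R < ‖x‖ → φ x = 0 := by
  obtain ⟨R, hR⟩ := h.compact.isCompact.isBounded.exists_norm_le
  exact ⟨R, fun x hx => image_eq_zero_of_notMem_tsupport fun hm => absurd (hR x hm) (not_le.2 hx)⟩

/-- The planar Gagliardo–Nirenberg inequality for powers of a test function. -/
theorem IsTestFunction.lintegral_pow_le {φ : Plane → ℝ} (h : IsTestFunction φ) (m : ℕ) :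
    ∫⁻ x, ‖φ x‖ₑ ^ (2 * (m + 1)) ≤
      (∫⁻ x, ‖(m + 1) * φ x ^ m * classicalPartial 1 φ x‖ₑ) *
      (∫⁻ x, ‖(m + 1) * φ x ^ m * classicalPartial 0 φ x‖ₑ) := by
  have c := h.smooth.continuous
  have c0 := h.continuous_partial 0
  have c1 := h.continuous_partial 1
  rw [← lintegral_point, ← lintegral_point, ← lintegral_point]
  have cp := continuous_point
  refine lintegral_le_mul_of_sections (μ := volume) (ν := volume)
    (A := fun z => ‖(m + 1) * φ (point z) ^ m * classicalPartial 1 φ (point z)‖ₑ)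
    (B := fun z => ‖(m + 1) * φ (point z) ^ m * classicalPartial 0 φ (point z)‖ₑ)
    (by fun_prop) (by fun_prop) (ae_of_all _ ?_)
  rintro ⟨s, t⟩
  -- One estimate for both families of coordinate lines: `(a s, b s)` runs along a line of constant
  -- velocity `(a', b')`, and the bound on `|s|` makes the restriction of the test function
  -- compactly supported.
  have key : ∀ {a b : ℝ → ℝ} {a' b' : ℝ}, (∀ s, HasDerivAt a a' s) → (∀ s, HasDerivAt b b' s) →
      Continuous (fun s => point (a s, b s)) → (∀ s, |s| ≤ ‖point (a s, b s)‖) → ∀ s, ‖φ (point (a s, b s)) ^ (m + 1)‖ₑ ≤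
      ∫⁻ s, ‖(m + 1) * φ (point (a s, b s)) ^ m * (a' * classicalPartial 0 φ (point (a s, b s))
        + b' * classicalPartial 1 φ (point (a s, b s)))‖ₑ := by
    intro a b a' b' ha hb cc hn s
    refine enorm_le_lintegral_of_hasCompactSupport
      (h := fun s => φ (point (a s, b s)) ^ (m + 1)) (fun s => ?_) (by fun_prop) ?_ s
    · have := (h.hasDerivAt_comp (ha s) (hb s)).fun_pow (m + 1)
      simpa using this
    · obtain ⟨R, hR⟩ := h.exists_radius
      refine HasCompactSupport.intro (isCompact_Icc (a := -R) (b := R)) fun x hx => ?_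
      rw [hR _ (lt_of_lt_of_le ?_ (hn x)), zero_pow (by simp)]
      by_contra hcon
      exact hx (abs_le.1 (not_lt.1 hcon))
  have h1 := key (fun t => hasDerivAt_const t s) (fun t => hasDerivAt_id t)
    (by fun_prop) (fun t => abs_snd_le_norm_point (s, t)) t
  have h2 := key (fun t => hasDerivAt_id t) (fun s => hasDerivAt_const s t)
    (by fun_prop) (fun s => abs_fst_le_norm_point (s, t)) s
  simp only [zero_mul, one_mul, zero_add, add_zero, id] at h1 h2
  calc ‖φ (point (s, t))‖ₑ ^ (2 * (m + 1)) = ‖φ (point (s, t)) ^ (m + 1)‖ₑ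
        * ‖φ (point (s, t)) ^ (m + 1)‖ₑ := by
        rw [enorm_pow]; ring
    _ ≤ _ := mul_le_mul' h1 h2


/-! ### Polar coordinates: angular Poincaré inequality and decay at infinity -/

/-- The point with the given polar coordinates. -/
def polarPoint (z : ℝ × ℝ) : Plane := point (z.1 * Real.cos z.2, z.1 * Real.sin z.2)

theorem continuous_polarPoint : Continuous polarPoint :=
  continuous_point.comp (by fun_prop)

theorem norm_polarPoint (z : ℝ × ℝ) : ‖polarPoint z‖ = |z.1| := by
  rw [polarPoint, norm_point, ← Real.sqrt_sq_eq_abs]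
  congr 1
  simp only
  nlinarith [Real.sin_sq_add_cos_sq z.2]

/-- The measure `dr dθ` on the set of polar coordinates of the plane. -/
abbrev polarVol : Measure (ℝ × ℝ) :=
  (volume.restrict (Ioi (0 : ℝ))).prod (volume.restrict (Ioo (-Real.pi) Real.pi))

theorem lintegral_polar (h : Plane → ℝ≥0∞) :
    ∫⁻ z, ENNReal.ofReal z.1 * h (polarPoint z) ∂polarVol = ∫⁻ x, h x := by
  rw [← lintegral_point, ← lintegral_comp_polarCoord_symm, polarVol, Measure.prod_restrict]
  rfl

theorem ae_polarVol_pos : ∀ᵐ z ∂polarVol, 0 < z.1 ∧ z.2 ∈ Icc (-Real.pi) Real.pi := by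
  rw [polarVol, Measure.prod_restrict]
  filter_upwards [ae_restrict_mem (measurableSet_Ioi.prod measurableSet_Ioo)] with z hz
  exact ⟨hz.1, Ioo_subset_Icc_self hz.2⟩

theorem IsTestFunction.hasDerivAt_angle {φ : Plane → ℝ} (h : IsTestFunction φ) (r s : ℝ) :
    HasDerivAt (fun s => φ (polarPoint (r, s)) ^ 2)
      (2 * φ (polarPoint (r, s)) * angularPartial φ (polarPoint (r, s))) s := by
  have h1 := (h.hasDerivAt_comp ((Real.hasDerivAt_cos s).const_mul r)
    ((Real.hasDerivAt_sin s).const_mul r)).fun_pow 2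
  refine h1.congr_deriv ?_
  simp only [polarPoint, angularPartial, point_zero, point_one]
  push_cast
  ring

/-- The square of a test function is controlled by the integral of its angular derivative over
the circle. -/
theorem IsTestFunction.sq_le_lintegral_angle {φ : Plane → ℝ} (h : IsTestFunction φ) {r t : ℝ}
    (hr : 0 < r) (ht : t ∈ Icc (-Real.pi) Real.pi) :
    ‖φ (polarPoint (r, t))‖ₑ ^ 2 ≤ ∫⁻ s in Ioo (-Real.pi) Real.pi,
      ‖2 * φ (polarPoint (r, s)) * angularPartial φ (polarPoint (r, s))‖ₑ := by
  have c := h.smooth.continuous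
  have ca := h.continuous_angular
  have cp := continuous_polarPoint
  -- The angle `-π` is the point `(-r, 0)`, which lies outside the half-plane; this zero is where
  -- the integration along the circle starts.
  have h0 : φ (polarPoint (r, -Real.pi)) = 0 := h.eq_zero_of_nonpos (by
    simp [polarPoint, hr.le])
  have := enorm_sub_le_lintegral_Ioo (h.hasDerivAt_angle r) (by fun_prop) ht
    (left_mem_Icc.2 (by linarith [Real.pi_pos]))
  simpa [h0, enorm_pow] using this

/-- Integrating from infinity inward keeps the integral over radii larger than `r`, which is what
lets a factor `R < r` be replaced by the Jacobian weight later on. -/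
theorem IsTestFunction.sq_le_lintegral_radius {φ : Plane → ℝ} (h : IsTestFunction φ) (r t : ℝ) :
    ‖φ (polarPoint (r, t))‖ₑ ^ 2 ≤ ∫⁻ s in Ioi r,
      ‖2 * φ (polarPoint (s, t)) * (Real.cos t * classicalPartial 0 φ (polarPoint (s, t))
        + Real.sin t * classicalPartial 1 φ (polarPoint (s, t)))‖ₑ := by
  have c := h.smooth.continuous
  have c0 := h.continuous_partial 0
  have c1 := h.continuous_partial 1
  have cp := continuous_polarPoint
  have hd : ∀ s, HasDerivAt (fun s => φ (polarPoint (s, t)) ^ 2)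
      (2 * φ (polarPoint (s, t)) * (Real.cos t * classicalPartial 0 φ (polarPoint (s, t))
        + Real.sin t * classicalPartial 1 φ (polarPoint (s, t)))) s := fun s => by
    have h1 := (h.hasDerivAt_comp ((hasDerivAt_id s).mul_const (Real.cos t))
      ((hasDerivAt_id s).mul_const (Real.sin t))).fun_pow 2
    refine h1.congr_deriv ?_
    simp [polarPoint]
  have hs : HasCompactSupport (fun s => φ (polarPoint (s, t)) ^ 2) := by
    obtain ⟨R, hR⟩ := h.exists_radius
    refine HasCompactSupport.intro (isCompact_Icc (a := -R) (b := R)) fun x hx => ?_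
    rw [hR _ ?_, zero_pow (by simp)]
    rw [norm_polarPoint]
    by_contra hcon
    exact hx (abs_le.1 (not_lt.1 hcon))
  have := enorm_le_lintegral_Ioi_of_hasCompactSupport hd (by fun_prop) hs r
  simpa [enorm_pow] using this

/-- The angular Poincaré inequality for test functions. -/
theorem IsTestFunction.lintegral_sq_le_angular {φ : Plane → ℝ} (h : IsTestFunction φ) :
    ∫⁻ x, ‖φ x‖ₑ ^ 2 ≤
      ENNReal.ofReal (2 * Real.pi) * ∫⁻ x, ‖2 * φ x * angularPartial φ x‖ₑ := by
  have c := h.smooth.continuous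
  have ca := h.continuous_angular
  have cp := continuous_polarPoint
  set A : ℝ × ℝ → ℝ≥0∞ := fun z => ENNReal.ofReal z.1 *
    ‖2 * φ (polarPoint z) * angularPartial φ (polarPoint z)‖ₑ with hA
  have mA : Measurable A := by fun_prop
  rw [← lintegral_polar, ← lintegral_polar (fun x => ‖2 * φ x * angularPartial φ x‖ₑ)]
  -- The bound along the circle does not depend on the angle, so integrating in the angle only
  -- contributes the length `2π`.
  calc ∫⁻ z, ENNReal.ofReal z.1 * ‖φ (polarPoint z)‖ₑ ^ 2 ∂polarVol
      ≤ ∫⁻ z, (∫⁻ t in Ioo (-Real.pi) Real.pi, A (z.1, t)) * 1 ∂polarVol := by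
        refine lintegral_mono_ae ?_
        filter_upwards [ae_polarVol_pos] with z hz
        rw [mul_one, hA]
        simp only
        rw [lintegral_const_mul _ (by fun_prop)]
        exact mul_le_mul' le_rfl (h.sq_le_lintegral_angle hz.1 hz.2)
    _ = (∫⁻ s in Ioi (0 : ℝ), ∫⁻ t in Ioo (-Real.pi) Real.pi, A (s, t)) *
        ∫⁻ _ in Ioo (-Real.pi) Real.pi, 1 :=
        lintegral_prod_mul (g := fun _ => (1 : ℝ≥0∞)) mA.lintegral_prod_right'.aemeasurable
          aemeasurable_const
    _ = ENNReal.ofReal (2 * Real.pi) * ∫⁻ z, A z ∂polarVol := by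
        rw [lintegral_prod _ mA.aemeasurable, mul_comm]
        congr 1
        rw [lintegral_one, Measure.restrict_apply_univ, Real.volume_Ioo]
        congr 1; ring

/-- Decay at infinity of the fourth moment of a test function. -/
theorem IsTestFunction.lintegral_tail_le {φ : Plane → ℝ} (h : IsTestFunction φ) (R : ℝ) :
    ENNReal.ofReal R * ∫⁻ x, {x : Plane | R < ‖x‖}.indicator 1 x * ‖φ x‖ₑ ^ 4 ≤
      (∫⁻ x, ‖2 * φ x * angularPartial φ x‖ₑ) *
      ∫⁻ x, ‖2 * φ x‖ₑ * (‖classicalPartial 0 φ x‖ₑ + ‖classicalPartial 1 φ x‖ₑ) := by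
  have c := h.smooth.continuous
  have ca := h.continuous_angular
  have c0 := h.continuous_partial 0
  have c1 := h.continuous_partial 1
  have cp := continuous_polarPoint
  have mI : Measurable ({x : Plane | R < ‖x‖}.indicator (1 : Plane → ℝ≥0∞)) :=
    measurable_one.indicator (measurableSet_lt measurable_const measurable_norm)
  rw [← lintegral_const_mul _ (by fun_prop), ← lintegral_polar, ← lintegral_polar (fun x =>
    ‖2 * φ x * angularPartial φ x‖ₑ), ← lintegral_polar (fun x =>
    ‖2 * φ x‖ₑ * (‖classicalPartial 0 φ x‖ₑ + ‖classicalPartial 1 φ x‖ₑ))]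
  refine lintegral_le_mul_of_sections (by fun_prop) (by fun_prop) ?_
  filter_upwards [ae_polarVol_pos] with z hz
  by_cases hzR : R < z.1
  swap
  · have : polarPoint z ∉ {x : Plane | R < ‖x‖} := by
      simpa [norm_polarPoint, abs_of_pos hz.1] using hzR
    simp [this]
  have hm : polarPoint z ∈ {x : Plane | R < ‖x‖} := by
      simpa [norm_polarPoint, abs_of_pos hz.1] using hzR
  simp only [hm, indicator_of_mem, Pi.one_apply, one_mul]
  rw [lintegral_const_mul _ (by fun_prop)]
  have h1 := h.sq_le_lintegral_angle hz.1 hz.2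
  have h2 := h.sq_le_lintegral_radius z.1 z.2
  -- Since `R < r < s` on the domain of integration, the constant `R` is at most the polar Jacobian
  -- `s`. The Jacobian `r` of the left-hand side is left over for the angular factor.
  have h3 : ENNReal.ofReal R * ∫⁻ s in Ioi z.1,
      ‖2 * φ (polarPoint (s, z.2)) * (Real.cos z.2 * classicalPartial 0 φ (polarPoint (s, z.2))
        + Real.sin z.2 * classicalPartial 1 φ (polarPoint (s, z.2)))‖ₑ ≤
      ∫⁻ s in Ioi 0, ENNReal.ofReal s * (‖2 * φ (polarPoint (s, z.2))‖ₑ *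
        (‖classicalPartial 0 φ (polarPoint (s, z.2))‖ₑ
          + ‖classicalPartial 1 φ (polarPoint (s, z.2))‖ₑ)) := by
    rw [← lintegral_const_mul _ (by fun_prop)]
    refine le_trans ?_ (lintegral_mono_set (Ioi_subset_Ioi hz.1.le))
    refine setLIntegral_mono (by fun_prop) fun s hs => ?_
    refine mul_le_mul' (ENNReal.ofReal_le_ofReal (hzR.trans hs).le) ?_
    rw [enorm_mul]
    refine mul_le_mul' le_rfl ((enorm_add_le _ _).trans (add_le_add ?_ ?_))
    · rw [enorm_mul]
      refine mul_le_of_le_one_left' ?_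
      rw [Real.enorm_eq_ofReal_abs, ENNReal.ofReal_le_one]
      exact Real.abs_cos_le_one _
    · rw [enorm_mul]
      refine mul_le_of_le_one_left' ?_
      rw [Real.enorm_eq_ofReal_abs, ENNReal.ofReal_le_one]
      exact Real.abs_sin_le_one _
  calc ENNReal.ofReal z.1 * (ENNReal.ofReal R * ‖φ (polarPoint z)‖ₑ ^ 4)
      = (ENNReal.ofReal z.1 * ‖φ (polarPoint z)‖ₑ ^ 2)
        * (ENNReal.ofReal R * ‖φ (polarPoint z)‖ₑ ^ 2) := by ring
    _ ≤ _ := mul_le_mul' (mul_le_mul' le_rfl h1) ((mul_le_mul' le_rfl h2).trans h3)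

/-! ### Poincaré inequality on small squares -/

/-- The half-open square with the given side whose lower left corner has the given coordinates. -/
def cell (ε : ℝ) (c : ℝ × ℝ) : Set Plane :=
  {x | x 0 ∈ Ico c.1 (c.1 + ε) ∧ x 1 ∈ Ico c.2 (c.2 + ε)}


theorem measurableSet_cell (ε : ℝ) (c : ℝ × ℝ) : MeasurableSet (cell ε c) := by
  have h0 : Measurable fun x : Plane => x 0 := by fun_prop
  have h1 : Measurable fun x : Plane => x 1 := by fun_prop
  exact (h0 measurableSet_Ico).inter (h1 measurableSet_Ico)

theorem sq_lintegral_le {α : Type*} [MeasurableSpace α] {μ : Measure α} {h : α → ℝ≥0∞}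
    (hh : AEMeasurable h μ) : (∫⁻ x, h x ∂μ) ^ 2 ≤ μ univ * ∫⁻ x, h x ^ 2 ∂μ := by
  have := ENNReal.lintegral_mul_le_Lp_mul_Lq μ Real.HolderConjugate.two_two hh
    (aemeasurable_const (b := (1 : ℝ≥0∞)))
  simp only [Pi.mul_apply, mul_one, ENNReal.rpow_two, one_pow, lintegral_one] at this
  calc (∫⁻ x, h x ∂μ) ^ 2 ≤ ((∫⁻ x, h x ^ 2 ∂μ) ^ (1 / 2 : ℝ) * μ univ ^ (1 / 2 : ℝ)) ^ 2 := by
        gcongr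
    _ = _ := by
        rw [mul_pow, ← ENNReal.rpow_natCast, ← ENNReal.rpow_natCast, ← ENNReal.rpow_mul,
          ← ENNReal.rpow_mul]
        norm_num
        rw [mul_comm]

theorem add_sq_le_three (a b c : ℝ≥0∞) : (a + b + c) ^ 2 ≤ 3 * (a ^ 2 + b ^ 2 + c ^ 2) := by
  by_cases h : a = ⊤ ∨ b = ⊤ ∨ c = ⊤
  · have : 3 * (a ^ 2 + b ^ 2 + c ^ 2) = ⊤ := by
      rcases h with h | h | h <;> simp [h]
    rw [this]; exact le_top
  · push Not at h
    obtain ⟨ha, hb, hc⟩ := h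
    lift a to ℝ≥0 using ha
    lift b to ℝ≥0 using hb
    lift c to ℝ≥0 using hc
    norm_cast
    rw [← NNReal.coe_le_coe]
    push_cast
    nlinarith [sq_nonneg ((a : ℝ) - b), sq_nonneg ((b : ℝ) - c), sq_nonneg ((a : ℝ) - c)]

/-- The volume of the parameter square of a cell. -/
abbrev squareVol (ε : ℝ) (c : ℝ × ℝ) : Measure (ℝ × ℝ) :=
  (volume.restrict (Ico c.1 (c.1 + ε))).prod (volume.restrict (Ico c.2 (c.2 + ε)))

theorem setLIntegral_cell (ε : ℝ) (c : ℝ × ℝ) {h : Plane → ℝ≥0∞} :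
    ∫⁻ z, h (point z) ∂(squareVol ε c) = ∫⁻ x in cell ε c, h x := by
  rw [squareVol, Measure.prod_restrict, ← lintegral_indicator (measurableSet_Ico.prod measurableSet_Ico),
    ← lintegral_indicator (measurableSet_cell ε c), ← lintegral_point]
  rfl

theorem setIntegral_cell (ε : ℝ) (c : ℝ × ℝ) {h : Plane → ℝ} :
    ∫ z, h (point z) ∂(squareVol ε c) = ∫ x in cell ε c, h x := by
  rw [squareVol, Measure.prod_restrict, ← integral_indicator (measurableSet_Ico.prod measurableSet_Ico),
    ← integral_indicator (measurableSet_cell ε c),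
    ← measurePreserving_pointEquiv.integral_comp pointEquiv.measurableEmbedding]
  simp only [pointEquiv_apply]
  rfl

/-- The Poincaré inequality on a cell. -/
theorem IsTestFunction.lintegral_cell_le {φ : Plane → ℝ} (h : IsTestFunction φ) {ε : ℝ}
    (hε : 0 < ε) (c : ℝ × ℝ) :
    ENNReal.ofReal ε ^ 4 * ∫⁻ x in cell ε c, ‖φ x‖ₑ ^ 2 ≤
      3 * (ENNReal.ofReal ε ^ 2 * ‖∫ x in cell ε c, φ x‖ₑ ^ 2 + ENNReal.ofReal ε ^ 6 *
        ∫⁻ x in cell ε c, (‖classicalPartial 0 φ x‖ₑ ^ 2 + ‖classicalPartial 1 φ x‖ₑ ^ 2)) := by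
  have cφ := h.smooth.continuous
  have c0 := h.continuous_partial 0
  have c1 := h.continuous_partial 1
  have cp := continuous_point
  have mφ := cφ.measurable
  have m0 := c0.measurable
  have m1 := c1.measurable
  have mp := cp.measurable
  set e := ENNReal.ofReal ε with he
  set I := Ico c.1 (c.1 + ε) with hI
  set J := Ico c.2 (c.2 + ε) with hJ
  have vI : volume.restrict I univ = e := by simp [hI, he]
  have vJ : volume.restrict J univ = e := by simp [hJ, he]
  have vIJ : squareVol ε c univ = e ^ 2 := by
    rw [squareVol, ← univ_prod_univ, Measure.prod_prod, vI, vJ, sq]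
  rw [← setLIntegral_cell, ← setIntegral_cell, ← setLIntegral_cell]
  set A : ℝ → ℝ≥0∞ := fun s => ∫⁻ t in J, ‖classicalPartial 1 φ (point (s, t))‖ₑ with hA
  set B : ℝ → ℝ≥0∞ := fun t => ∫⁻ s in I, ‖classicalPartial 0 φ (point (s, t))‖ₑ with hB
  have mA : Measurable A := Measurable.lintegral_prod_right'
    (f := fun z => ‖classicalPartial 1 φ (point z)‖ₑ) (by fun_prop)
  have mB : Measurable B := Measurable.lintegral_prod_left'
    (f := fun z => ‖classicalPartial 0 φ (point z)‖ₑ) (by fun_prop)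
  set N : ℝ≥0∞ := ∫⁻ z, ‖classicalPartial 0 φ (point z)‖ₑ ∂(squareVol ε c) with hN
  -- The two points are joined by a vertical segment at abscissa `s` followed by a horizontal one at
  -- height `t'`, so the bound separates into a function of `s` and a function of `t'`.
  have hdiff : ∀ s ∈ I, ∀ t ∈ J, ∀ s' ∈ I, ∀ t' ∈ J,
      ‖φ (point (s, t)) - φ (point (s', t'))‖ₑ ≤ A s + B t' := by
    intro s hs t ht s' hs' t' ht'
    have h1 := enorm_sub_le_lintegral_Ioo (h' := fun t => classicalPartial 1 φ (point (s, t)))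
      (fun t => by simpa using h.hasDerivAt_comp (hasDerivAt_const t s) (hasDerivAt_id t))
      (by fun_prop) (Ico_subset_Icc_self ht) (Ico_subset_Icc_self ht')
    have h2 := enorm_sub_le_lintegral_Ioo (h' := fun s => classicalPartial 0 φ (point (s, t')))
      (fun s => by simpa using h.hasDerivAt_comp (hasDerivAt_id s) (hasDerivAt_const s t'))
      (by fun_prop) (Ico_subset_Icc_self hs) (Ico_subset_Icc_self hs')
    rw [restrict_Ioo_eq_restrict_Ico] at h1 h2
    calc _ = ‖(φ (point (s, t)) - φ (point (s, t'))) + (φ (point (s, t')) - φ (point (s', t')))‖ₑ := by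
          congr 1; ring
      _ ≤ _ := (enorm_add_le _ _).trans (add_le_add h1 h2)
  have haemem : ∀ᵐ z ∂(squareVol ε c), z.1 ∈ I ∧ z.2 ∈ J := by
    rw [squareVol, Measure.prod_restrict]
    exact ae_restrict_mem (measurableSet_Ico.prod measurableSet_Ico)
  have hint : Integrable (fun z => φ (point z)) (squareVol ε c) := by
    obtain ⟨C, hC⟩ := h.compact.exists_bound_of_continuous cφ
    exact Integrable.of_bound (by fun_prop) C (ae_of_all _ fun z => hC _)
  set m : ℝ := ∫ z, φ (point z) ∂(squareVol ε c) with hm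
  -- The previous bound is averaged over `(s', t')`. Everything is multiplied by the area `e ^ 2` so
  -- that no division occurs in `ℝ≥0∞`.
  have hpt : ∀ z : ℝ × ℝ, z.1 ∈ I → z.2 ∈ J →
      e ^ 2 * ‖φ (point z)‖ₑ ≤ ‖m‖ₑ + e ^ 2 * A z.1 + e * N := by
    rintro ⟨s, t⟩ hs ht
    have h1 : ε ^ 2 * φ (point (s, t)) - m = ∫ w, (φ (point (s, t)) - φ (point w)) ∂(squareVol ε c) := by
      rw [integral_sub (integrable_const _) hint, integral_const, measureReal_def, vIJ]
      simp [he, hε.le, hm]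
    have h2 : ‖ε ^ 2 * φ (point (s, t)) - m‖ₑ ≤ e ^ 2 * A s + e * N := by
      rw [h1]
      refine (enorm_integral_le_lintegral_enorm _).trans ?_
      calc _ ≤ ∫⁻ w, (A s + B w.2) ∂(squareVol ε c) := by
            refine lintegral_mono_ae ?_
            filter_upwards [haemem] with w hw
            exact hdiff s hs t ht w.1 hw.1 w.2 hw.2
        _ = _ := by
            rw [lintegral_add_left measurable_const, lintegral_const, vIJ, mul_comm]
            congr 1
            have := lintegral_prod_mul (μ := volume.restrict I) (ν := volume.restrict J)
              (f := fun _ => (1 : ℝ≥0∞)) (g := B) aemeasurable_const mB.aemeasurable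
            simp only [one_mul, lintegral_one, vI] at this
            rw [this, hN, lintegral_prod_symm' _ (by fun_prop)]
    calc e ^ 2 * ‖φ (point (s, t))‖ₑ = ‖m + (ε ^ 2 * φ (point (s, t)) - m)‖ₑ := by
          rw [add_sub_cancel, enorm_mul, enorm_pow, Real.enorm_of_nonneg hε.le]
      _ ≤ _ := (enorm_add_le _ _).trans (by rw [add_assoc]; exact add_le_add le_rfl h2)
  calc e ^ 4 * ∫⁻ z, ‖φ (point z)‖ₑ ^ 2 ∂(squareVol ε c)
      = ∫⁻ z, (e ^ 2 * ‖φ (point z)‖ₑ) ^ 2 ∂(squareVol ε c) := by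
        rw [← lintegral_const_mul _ (by fun_prop)]
        congr 1; ext z; ring
    _ ≤ ∫⁻ z, 3 * (‖m‖ₑ ^ 2 + (e ^ 2 * A z.1) ^ 2 + (e * N) ^ 2) ∂(squareVol ε c) := by
        refine lintegral_mono_ae ?_
        filter_upwards [haemem] with z hz
        refine le_trans ?_ (add_sq_le_three _ _ _)
        gcongr
        exact hpt z hz.1 hz.2
    _ = 3 * (e ^ 2 * ‖m‖ₑ ^ 2 + e ^ 4 * (e * ∫⁻ s in I, A s ^ 2) + e ^ 4 * N ^ 2) := by
        have hA2 : ∫⁻ z, (e ^ 2 * A z.1) ^ 2 ∂(squareVol ε c) = e ^ 4 * (e * ∫⁻ s in I, A s ^ 2) := by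
          have := lintegral_prod_mul (μ := volume.restrict I) (ν := volume.restrict J)
            (f := fun s => (e ^ 2 * A s) ^ 2) (g := fun _ => (1 : ℝ≥0∞)) (by fun_prop) aemeasurable_const
          simp only [mul_one, lintegral_one, vJ] at this
          rw [this, mul_comm]
          simp only [mul_pow]
          rw [lintegral_const_mul _ (by fun_prop)]
          ring
        rw [lintegral_const_mul _ (by fun_prop), lintegral_add_right _ (by fun_prop),
          lintegral_add_right _ (by fun_prop), hA2, lintegral_const, lintegral_const, vIJ]
        ring
    _ ≤ 3 * (e ^ 2 * ‖m‖ₑ ^ 2 + e ^ 4 * (e * (e * ∫⁻ z, ‖classicalPartial 1 φ (point z)‖ₑ ^ 2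
          ∂(squareVol ε c))) + e ^ 4 * (e ^ 2 * ∫⁻ z, ‖classicalPartial 0 φ (point z)‖ₑ ^ 2
          ∂(squareVol ε c))) := by
        gcongr
        · rw [lintegral_prod _ (by fun_prop), ← lintegral_const_mul _ (Measurable.lintegral_prod_right'
            (f := fun z => ‖classicalPartial 1 φ (point z)‖ₑ ^ 2) (by fun_prop))]
          refine lintegral_mono fun s => ?_
          have := sq_lintegral_le (μ := volume.restrict J)
            (h := fun t => ‖classicalPartial 1 φ (point (s, t))‖ₑ) (by fun_prop)
          rwa [vJ] at this
        · have := sq_lintegral_le (μ := squareVol ε c)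
            (h := fun z => ‖classicalPartial 0 φ (point z)‖ₑ) (by fun_prop)
          rwa [vIJ] at this
    _ = _ := by
        rw [lintegral_add_left (by fun_prop)]
        ring

/-- The cell with the given index in the square grid of mesh `ε`. -/
def gridCell (ε : ℝ) (k : ℤ × ℤ) : Set Plane := cell ε (k.1 * ε, k.2 * ε)

theorem measurableSet_gridCell (ε : ℝ) (k : ℤ × ℤ) : MeasurableSet (gridCell ε k) :=
  measurableSet_cell _ _

/-- The indices of the grid cells that cover the ball of radius `N ε`. -/
def gridIndices (N : ℕ) : Finset (ℤ × ℤ) := Finset.Ico (-(N : ℤ)) N ×ˢ Finset.Ico (-(N : ℤ)) N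

theorem mem_Ico_mul_iff {ε : ℝ} (hε : 0 < ε) (k : ℤ) (s : ℝ) :
    s ∈ Ico (k * ε) (k * ε + ε) ↔ ⌊s / ε⌋ = k := by
  rw [Int.floor_eq_iff, le_div_iff₀ hε, div_lt_iff₀ hε, add_mul, one_mul]
  rfl

theorem pairwise_disjoint_gridCell {ε : ℝ} (hε : 0 < ε) : Pairwise (Function.onFun Disjoint (gridCell ε)) := by
  intro k l hkl
  refine Set.disjoint_left.2 ?_
  rintro x ⟨h0, h1⟩ ⟨g0, g1⟩
  rw [mem_Ico_mul_iff hε] at h0 h1 g0 g1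
  exact hkl (Prod.ext (h0.symm.trans g0) (h1.symm.trans g1))

theorem ball_subset_gridCells {ε : ℝ} (hε : 0 < ε) (N : ℕ) :
    Metric.ball (0 : Plane) (N * ε) ⊆ ⋃ k ∈ gridIndices N, gridCell ε k := by
  intro x hx
  have hx : ‖x‖ < N * ε := by simpa using hx
  have hc : ∀ i, ⌊x i / ε⌋ ∈ Finset.Ico (-(N : ℤ)) N := by
    intro i
    have h1 := abs_lt.1 ((PiLp.norm_apply_le x i).trans_lt hx)
    rw [Finset.mem_Ico, Int.le_floor, Int.floor_lt, le_div_iff₀ hε, div_lt_iff₀ hε]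
    push_cast
    exact ⟨by linarith [h1.1], h1.2⟩
  refine mem_biUnion (x := (⌊x 0 / ε⌋, ⌊x 1 / ε⌋)) (Finset.mem_product.2 ⟨hc 0, hc 1⟩) ?_
  exact ⟨(mem_Ico_mul_iff hε _ _).2 rfl, (mem_Ico_mul_iff hε _ _).2 rfl⟩

/-- Up to finitely many averages, a test function is small in `L²` of a ball relative to its
gradient. -/
theorem IsTestFunction.lintegral_ball_le {φ : Plane → ℝ} (h : IsTestFunction φ) {ε : ℝ}
    (hε : 0 < ε) (N : ℕ) :
    ENNReal.ofReal ε ^ 4 * ∫⁻ x, (Metric.ball 0 (N * ε)).indicator 1 x * ‖φ x‖ₑ ^ 2 ∂halfVol ≤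
      3 * (ENNReal.ofReal ε ^ 2 * ∑ k ∈ gridIndices N, ‖∫ x in gridCell ε k, φ x ∂halfVol‖ₑ ^ 2 +
        ENNReal.ofReal ε ^ 6 *
        ∫⁻ x, (‖classicalPartial 0 φ x‖ₑ ^ 2 + ‖classicalPartial 1 φ x‖ₑ ^ 2) ∂halfVol) := by
  have disj : ∀ s : Set (ℤ × ℤ), s.PairwiseDisjoint (gridCell ε) := fun s =>
    (pairwise_disjoint_gridCell hε).set_pairwise _
  have hcell : ∀ k, ∫ x in gridCell ε k, φ x ∂halfVol = ∫ x in gridCell ε k, φ x := fun k => by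
    rw [Measure.restrict_restrict (measurableSet_gridCell ε k)]
    refine (setIntegral_eq_of_subset_of_forall_sdiff_eq_zero (measurableSet_gridCell ε k)
      inter_subset_left fun x hx => h.eq_zero_of_nonpos ?_).symm
    by_contra hcon
    exact hx.2 ⟨hx.1, not_le.1 hcon⟩
  rw [lintegral_halfVol_eq (fun x hx => by simp [h.eq_zero_of_nonpos hx]),
    lintegral_halfVol_eq (fun x hx => by simp [h.partial_eq_zero_of_nonpos _ hx])]
  simp only [hcell]
  set D : Plane → ℝ≥0∞ := fun x => ‖classicalPartial 0 φ x‖ₑ ^ 2 + ‖classicalPartial 1 φ x‖ₑ ^ 2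
  calc _ ≤ ENNReal.ofReal ε ^ 4 * ∫⁻ x in ⋃ k ∈ gridIndices N, gridCell ε k, ‖φ x‖ₑ ^ 2 := by
        refine mul_le_mul' le_rfl ?_
        refine le_trans (le_of_eq ?_) (lintegral_mono_set (ball_subset_gridCells hε N))
        rw [← lintegral_indicator measurableSet_ball]
        congr 1; ext x
        by_cases hx : x ∈ Metric.ball (0 : Plane) (N * ε) <;> simp only [hx, indicator_of_mem,
          indicator_of_notMem, not_false_eq_true, Pi.one_apply, one_mul, zero_mul]
    _ = ∑ k ∈ gridIndices N, ENNReal.ofReal ε ^ 4 * ∫⁻ x in gridCell ε k, ‖φ x‖ₑ ^ 2 := by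
        rw [lintegral_biUnion_finset (disj _) fun k _ => measurableSet_gridCell ε k, Finset.mul_sum]
    _ ≤ ∑ k ∈ gridIndices N, 3 * (ENNReal.ofReal ε ^ 2 * ‖∫ x in gridCell ε k, φ x‖ₑ ^ 2 +
          ENNReal.ofReal ε ^ 6 * ∫⁻ x in gridCell ε k, D x) :=
        Finset.sum_le_sum fun k _ => h.lintegral_cell_le hε _
    _ = 3 * (ENNReal.ofReal ε ^ 2 * ∑ k ∈ gridIndices N, ‖∫ x in gridCell ε k, φ x‖ₑ ^ 2 +
          ENNReal.ofReal ε ^ 6 * ∫⁻ x in ⋃ k ∈ gridIndices N, gridCell ε k, D x) := by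
        rw [lintegral_biUnion_finset (disj _) fun k _ => measurableSet_gridCell ε k,
          ← Finset.mul_sum, Finset.sum_add_distrib, Finset.mul_sum, Finset.mul_sum]
    _ ≤ _ := by
        gcongr
        exact Measure.restrict_le_self

/-! ### Multiplication operators on `L²` -/

theorem integral_mul_eq_inner (u : L2Half) {ψ : Plane → ℝ} (h : MemLp ψ 2 halfVol) :
    ∫ x, u x * ψ x ∂halfVol = inner ℝ (h.toLp ψ) u := by
  rw [L2.inner_def]
  refine integral_congr_ae ?_
  filter_upwards [h.coeFn_toLp] with x hx
  simp [hx]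

theorem norm_sq_eq_integral (u : L2Half) : ‖u‖ ^ 2 = ∫ x, u x ^ 2 ∂halfVol := by
  rw [← real_inner_self_eq_norm_sq, L2.inner_def]
  simp [sq]

theorem memLp_bounded_mul (m : Plane →ᵇ ℝ) (v : L2Half) :
    MemLp (fun x => m x * v x) 2 halfVol :=
  (Lp.memLp v).of_le_mul (c := ‖m‖) (m.continuous.aestronglyMeasurable.mul
    (Lp.aestronglyMeasurable v)) (ae_of_all _ fun x => by
      rw [norm_mul]; gcongr; exact m.norm_coe_le_norm x)

/-- Multiplication by a bounded continuous function as an operator on `L²`. -/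
def mulL (m : Plane →ᵇ ℝ) : L2Half →L[ℝ] L2Half :=
  LinearMap.mkContinuous
    { toFun := fun v => (memLp_bounded_mul m v).toLp _
      map_add' := fun u v => by
        rw [← MemLp.toLp_add]
        refine MemLp.toLp_congr _ _ ?_
        filter_upwards [Lp.coeFn_add u v] with x hx
        simp only [hx, Pi.add_apply]; ring
      map_smul' := fun c v => by
        rw [RingHom.id_apply, ← MemLp.toLp_const_smul]
        refine MemLp.toLp_congr _ _ ?_
        filter_upwards [Lp.coeFn_smul c v] with x hx
        simp only [hx, Pi.smul_apply, smul_eq_mul]; ring }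
    ‖m‖ fun v => by
      refine Lp.norm_le_mul_norm_of_ae_le_mul ?_
      filter_upwards [(memLp_bounded_mul m v).coeFn_toLp] with x hx
      change ‖(memLp_bounded_mul m v).toLp _ x‖ ≤ _
      rw [hx, norm_mul]
      gcongr
      exact m.norm_coe_le_norm x

theorem coeFn_mulL (m : Plane →ᵇ ℝ) (v : L2Half) :
    (mulL m v : Plane → ℝ) =ᵐ[halfVol] fun x => m x * v x :=
  (memLp_bounded_mul m v).coeFn_toLp

theorem mulL_toLp (m : Plane →ᵇ ℝ) {f g : Plane → ℝ} (hf : MemLp f 2 halfVol)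
    (hg : MemLp g 2 halfVol) (h : ∀ x, g x = m x * f x) : mulL m (hf.toLp f) = hg.toLp g := by
  refine Lp.ext ?_
  filter_upwards [coeFn_mulL m (hf.toLp f), hf.coeFn_toLp, hg.coeFn_toLp] with x h1 h2 h3
  rw [h1, h2, h3, h]

/-- Dominated convergence. The convergence is only strong, not in operator norm: the sup norms of
the multipliers need not tend to zero, as for the cutoffs minus one. -/
theorem tendsto_mulL_zero {m : ℕ → Plane →ᵇ ℝ} {C : ℝ} (hC : ∀ k x, |m k x| ≤ C)
    (hm : ∀ x, Tendsto (fun k => m k x) atTop (𝓝 0)) (v : L2Half) :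
    Tendsto (fun k => mulL (m k) v) atTop (𝓝 0) := by
  rw [tendsto_zero_iff_norm_tendsto_zero]
  have h : Tendsto (fun k => ‖mulL (m k) v‖ ^ 2) atTop (𝓝 0) := by
    have e : ∀ k, ‖mulL (m k) v‖ ^ 2 = ∫ x, (m k x * v x) ^ 2 ∂halfVol := fun k => by
      rw [norm_sq_eq_integral]
      refine integral_congr_ae ?_
      filter_upwards [coeFn_mulL (m k) v] with x hx
      rw [hx]
    simp only [e]
    rw [show (0 : ℝ) = ∫ x : Plane, 0 ∂halfVol by simp]
    refine tendsto_integral_of_dominated_convergence (fun x => C ^ 2 * v x ^ 2) (fun k => ?_)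
      ((Lp.memLp v).integrable_sq.const_mul _) (fun k => ae_of_all _ fun x => ?_)
      (ae_of_all _ fun x => ?_)
    · exact ((m k).continuous.aestronglyMeasurable.mul (Lp.aestronglyMeasurable v)).pow 2
    · rw [Real.norm_eq_abs, abs_of_nonneg (sq_nonneg _), mul_pow]
      exact mul_le_mul_of_nonneg_right (sq_le_sq.2 ((hC k x).trans (le_abs_self C)))
        (sq_nonneg _)
    · have := ((hm x).mul_const (v x)).pow 2
      simpa using this
  have h2 := h.sqrt
  simpa [Real.sqrt_sq (norm_nonneg _)] using h2

/-! ### Density of test functions and completeness of `H⁺` -/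

/-- The space `(L²)⁴` that contains `H⁺`. -/
abbrev Ambient : Type := PiLp 2 (fun _ : Fin 4 => L2Half)

/-- A test function together with its derivatives, as an element of `(L²)⁴`. -/
def testVec (φ : Plane → ℝ) (h : IsTestFunction φ) : Ambient :=
  WithLp.toLp 2 ![h.memLp.toLp φ, (h.memLp_partial 0).toLp _, (h.memLp_partial 1).toLp _,
    h.memLp_angular.toLp _]

theorem setIntegral_halfVol_eq {h : Plane → ℝ} (hh : ∀ x : Plane, x 0 ≤ 0 → h x = 0) :
    ∫ x, h x ∂halfVol = ∫ x, h x :=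
  setIntegral_eq_integral_of_forall_compl_eq_zero fun x hx => hh x (not_lt.1 hx)

theorem IsTestFunction.integral_mul_partial {φ ψ : Plane → ℝ} (h : IsTestFunction φ)
    (k : IsTestFunction ψ) (i : Fin 2) :
    ∫ x, φ x * classicalPartial i ψ x ∂halfVol = - ∫ x, classicalPartial i φ x * ψ x ∂halfVol := by
  rw [setIntegral_halfVol_eq fun x hx => by simp [h.eq_zero_of_nonpos hx],
    setIntegral_halfVol_eq fun x hx => by simp [k.eq_zero_of_nonpos hx]]
  have c1 := h.smooth.continuous
  have c2 := k.smooth.continuous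
  have c3 := h.continuous_partial i
  have c4 := k.continuous_partial i
  exact integral_mul_fderiv_eq_neg_fderiv_mul_of_integrable
    ((c3.mul c2).integrable_of_hasCompactSupport k.compact.mul_left)
    ((c1.mul c4).integrable_of_hasCompactSupport h.compact.mul_right)
    ((c1.mul c2).integrable_of_hasCompactSupport h.compact.mul_right)
    (fun x _ => h.smooth.differentiable (by simp) x)
    (fun x _ => k.smooth.differentiable (by simp) x)

/-- The squared radius of the `k`-th cutoff. -/
abbrev cutRad (k : ℕ) : ℝ := ((k : ℝ) + 1) ^ 2

/-- A smooth positive radial cutoff that decays quadratically. -/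
def damp (k : ℕ) (x : Plane) : ℝ := cutRad k / (cutRad k + ‖x‖ ^ 2)

/-- The partial derivatives of the cutoff. -/
def dampPartial (k : ℕ) (i : Fin 2) (x : Plane) : ℝ :=
  -(cutRad k * (2 * x i)) / (cutRad k + ‖x‖ ^ 2) ^ 2

theorem cutRad_pos (k : ℕ) : 0 < cutRad k := by positivity

theorem cutRad_add_pos (k : ℕ) (x : Plane) : 0 < cutRad k + ‖x‖ ^ 2 := by positivity

theorem continuous_damp (k : ℕ) : Continuous (damp k) := by
  unfold damp
  exact continuous_const.div (by fun_prop) fun x => (cutRad_add_pos k x).ne'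

theorem continuous_dampPartial (k : ℕ) (i : Fin 2) : Continuous (dampPartial k i) := by
  unfold dampPartial
  exact Continuous.div (by fun_prop) (by fun_prop) fun x => (pow_pos (cutRad_add_pos k x) 2).ne'

theorem damp_pos (k : ℕ) (x : Plane) : 0 < damp k x := div_pos (cutRad_pos k) (cutRad_add_pos k x)

theorem damp_le_one (k : ℕ) (x : Plane) : damp k x ≤ 1 :=
  div_le_one_of_le₀ (by nlinarith [sq_nonneg ‖x‖]) (cutRad_add_pos k x).le

theorem abs_coord_le (x : Plane) (i : Fin 2) : |x i| ≤ ‖x‖ := PiLp.norm_apply_le x i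

/-- By the arithmetic–geometric mean inequality `2 (k+1) ‖x‖ ≤ (k+1)² + ‖x‖²`. The quadratic decay
of the cutoff thus absorbs the unbounded coefficients of the angular derivative, which after damping
is controlled by the gradient in `L²`. -/
theorem abs_damp_mul_coord_le (k : ℕ) (i : Fin 2) (x : Plane) :
    |damp k x * x i| ≤ k + 1 := by
  rw [abs_mul, abs_of_pos (damp_pos k x), damp, div_mul_eq_mul_div,
    div_le_iff₀ (cutRad_add_pos k x)]
  have h1 := abs_coord_le x i
  have hk : (0 : ℝ) < k + 1 := by positivity
  have h2 : ((k : ℝ) + 1) * |x i| ≤ cutRad k + ‖x‖ ^ 2 := by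
    nlinarith [sq_nonneg ((k : ℝ) + 1 - ‖x‖), mul_le_mul_of_nonneg_left h1 hk.le]
  nlinarith [mul_le_mul_of_nonneg_left h2 hk.le]

theorem abs_dampPartial_le (k : ℕ) (i : Fin 2) (x : Plane) :
    |dampPartial k i x| ≤ 1 / (k + 1) := by
  have hk : (0 : ℝ) < k + 1 := by positivity
  have hp := cutRad_add_pos k x
  rw [dampPartial, abs_div, abs_neg, abs_of_pos (pow_pos hp 2), div_le_div_iff₀ (pow_pos hp 2) hk,
    abs_mul, abs_of_pos (cutRad_pos k), abs_mul, abs_two]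
  have h1 := abs_coord_le x i
  have h2 : ((k : ℝ) + 1) * (2 * |x i|) ≤ cutRad k + ‖x‖ ^ 2 := by
    nlinarith [sq_nonneg ((k : ℝ) + 1 - ‖x‖), mul_le_mul_of_nonneg_left h1 hk.le]
  have h3 : cutRad k ≤ cutRad k + ‖x‖ ^ 2 := by nlinarith [sq_nonneg ‖x‖]
  calc cutRad k * (2 * |x i|) * (k + 1) = cutRad k * (((k : ℝ) + 1) * (2 * |x i|)) := by ring
    _ ≤ (cutRad k + ‖x‖ ^ 2) * (cutRad k + ‖x‖ ^ 2) := by gcongr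
    _ = _ := by ring

/-- The cutoff as a bounded function. -/
def dampB (k : ℕ) : Plane →ᵇ ℝ :=
  .ofNormedAddCommGroup (damp k) (continuous_damp k) 1 fun x => by
    rw [Real.norm_eq_abs, abs_of_pos (damp_pos k x)]; exact damp_le_one k x

/-- The partial derivatives of the cutoff as bounded functions. -/
def dampPartialB (k : ℕ) (i : Fin 2) : Plane →ᵇ ℝ :=
  .ofNormedAddCommGroup (dampPartial k i) (continuous_dampPartial k i) _ (abs_dampPartial_le k i)

/-- The product of the cutoff and a coordinate as a bounded function. -/
def dampCoordB (k : ℕ) (i : Fin 2) : Plane →ᵇ ℝ :=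
  .ofNormedAddCommGroup (fun x => damp k x * x i)
    ((continuous_damp k).mul (by fun_prop)) _ (abs_damp_mul_coord_le k i)

theorem tendsto_cutRad_atTop : Tendsto cutRad atTop atTop :=
  (tendsto_pow_atTop two_ne_zero).comp
    (tendsto_atTop_add_const_right _ _ tendsto_natCast_atTop_atTop)

theorem tendsto_damp (x : Plane) : Tendsto (fun k => damp k x) atTop (𝓝 1) := by
  have e : ∀ k, damp k x = 1 - ‖x‖ ^ 2 / (cutRad k + ‖x‖ ^ 2) := fun k => by
    rw [damp, eq_sub_iff_add_eq, ← add_div, div_self (cutRad_add_pos k x).ne']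
  simp only [e]
  have := (tendsto_const_nhds (x := ‖x‖ ^ 2)).div_atTop
    (tendsto_atTop_add_const_right _ (‖x‖ ^ 2) tendsto_cutRad_atTop)
  simpa using this.const_sub 1

theorem contDiff_damp (k : ℕ) : ContDiff ℝ (⊤ : ℕ∞) (damp k) := by
  unfold damp
  exact contDiff_const.div (contDiff_const.add (contDiff_norm_sq ℝ))
    fun x => (cutRad_add_pos k x).ne'

theorem classicalPartial_damp (k : ℕ) (i : Fin 2) (x : Plane) :
    classicalPartial i (damp k) x = dampPartial k i x := by
  have h := ((hasDerivAt_inv (cutRad_add_pos k x).ne').comp_hasFDerivAt x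
    ((hasStrictFDerivAt_norm_sq x).hasFDerivAt.const_add (cutRad k))).const_mul (cutRad k)
  have e : (fun y : Plane => cutRad k * (Inv.inv ∘ fun y => cutRad k + ‖y‖ ^ 2) y) = damp k := by
    ext y; rw [damp, div_eq_mul_inv]; rfl
  rw [e] at h
  rw [classicalPartial, h.fderiv, dampPartial]
  simp [EuclideanSpace.inner_single_right]
  ring

theorem IsTestFunction.damp_mul {φ : Plane → ℝ} (h : IsTestFunction φ) (k : ℕ) :
    IsTestFunction (fun x => damp k x * φ x) :=
  ⟨(contDiff_damp k).mul h.smooth, h.compact.mul_left,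
    (tsupport_mul_subset_right (f := damp k) (g := φ)).trans h.support⟩

theorem IsTestFunction.partial_damp_mul {φ : Plane → ℝ} (h : IsTestFunction φ) (k : ℕ)
    (i : Fin 2) (x : Plane) : classicalPartial i (fun x => damp k x * φ x) x =
      damp k x * classicalPartial i φ x + dampPartial k i x * φ x := by
  rw [← classicalPartial_damp]
  unfold classicalPartial
  rw [fderiv_fun_mul ((contDiff_damp k).differentiable (by simp) x)
    (h.smooth.differentiable (by simp) x)]
  simp [mul_comm]

/-- The cutoff is radial, so its own angular derivative vanishes and the two terms containing
`dampPartial` cancel. -/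
theorem IsTestFunction.angular_damp_mul {φ : Plane → ℝ} (h : IsTestFunction φ) (k : ℕ)
    (x : Plane) : angularPartial (fun x => damp k x * φ x) x =
      damp k x * x 0 * classicalPartial 1 φ x - damp k x * x 1 * classicalPartial 0 φ x := by
  rw [angularPartial, h.partial_damp_mul, h.partial_damp_mul, dampPartial, dampPartial]
  ring

/-- The derivatives of the product of a function with the cutoff. -/
def dampVec (k : ℕ) (U : Ambient) : Ambient :=
  WithLp.toLp 2 ![mulL (dampB k) (U 0), mulL (dampB k) (U 1) + mulL (dampPartialB k 0) (U 0),
    mulL (dampB k) (U 2) + mulL (dampPartialB k 1) (U 0),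
    mulL (dampCoordB k 0) (U 2) - mulL (dampCoordB k 1) (U 1)]

theorem tendsto_ambient_iff {ι : Type*} {l : Filter ι} {U : ι → Ambient} {V : Ambient} :
    Tendsto U l (𝓝 V) ↔ ∀ i, Tendsto (fun n => U n i) l (𝓝 (V i)) := by
  constructor
  · intro h i
    exact ((PiLp.proj (𝕜 := ℝ) 2 (fun _ : Fin 4 => L2Half) i).continuous.tendsto V).comp h
  · intro h
    exact ((PiLp.continuous_toLp 2 (fun _ : Fin 4 => L2Half)).tendsto (WithLp.ofLp V)).comp
      (tendsto_pi_nhds.2 h)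

theorem dampVec_testVec (k : ℕ) {φ : Plane → ℝ} (h : IsTestFunction φ) :
    dampVec k (testVec φ h) = testVec _ (h.damp_mul k) := by
  have hp : ∀ i, mulL (dampB k) ((h.memLp_partial i).toLp _) + mulL (dampPartialB k i) (h.memLp.toLp φ)
      = ((h.damp_mul k).memLp_partial i).toLp _ := fun i => by
    refine Lp.ext ?_
    filter_upwards [Lp.coeFn_add (mulL (dampB k) ((h.memLp_partial i).toLp _))
      (mulL (dampPartialB k i) (h.memLp.toLp φ)), coeFn_mulL (dampB k) ((h.memLp_partial i).toLp _),
      coeFn_mulL (dampPartialB k i) (h.memLp.toLp φ), h.memLp.coeFn_toLp,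
      (h.memLp_partial i).coeFn_toLp, ((h.damp_mul k).memLp_partial i).coeFn_toLp]
      with x h1 h2 h3 h4 h5 h6
    rw [h1, Pi.add_apply, h2, h3, h4, h5, h6, h.partial_damp_mul]
    rfl
  have ha : mulL (dampCoordB k 0) ((h.memLp_partial 1).toLp _)
      - mulL (dampCoordB k 1) ((h.memLp_partial 0).toLp _) = (h.damp_mul k).memLp_angular.toLp _ := by
    refine Lp.ext ?_
    filter_upwards [Lp.coeFn_sub (mulL (dampCoordB k 0) ((h.memLp_partial 1).toLp _))
      (mulL (dampCoordB k 1) ((h.memLp_partial 0).toLp _)),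
      coeFn_mulL (dampCoordB k 0) ((h.memLp_partial 1).toLp _),
      coeFn_mulL (dampCoordB k 1) ((h.memLp_partial 0).toLp _), (h.memLp_partial 0).coeFn_toLp,
      (h.memLp_partial 1).coeFn_toLp, (h.damp_mul k).memLp_angular.coeFn_toLp]
      with x h1 h2 h3 h4 h5 h6
    rw [h1, Pi.sub_apply, h2, h3, h4, h5, h6, h.angular_damp_mul]
    rfl
  have h0 : mulL (dampB k) (h.memLp.toLp φ) = (h.damp_mul k).memLp.toLp _ :=
    mulL_toLp _ _ _ fun x => rfl
  refine PiLp.ext fun i => ?_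
  fin_cases i
  · exact h0
  · exact hp 0
  · exact hp 1
  · exact ha

theorem tendsto_toLp_iff {f : ℕ → Plane → ℝ} (hf : ∀ n, MemLp (f n) 2 halfVol) (u : L2Half) :
    Tendsto (fun n => (hf n).toLp (f n)) atTop (𝓝 u) ↔
      Tendsto (fun n => eLpNorm (fun x => f n x - u x) 2 halfVol) atTop (𝓝 0) := by
  have := Lp.tendsto_Lp_iff_tendsto_eLpNorm'' (fi := atTop) f hf u (Lp.memLp u)
  rwa [Lp.toLp_coeFn] at this

theorem testVec_mem (φ : Plane → ℝ) (h : IsTestFunction φ) : testVec φ h ∈ HPlus := by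
  have e : (![testVec φ h 1, testVec φ h 2] : Fin 2 → L2Half)
      = fun i => (h.memLp_partial i).toLp _ := by
    funext i; fin_cases i <;> rfl
  refine ⟨?_, ?_⟩
  · rw [e]
    refine ⟨fun i ψ k => ?_, fun _ => φ, fun _ => h, ?_, fun i => ?_⟩
    · have h1 : ∫ x, h.memLp.toLp φ x * classicalPartial i ψ x ∂halfVol
          = ∫ x, φ x * classicalPartial i ψ x ∂halfVol := by
        refine integral_congr_ae ?_
        filter_upwards [h.memLp.coeFn_toLp] with x hx
        rw [hx]
      have h2 : ∫ x, (h.memLp_partial i).toLp _ x * ψ x ∂halfVol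
          = ∫ x, classicalPartial i φ x * ψ x ∂halfVol := by
        refine integral_congr_ae ?_
        filter_upwards [(h.memLp_partial i).coeFn_toLp] with x hx
        rw [hx]
      exact h1.trans ((h.integral_mul_partial k i).trans (by rw [h2]))
    · exact (tendsto_toLp_iff (fun _ => h.memLp) _).1 tendsto_const_nhds
    · exact (tendsto_toLp_iff (fun _ => h.memLp_partial i) _).1 tendsto_const_nhds
  · filter_upwards [h.memLp_angular.coeFn_toLp, (h.memLp_partial 0).coeFn_toLp,
      (h.memLp_partial 1).coeFn_toLp] with x h1 h2 h3
    exact h1.trans (by rw [angularPartial, ← h2, ← h3]; rfl)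

/-- The set of test functions in `(L²)⁴`. -/
def testSet : Set Ambient := {U | ∃ φ h, U = testVec φ h}

/-- Approximation in `H¹₀` says nothing about angular derivatives. After multiplication by the
cutoff these involve only bounded multiples of the gradient, so the damped approximants converge in
all four components. -/
theorem dampVec_mem_closure {U : Ambient} (hU : U ∈ HPlus) (k : ℕ) :
    dampVec k U ∈ closure testSet := by
  obtain ⟨⟨-, φ, hφ, h0, h1⟩, -⟩ := hU
  have h0' := (tendsto_toLp_iff (fun n => (hφ n).memLp) _).2 h0
  have h1' : ∀ i, Tendsto (fun n => ((hφ n).memLp_partial i).toLp _) atTop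
      (𝓝 ((![U 1, U 2] : Fin 2 → L2Half) i)) := fun i =>
    (tendsto_toLp_iff (fun n => (hφ n).memLp_partial i) _).2 (h1 i)
  refine mem_closure_of_tendsto (f := fun n => dampVec k (testVec (φ n) (hφ n))) (b := atTop) ?_
    (Eventually.of_forall fun n => ⟨_, _, dampVec_testVec k (hφ n)⟩)
  have t : ∀ {w : ℕ → L2Half} {v : L2Half} (m : Plane →ᵇ ℝ), Tendsto w atTop (𝓝 v) →
      Tendsto (fun n => mulL m (w n)) atTop (𝓝 (mulL m v)) := fun m h =>
    ((mulL m).continuous.tendsto _).comp h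
  rw [tendsto_ambient_iff]
  intro i
  fin_cases i
  · exact t _ h0'
  · exact (t _ (h1' 0)).add (t _ h0')
  · exact (t _ (h1' 1)).add (t _ h0')
  · exact (t _ (h1' 1)).sub (t _ (h1' 0))

theorem tendsto_mulL_damp (v : L2Half) : Tendsto (fun k => mulL (dampB k) v) atTop (𝓝 v) := by
  have h := tendsto_mulL_zero (m := fun k => dampB k - 1) (C := 1) (fun k x => ?_) (fun x => ?_) v
  · have e : ∀ k, mulL (dampB k - 1) v = mulL (dampB k) v - v := fun k => by
      refine Lp.ext ?_
      filter_upwards [coeFn_mulL (dampB k - 1) v, coeFn_mulL (dampB k) v,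
        Lp.coeFn_sub (mulL (dampB k) v) v] with x h1 h2 h3
      rw [h1, h3, Pi.sub_apply, h2]
      simp [sub_mul]
    simp only [e] at h
    simpa using h.add_const v
  · change |damp k x - 1| ≤ 1
    rw [abs_le]
    constructor <;> linarith [damp_pos k x, damp_le_one k x]
  · have := (tendsto_damp x).sub_const 1
    rw [sub_self] at this
    exact this

theorem tendsto_mulL_dampPartial (i : Fin 2) (v : L2Half) :
    Tendsto (fun k => mulL (dampPartialB k i) v) atTop (𝓝 0) := by
  refine tendsto_mulL_zero (C := 1) (fun k x => (abs_dampPartial_le k i x).trans ?_) (fun x => ?_) v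
  · rw [div_le_one (by positivity)]; linarith [k.cast_nonneg (α := ℝ)]
  · exact squeeze_zero_norm (fun k => abs_dampPartial_le k i x)
      tendsto_one_div_add_atTop_nhds_zero_nat

/-- The damped angular derivative is the cutoff times the angular derivative, which is in `L²` by
hypothesis; the derivative of the cutoff is uniformly at most `1 / (k + 1)`. -/
theorem tendsto_dampVec {U : Ambient} (hU : U ∈ HPlus) :
    Tendsto (fun k => dampVec k U) atTop (𝓝 U) := by
  obtain ⟨-, ha⟩ := hU
  have e : ∀ k, mulL (dampCoordB k 0) (U 2) - mulL (dampCoordB k 1) (U 1) = mulL (dampB k) (U 3) := by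
    intro k
    refine Lp.ext ?_
    filter_upwards [Lp.coeFn_sub (mulL (dampCoordB k 0) (U 2)) (mulL (dampCoordB k 1) (U 1)),
      coeFn_mulL (dampCoordB k 0) (U 2), coeFn_mulL (dampCoordB k 1) (U 1),
      coeFn_mulL (dampB k) (U 3), ha] with x h1 h2 h3 h4 h5
    rw [h1, Pi.sub_apply, h2, h3, h4, h5]
    change damp k x * x 0 * _ - damp k x * x 1 * _ = damp k x * _
    ring
  rw [tendsto_ambient_iff]
  intro i
  fin_cases i
  · exact tendsto_mulL_damp _
  · have := (tendsto_mulL_damp (U 1)).add (tendsto_mulL_dampPartial 0 (U 0))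
    rw [add_zero] at this
    exact this
  · have := (tendsto_mulL_damp (U 2)).add (tendsto_mulL_dampPartial 1 (U 0))
    rw [add_zero] at this
    exact this
  · exact (tendsto_mulL_damp (U 3)).congr fun k => (e k).symm

/-- Gives at once that `H⁺` is complete and that test functions are dense in its full norm. One
inclusion comes from damping with a fixed cutoff and then removing the cutoff; the other holds
because the defining relations are closed. -/
theorem coe_HPlus_eq_closure : (HPlus : Set Ambient) = closure testSet := by
  refine Subset.antisymm (fun U hU => ?_) (fun U hU => ?_)
  · have := mem_closure_of_tendsto (tendsto_dampVec hU)
      (Eventually.of_forall fun k => dampVec_mem_closure hU k)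
    rwa [closure_closure] at this
  obtain ⟨T, hT, hlim⟩ := mem_closure_iff_seq_limit.1 hU
  choose φ hφ hTφ using hT
  obtain rfl : T = fun n => testVec (φ n) (hφ n) := funext hTφ
  have hc := tendsto_ambient_iff.1 hlim
  have hg : ∀ i, Tendsto (fun n => ((hφ n).memLp_partial i).toLp _) atTop
      (𝓝 ((![U 1, U 2] : Fin 2 → L2Half) i)) := by
    intro i; fin_cases i
    · exact hc 1
    · exact hc 2
  refine ⟨⟨fun i ψ k => ?_, φ, hφ, (tendsto_toLp_iff (fun n => (hφ n).memLp) _).1 (hc 0),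
    fun i => (tendsto_toLp_iff (fun n => (hφ n).memLp_partial i) _).1 (hg i)⟩, ?_⟩
  · rw [integral_mul_eq_inner _ (k.memLp_partial i), integral_mul_eq_inner _ k.memLp]
    refine tendsto_nhds_unique ((tendsto_const_nhds (x := (k.memLp_partial i).toLp _)).inner (𝕜 := ℝ)
      (hc 0)) ((((tendsto_const_nhds (x := k.memLp.toLp ψ)).inner (𝕜 := ℝ) (hg i)).neg).congr
        fun n => ?_)
    have hw := (testVec_mem (φ n) (hφ n)).1.1 i ψ k
    rw [integral_mul_eq_inner _ (k.memLp_partial i), integral_mul_eq_inner _ k.memLp] at hw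
    refine Eq.trans ?_ hw.symm
    fin_cases i <;> rfl
  · have t : ∀ {w : ℕ → L2Half} {v : L2Half} (m : Plane →ᵇ ℝ), Tendsto w atTop (𝓝 v) →
        Tendsto (fun n => mulL m (w n)) atTop (𝓝 (mulL m v)) := fun m h =>
      ((mulL m).continuous.tendsto _).comp h
    -- Both sides are limits of the same sequence, since test functions satisfy the damped identity
    -- exactly.
    have e : mulL (dampCoordB 0 0) (U 2) - mulL (dampCoordB 0 1) (U 1) = mulL (dampB 0) (U 3) := by
      refine tendsto_nhds_unique ((t _ (hc 2)).sub (t _ (hc 1))) ((t _ (hc 3)).congr fun n => ?_)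
      refine Lp.ext ?_
      filter_upwards [coeFn_mulL (dampB 0) (testVec (φ n) (hφ n) 3),
        Lp.coeFn_sub (mulL (dampCoordB 0 0) (testVec (φ n) (hφ n) 2))
          (mulL (dampCoordB 0 1) (testVec (φ n) (hφ n) 1)),
        coeFn_mulL (dampCoordB 0 0) (testVec (φ n) (hφ n) 2),
        coeFn_mulL (dampCoordB 0 1) (testVec (φ n) (hφ n) 1), (testVec_mem (φ n) (hφ n)).2]
        with x h1 h2 h3 h4 h5
      rw [h1, h2, Pi.sub_apply, h3, h4, h5]
      change damp 0 x * _ = damp 0 x * x 0 * _ - damp 0 x * x 1 * _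
      ring
    filter_upwards [coeFn_mulL (dampB 0) (U 3),
        Lp.coeFn_sub (mulL (dampCoordB 0 0) (U 2)) (mulL (dampCoordB 0 1) (U 1)),
        coeFn_mulL (dampCoordB 0 0) (U 2), coeFn_mulL (dampCoordB 0 1) (U 1)] with x h1 h2 h3 h4
    rw [e, h1, Pi.sub_apply, h3, h4] at h2
    change damp 0 x * _ = damp 0 x * x 0 * _ - damp 0 x * x 1 * _ at h2
    refine mul_left_cancel₀ (damp_pos 0 x).ne' (h2.trans ?_)
    ring

instance : CompleteSpace HPlus := by
  have h : IsClosed (HPlus : Set Ambient) := coe_HPlus_eq_closure ▸ isClosed_closure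
  exact h.completeSpace_coe

/-- A test function as an element of `H⁺`. -/
def testElem (φ : Plane → ℝ) (h : IsTestFunction φ) : HPlus := ⟨testVec φ h, testVec_mem φ h⟩

/-- Test functions are dense in `H⁺`. -/
theorem exists_seq_testElem_tendsto (U : HPlus) :
    ∃ (φ : ℕ → Plane → ℝ) (hφ : ∀ n, IsTestFunction (φ n)),
      Tendsto (fun n => testElem (φ n) (hφ n)) atTop (𝓝 U) := by
  have hU : (U : Ambient) ∈ closure testSet := coe_HPlus_eq_closure ▸ U.2
  obtain ⟨T, hT, hlim⟩ := mem_closure_iff_seq_limit.1 hU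
  choose φ hφ hTφ using hT
  obtain rfl : T = fun n => testVec (φ n) (hφ n) := funext hTφ
  exact ⟨φ, hφ, tendsto_subtype_rng.2 hlim⟩

/-! ### Integral inequalities on `H⁺` -/

/-- The components of an element of `H⁺`, as bounded operators. -/
def coordL (i : Fin 4) : HPlus →L[ℝ] L2Half :=
  (PiLp.proj (𝕜 := ℝ) 2 (fun _ : Fin 4 => L2Half) i).comp HPlus.subtypeL

theorem norm_coordL_le (i : Fin 4) (U : HPlus) : ‖coordL i U‖ ≤ ‖U‖ :=
  PiLp.norm_apply_le (U : Ambient) i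

theorem enorm_coordL_le (i : Fin 4) (U : HPlus) : ‖coordL i U‖ₑ ≤ ‖U‖ₑ :=
  enorm_le_iff_norm_le.2 (norm_coordL_le i U)

theorem norm_sq_eq_sum (U : HPlus) :
    ‖U‖ ^ 2 = ‖fn U‖ ^ 2 + ‖fnD1 U‖ ^ 2 + ‖fnD2 U‖ ^ 2 + ‖fnAngle U‖ ^ 2 := by
  have := PiLp.norm_sq_eq_of_L2 (fun _ : Fin 4 => L2Half) (U : Ambient)
  rw [Fin.sum_univ_four] at this
  exact this

theorem sq_lintegral_mul_le {α : Type*} [MeasurableSpace α] {μ : Measure α} {f g : α → ℝ≥0∞}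
    (hf : AEMeasurable f μ) (hg : AEMeasurable g μ) :
    (∫⁻ x, f x * g x ∂μ) ^ 2 ≤ (∫⁻ x, f x ^ 2 ∂μ) * ∫⁻ x, g x ^ 2 ∂μ := by
  have := ENNReal.lintegral_mul_le_Lp_mul_Lq μ Real.HolderConjugate.two_two hf hg
  simp only [Pi.mul_apply, ENNReal.rpow_two] at this
  calc (∫⁻ x, f x * g x ∂μ) ^ 2
      ≤ ((∫⁻ x, f x ^ 2 ∂μ) ^ (1 / 2 : ℝ) * (∫⁻ x, g x ^ 2 ∂μ) ^ (1 / 2 : ℝ)) ^ 2 := by gcongr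
    _ = _ := by
        rw [mul_pow, ← ENNReal.rpow_natCast, ← ENNReal.rpow_natCast, ← ENNReal.rpow_mul,
          ← ENNReal.rpow_mul]
        norm_num

theorem lintegral_enorm_sq (u : L2Half) : ∫⁻ x, ‖u x‖ₑ ^ 2 ∂halfVol = ‖u‖ₑ ^ 2 := by
  rw [Lp.enorm_def, eLpNorm_eq_lintegral_rpow_enorm_toReal (by simp) (by simp),
    ← ENNReal.rpow_natCast, ← ENNReal.rpow_mul]
  norm_num

theorem lintegral_enorm_sq_toLp {f : Plane → ℝ} (hf : MemLp f 2 halfVol) :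
    ∫⁻ x, ‖f x‖ₑ ^ 2 ∂halfVol = ‖hf.toLp f‖ₑ ^ 2 := by
  rw [← lintegral_enorm_sq]
  refine lintegral_congr_ae ?_
  filter_upwards [hf.coeFn_toLp] with x hx
  rw [hx]

theorem lintegral_enorm_mul_le {f g : Plane → ℝ} (hf : MemLp f 2 halfVol)
    (hg : MemLp g 2 halfVol) :
    ∫⁻ x, ‖f x‖ₑ * ‖g x‖ₑ ∂halfVol ≤ ‖hf.toLp f‖ₑ * ‖hg.toLp g‖ₑ := by
  have h := sq_lintegral_mul_le hf.aestronglyMeasurable.enorm hg.aestronglyMeasurable.enorm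
  rw [lintegral_enorm_sq_toLp hf, lintegral_enorm_sq_toLp hg, ← mul_pow] at h
  exact (ENNReal.pow_le_pow_left_iff two_ne_zero).1 h

/-- Integral inequalities pass from test functions to `H⁺`. -/
theorem lintegral_mul_pow_le_of_testElem {w : Plane → ℝ≥0∞} (hw : Measurable w) (k : ℕ)
    {Ψ : HPlus → ℝ≥0∞} (hΨ : Continuous Ψ)
    (h : ∀ φ hφ, ∫⁻ x, w x * ‖φ x‖ₑ ^ k ∂halfVol ≤ Ψ (testElem φ hφ)) (U : HPlus) :
    ∫⁻ x, w x * ‖fn U x‖ₑ ^ k ∂halfVol ≤ Ψ U := by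
  obtain ⟨φ, hφ, hlim⟩ := exists_seq_testElem_tendsto U
  have h0 : Tendsto (fun n => (hφ n).memLp.toLp (φ n)) atTop (𝓝 (fn U)) :=
    ((coordL 0).continuous.tendsto U).comp hlim
  -- Convergence in `L²` gives almost everywhere convergence of a subsequence, and Fatou's lemma
  -- then carries the upper bound to the limit.
  obtain ⟨ns, hns, hae⟩ := (tendstoInMeasure_of_tendsto_Lp h0).exists_seq_tendsto_ae
  have hall : ∀ᵐ x ∂halfVol, ∀ n, (hφ n).memLp.toLp (φ n) x = φ n x :=
    ae_all_iff.2 fun n => (hφ n).memLp.coeFn_toLp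
  calc ∫⁻ x, w x * ‖fn U x‖ₑ ^ k ∂halfVol
      ≤ ∫⁻ x, liminf (fun n => w x * ‖φ (ns n) x‖ₑ ^ k) atTop ∂halfVol := by
        refine lintegral_mono_ae ?_
        filter_upwards [hae, hall] with x hx hx'
        simp only [hx'] at hx
        -- The weight may take the value `⊤`, where multiplication is not continuous at `0`. There
        -- the limit either has a zero left-hand side, or the approximants eventually give `⊤` as
        -- well.
        by_cases hwx : w x = ⊤
        · by_cases h0 : fn U x = 0 ∧ k ≠ 0
          · simp [h0.1, h0.2]
          have hpos : ∀ᶠ n in atTop, w x * ‖φ (ns n) x‖ₑ ^ k = ⊤ := by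
            rw [not_and_or, not_not] at h0
            rcases h0 with h0 | h0
            · filter_upwards [hx.eventually_ne h0] with n hn
              rw [hwx, ENNReal.top_mul (pow_ne_zero _ (by simpa using hn))]
            · simp [h0, hwx]
          rw [liminf_congr hpos, liminf_const]
          exact le_top
        · have hc : Tendsto (fun n => w x * ‖φ (ns n) x‖ₑ ^ k) atTop (𝓝 (w x * ‖fn U x‖ₑ ^ k)) :=
            ENNReal.Tendsto.const_mul (((ENNReal.continuous_pow k).tendsto _).comp hx.enorm)
              (Or.inr hwx)
          exact hc.liminf_eq.ge
    _ ≤ liminf (fun n => ∫⁻ x, w x * ‖φ (ns n) x‖ₑ ^ k ∂halfVol) atTop :=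
        lintegral_liminf_le fun n => hw.mul ((hφ _).smooth.continuous.measurable.enorm.pow_const k)
    _ ≤ liminf (fun n => Ψ (testElem (φ (ns n)) (hφ (ns n)))) atTop :=
        liminf_le_liminf (Eventually.of_forall fun n => h _ _)
    _ = Ψ U := (((hΨ.tendsto U).comp hlim).comp hns.tendsto_atTop).liminf_eq

theorem continuous_const_mul_enorm_pow {c : ℝ≥0∞} (hc : c ≠ ⊤) (k : ℕ) :
    Continuous fun U : HPlus => c * ‖U‖ₑ ^ k :=
  (ENNReal.continuous_const_mul hc).comp ((ENNReal.continuous_pow k).comp continuous_enorm)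

/-- The angular Poincaré inequality. -/
theorem norm_fn_le_norm_fnAngle (U : HPlus) : ‖fn U‖ ≤ 4 * Real.pi * ‖fnAngle U‖ := by
  obtain ⟨φ, hφ, hlim⟩ := exists_seq_testElem_tendsto U
  refine le_of_tendsto_of_tendsto (((coordL 0).continuous.tendsto U).comp hlim).norm
    ((((coordL 3).continuous.tendsto U).comp hlim).norm.const_mul (4 * Real.pi))
    (Eventually.of_forall fun n => ?_)
  have h := hφ n
  change ‖h.memLp.toLp _‖ ≤ 4 * Real.pi * ‖h.memLp_angular.toLp _‖
  -- The constant `4π` is `2π` for the length of the circle times `2` from the derivative of the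
  -- square; one factor of the `L²` norm is cancelled at the end.
  have h1 : ‖h.memLp.toLp (φ n)‖ₑ ^ 2 ≤ ENNReal.ofReal (2 * Real.pi) *
      (ENNReal.ofReal 2 * (‖h.memLp.toLp (φ n)‖ₑ * ‖h.memLp_angular.toLp _‖ₑ)) := by
    rw [← lintegral_enorm_sq_toLp, lintegral_halfVol_eq (fun x hx => by simp [h.eq_zero_of_nonpos hx])]
    refine h.lintegral_sq_le_angular.trans (mul_le_mul' le_rfl ?_)
    rw [← lintegral_halfVol_eq (fun x hx => by simp [h.eq_zero_of_nonpos hx])]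
    refine le_trans (le_of_eq ?_) (mul_le_mul' le_rfl (lintegral_enorm_mul_le h.memLp h.memLp_angular))
    rw [← lintegral_const_mul' _ _ (by simp)]
    simp only [enorm_mul, mul_assoc]
    congr! 3
    simp [enorm_eq_nnnorm]
  rw [← ofReal_norm, ← ofReal_norm, ← ENNReal.ofReal_pow (norm_nonneg _),
    ← ENNReal.ofReal_mul (norm_nonneg _),
    ← ENNReal.ofReal_mul (by norm_num), ← ENNReal.ofReal_mul (by positivity),
    ENNReal.ofReal_le_ofReal_iff (by positivity)] at h1
  by_contra hcon
  push Not at hcon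
  have hp : 0 < ‖h.memLp.toLp (φ n)‖ := lt_of_le_of_lt (by positivity) hcon
  nlinarith [mul_lt_mul_of_pos_left hcon hp]

/-- The Sobolev embedding of `H⁺` into all spaces `L^q` with even `q`. -/
theorem lintegral_pow_even_le (m : ℕ) (U : HPlus) :
    ∫⁻ x, ‖fn U x‖ₑ ^ (2 * (m + 1)) ∂halfVol ≤
      ((m + 1).factorial : ℝ≥0∞) ^ 2 * ‖U‖ₑ ^ (2 * (m + 1)) := by
  have key : ∀ φ (h : IsTestFunction φ), ∫⁻ x, ‖φ x‖ₑ ^ (2 * (m + 1)) ∂halfVol ≤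
      ((m + 1).factorial : ℝ≥0∞) ^ 2 * ‖testElem φ h‖ₑ ^ (2 * (m + 1)) := by
    intro φ h
    have hd : ∀ i, ‖(h.memLp_partial i).toLp _‖ₑ ≤ ‖testElem φ h‖ₑ := by
      intro i; fin_cases i
      · exact enorm_coordL_le 1 (testElem φ h)
      · exact enorm_coordL_le 2 (testElem φ h)
    -- Let `I_m` be the integral of `|φ| ^ (2 (m + 1))`. The Gagliardo–Nirenberg inequality, with
    -- the Cauchy–Schwarz inequality in each factor, gives `I_{m+1} ≤ (m+2)² I_m ‖φ‖²`; iterating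
    -- produces the squared factorial.
    induction m with
    | zero =>
      simp only [zero_add, mul_one, Nat.factorial_one, Nat.cast_one, one_pow, one_mul]
      rw [lintegral_enorm_sq_toLp h.memLp]
      gcongr
      exact enorm_coordL_le 0 (testElem φ h)
    | succ m ih =>
      set I := ∫⁻ x, ‖φ x‖ₑ ^ (2 * (m + 1)) ∂halfVol with hI
      have hf : ∀ i, (∫⁻ x, ‖((m + 1 : ℕ) + 1) * φ x ^ (m + 1) * classicalPartial i φ x‖ₑ) ^ 2 ≤
          ((m + 2 : ℕ) : ℝ≥0∞) ^ 2 * (I * ‖testElem φ h‖ₑ ^ 2) := by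
        intro i
        rw [← lintegral_halfVol_eq (fun x hx => by simp [h.eq_zero_of_nonpos hx])]
        have e : ∀ x, ‖((m + 1 : ℕ) + 1) * φ x ^ (m + 1) * classicalPartial i φ x‖ₑ =
            ((m + 2 : ℕ) : ℝ≥0∞) * (‖φ x ^ (m + 1)‖ₑ * ‖classicalPartial i φ x‖ₑ) := fun x => by
          rw [enorm_mul, enorm_mul, mul_assoc]
          congr 1
          rw [← Nat.cast_succ, Real.enorm_natCast]
        simp only [e]
        have c := h.smooth.continuous
        have ci := h.continuous_partial i
        rw [lintegral_const_mul' _ _ (by simp), mul_pow]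
        refine mul_le_mul' le_rfl ((sq_lintegral_mul_le (by fun_prop)
          (by fun_prop)).trans (mul_le_mul' (le_of_eq ?_) ?_))
        · rw [hI]
          congr! 2 with x
          rw [enorm_pow]; ring
        · rw [lintegral_enorm_sq_toLp (h.memLp_partial i)]
          gcongr
          exact hd i
      have h1 := h.lintegral_pow_le (m + 1)
      rw [← lintegral_halfVol_eq (fun x hx => by simp [h.eq_zero_of_nonpos hx])] at h1
      have h2 : (∫⁻ x, ‖φ x‖ₑ ^ (2 * (m + 1 + 1)) ∂halfVol) ^ 2 ≤
          (((m + 2 : ℕ) : ℝ≥0∞) ^ 2 * (I * ‖testElem φ h‖ₑ ^ 2)) ^ 2 := by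
        calc _ ≤ _ := pow_le_pow_left' h1 2
          _ ≤ _ := by
            rw [mul_pow, sq (_ * (I * _))]
            exact mul_le_mul' (hf 1) (hf 0)
      have h3 := (ENNReal.pow_le_pow_left_iff two_ne_zero).1 h2
      refine h3.trans ((mul_le_mul' le_rfl (mul_le_mul' ih le_rfl)).trans (le_of_eq ?_))
      rw [Nat.factorial_succ (m + 1)]
      push_cast
      ring
  simpa using lintegral_mul_pow_le_of_testElem (w := 1) measurable_one (2 * (m + 1))
    (continuous_const_mul_enorm_pow (c := ((m + 1).factorial : ℝ≥0∞) ^ 2) (by finiteness) _)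
    (by simpa using key) U

/-- Decay at infinity of the fourth moment of elements of `H⁺`. -/
theorem lintegral_tail_le {R : ℝ} (hR : 0 < R) (U : HPlus) :
    ∫⁻ x, {x : Plane | R < ‖x‖}.indicator 1 x * ‖fn U x‖ₑ ^ 4 ∂halfVol ≤
      ENNReal.ofReal (8 / R) * ‖U‖ₑ ^ 4 := by
  have mI : Measurable ({x : Plane | R < ‖x‖}.indicator (1 : Plane → ℝ≥0∞)) :=
    measurable_one.indicator (measurableSet_lt measurable_const measurable_norm)
  refine lintegral_mul_pow_le_of_testElem mI 4 (continuous_const_mul_enorm_pow (by simp) 4) ?_ U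
  intro φ h
  have h1 := h.lintegral_tail_le R
  rw [← lintegral_halfVol_eq (fun x hx => by simp [h.eq_zero_of_nonpos hx]),
    ← lintegral_halfVol_eq (fun x hx => by simp [h.eq_zero_of_nonpos hx]),
    ← lintegral_halfVol_eq (fun x hx => by simp [h.eq_zero_of_nonpos hx])] at h1
  set N := ‖testElem φ h‖ₑ with hN
  have hN0 : ‖h.memLp.toLp φ‖ₑ ≤ N := enorm_coordL_le 0 (testElem φ h)
  have hN1 : ‖(h.memLp_partial 0).toLp _‖ₑ ≤ N := enorm_coordL_le 1 (testElem φ h)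
  have hN2 : ‖(h.memLp_partial 1).toLp _‖ₑ ≤ N := enorm_coordL_le 2 (testElem φ h)
  have hN3 : ‖h.memLp_angular.toLp _‖ₑ ≤ N := enorm_coordL_le 3 (testElem φ h)
  have e2 : ‖(2 : ℝ)‖ₑ = 2 := by simp [enorm_eq_nnnorm]
  have c := h.smooth.continuous
  have c0 := h.continuous_partial 0
  have b : ∀ {g : Plane → ℝ} (hg : MemLp g 2 halfVol), ‖hg.toLp g‖ₑ ≤ N →
      ∫⁻ x, ‖2 * φ x‖ₑ * ‖g x‖ₑ ∂halfVol ≤ 2 * N ^ 2 := by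
    intro g hg hgN
    simp only [enorm_mul, e2, mul_assoc]
    rw [lintegral_const_mul' _ _ (by simp), sq]
    gcongr
    exact (lintegral_enorm_mul_le h.memLp hg).trans (mul_le_mul' hN0 hgN)
  have b1 : ∫⁻ x, ‖2 * φ x * angularPartial φ x‖ₑ ∂halfVol ≤ 2 * N ^ 2 := by
    simp only [enorm_mul (2 * φ _)]
    exact b h.memLp_angular hN3
  have b2 : ∫⁻ x, ‖2 * φ x‖ₑ * (‖classicalPartial 0 φ x‖ₑ + ‖classicalPartial 1 φ x‖ₑ) ∂halfVol
      ≤ 2 * N ^ 2 + 2 * N ^ 2 := by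
    simp only [mul_add]
    rw [lintegral_add_left (by fun_prop)]
    exact add_le_add (b _ hN1) (b _ hN2)
  -- The constant `8` is `2 · (2 + 2)`: one angular factor and two partial derivatives, each
  -- carrying the `2` from the derivative of the square.
  have h2 := h1.trans (mul_le_mul' b1 b2)
  have hR' : ENNReal.ofReal R ≠ 0 := by simpa using hR
  rw [ENNReal.ofReal_div_of_pos hR, div_eq_mul_inv, mul_assoc, mul_comm _ (N ^ 4), ← mul_assoc,
    ← div_eq_mul_inv, ENNReal.le_div_iff_mul_le (Or.inl hR') (Or.inl (by simp)), mul_comm]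
  refine h2.trans (le_of_eq ?_)
  rw [show ENNReal.ofReal 8 = 8 by simp]
  ring

/-- Grid cells have finite volume. -/
theorem halfVol_gridCell_ne_top (ε : ℝ) (k : ℤ × ℤ) : halfVol (gridCell ε k) ≠ ⊤ := by
  have h1 : volume (gridCell ε k) = squareVol ε (k.1 * ε, k.2 * ε) univ := by
    have := setLIntegral_cell ε (k.1 * ε, k.2 * ε) (h := 1)
    simpa [gridCell] using this.symm
  refine ((Measure.restrict_le_self _).trans_lt ?_).ne
  rw [h1]
  exact measure_lt_top _ _

/-- The integral over a grid cell as a bounded functional. -/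
def cellL (ε : ℝ) (k : ℤ × ℤ) : HPlus →L[ℝ] ℝ :=
  (innerSL ℝ (indicatorConstLp 2 (measurableSet_gridCell ε k) (halfVol_gridCell_ne_top ε k)
    (1 : ℝ))).comp (coordL 0)

theorem cellL_apply (ε : ℝ) (k : ℤ × ℤ) (U : HPlus) :
    cellL ε k U = ∫ x in gridCell ε k, fn U x ∂halfVol :=
  L2.inner_indicatorConstLp_one _ _ (fn U)

/-- Up to finitely many averages, an element of `H⁺` is small in `L²` of a ball. -/
theorem lintegral_ball_le {ε : ℝ} (hε : 0 < ε) (N : ℕ) (U : HPlus) :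
    ∫⁻ x, (Metric.ball 0 (N * ε)).indicator 1 x * ‖fn U x‖ₑ ^ 2 ∂halfVol ≤
      ENNReal.ofReal (3 / ε ^ 2) * ∑ k ∈ gridIndices N, ‖cellL ε k U‖ₑ ^ 2 +
        ENNReal.ofReal (6 * ε ^ 2) * ‖U‖ₑ ^ 2 := by
  have mI : Measurable ((Metric.ball (0 : Plane) (N * ε)).indicator (1 : Plane → ℝ≥0∞)) :=
    measurable_one.indicator measurableSet_ball
  refine lintegral_mul_pow_le_of_testElem mI 2
    (Ψ := fun U => ENNReal.ofReal (3 / ε ^ 2) * ∑ k ∈ gridIndices N, ‖cellL ε k U‖ₑ ^ 2 +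
        ENNReal.ofReal (6 * ε ^ 2) * ‖U‖ₑ ^ 2)
    (((ENNReal.continuous_const_mul ENNReal.ofReal_ne_top).comp (continuous_finsetSum _ fun k _ =>
      (ENNReal.continuous_pow 2).comp (cellL ε k).continuous.enorm)).add
    (continuous_const_mul_enorm_pow ENNReal.ofReal_ne_top 2)) ?_ U
  intro φ h
  have h1 := h.lintegral_ball_le hε N
  have e : ∀ k, ∫ x in gridCell ε k, φ x ∂halfVol = cellL ε k (testElem φ h) := fun k => by
    rw [cellL_apply]
    refine integral_congr_ae (ae_restrict_of_ae ?_)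
    exact h.memLp.coeFn_toLp.symm
  have c0 := h.continuous_partial 0
  rw [lintegral_add_left (by fun_prop), lintegral_enorm_sq_toLp (h.memLp_partial 0),
    lintegral_enorm_sq_toLp (h.memLp_partial 1)] at h1
  simp only [e] at h1
  set S := ∑ k ∈ gridIndices N, ‖cellL ε k (testElem φ h)‖ₑ ^ 2
  set M := ‖testElem φ h‖ₑ
  have hN1 : ‖(h.memLp_partial 0).toLp _‖ₑ ≤ M := enorm_coordL_le 1 (testElem φ h)
  have hN2 : ‖(h.memLp_partial 1).toLp _‖ₑ ≤ M := enorm_coordL_le 2 (testElem φ h)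
  have e4 : ENNReal.ofReal ε ^ 4 ≠ 0 := by simpa using hε
  have h2 : ENNReal.ofReal ε ^ 4 * ∫⁻ x, (Metric.ball 0 (N * ε)).indicator 1 x * ‖φ x‖ₑ ^ 2 ∂halfVol
      ≤ ENNReal.ofReal ε ^ 4 * (ENNReal.ofReal (3 / ε ^ 2) * S
        + ENNReal.ofReal (6 * ε ^ 2) * M ^ 2) := by
    -- Both partial derivatives are bounded by the full norm, which turns the constant `3` into `6`;
    -- the factor `ε ^ 4` is then cancelled.
    calc _ ≤ _ := h1
      _ ≤ 3 * (ENNReal.ofReal ε ^ 2 * S + ENNReal.ofReal ε ^ 6 * (M ^ 2 + M ^ 2)) := by gcongr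
      _ = _ := by
        have a1 : ENNReal.ofReal ε ^ 4 * ENNReal.ofReal (3 / ε ^ 2) = 3 * ENNReal.ofReal ε ^ 2 := by
          rw [← ENNReal.ofReal_pow hε.le, ← ENNReal.ofReal_pow hε.le, ← ENNReal.ofReal_ofNat 3,
            ← ENNReal.ofReal_mul (by positivity), ← ENNReal.ofReal_mul (by positivity)]
          congr 1; field_simp
        have a2 : ENNReal.ofReal ε ^ 4 * ENNReal.ofReal (6 * ε ^ 2) = 6 * ENNReal.ofReal ε ^ 6 := by
          rw [← ENNReal.ofReal_pow hε.le, ← ENNReal.ofReal_pow hε.le, ← ENNReal.ofReal_ofNat 6,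
            ← ENNReal.ofReal_mul (by positivity), ← ENNReal.ofReal_mul (by positivity)]
          congr 1; ring
        rw [mul_add (ENNReal.ofReal ε ^ 4), ← mul_assoc (ENNReal.ofReal ε ^ 4),
          ← mul_assoc (ENNReal.ofReal ε ^ 4), a1, a2]
        ring
  exact (ENNReal.mul_le_mul_iff_right e4 (by simp)).1 h2

/-! ### Compactness of the embedding into `L⁴` -/

section Compactness

variable {ι : Type*} {l : Filter ι} {U : ι → HPlus} {M : ℝ}

theorem enorm_le_ofReal (hM : ∀ i, ‖U i‖ ≤ M) (i : ι) : ‖U i‖ₑ ≤ ENNReal.ofReal M := by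
  rw [← ofReal_norm]; exact ENNReal.ofReal_le_ofReal (hM i)

/-- Rellich's theorem: weak convergence in `H⁺` implies strong convergence in `L²` of balls. -/
theorem tendsto_lintegral_ball (hM : ∀ i, ‖U i‖ ≤ M)
    (hw : ∀ ℓ : HPlus →L[ℝ] ℝ, Tendsto (fun i => ℓ (U i)) l (𝓝 0)) (R : ℝ) :
    Tendsto (fun i => ∫⁻ x, (Metric.ball 0 R).indicator 1 x * ‖fn (U i) x‖ₑ ^ 2 ∂halfVol) l
      (𝓝 0) := by
  rw [ENNReal.tendsto_nhds_zero]
  intro η hη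
  have hη2 : 0 < η / 2 := ENNReal.half_pos hη.ne'
  -- The mesh is fixed first, so that the gradient term is small uniformly in `i`. What remains are
  -- finitely many cell averages, which are bounded functionals and vanish in the weak limit.
  obtain ⟨ε, hε1, hε⟩ : ∃ ε : ℝ, ENNReal.ofReal (6 * ε ^ 2) * ENNReal.ofReal M ^ 2 ≤ η / 2 ∧ 0 < ε := by
    have hc : Tendsto (fun ε : ℝ => ENNReal.ofReal (6 * ε ^ 2) * ENNReal.ofReal M ^ 2) (𝓝[>] 0)
        (𝓝 0) := by
      have h1 : Tendsto (fun ε : ℝ => ENNReal.ofReal (6 * ε ^ 2)) (𝓝[>] 0) (𝓝 0) := by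
        refine tendsto_nhdsWithin_of_tendsto_nhds ?_
        have : Continuous fun ε : ℝ => ENNReal.ofReal (6 * ε ^ 2) :=
          ENNReal.continuous_ofReal.comp (by fun_prop)
        simpa using this.tendsto 0
      simpa using ENNReal.Tendsto.mul_const h1 (b := ENNReal.ofReal M ^ 2)
        (Or.inr (by finiteness))
    exact (((ENNReal.tendsto_nhds_zero.1 hc) _ hη2).and self_mem_nhdsWithin).exists
  obtain ⟨N, hN⟩ := exists_nat_ge (R / ε)
  have hS : Tendsto (fun i => ENNReal.ofReal (3 / ε ^ 2) * ∑ k ∈ gridIndices N, ‖cellL ε k (U i)‖ₑ ^ 2)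
      l (𝓝 0) := by
    have h1 : Tendsto (fun i => ∑ k ∈ gridIndices N, ‖cellL ε k (U i)‖ₑ ^ 2) l (𝓝 0) := by
      have := tendsto_finsetSum (gridIndices N) fun k _ =>
        ((ENNReal.continuous_pow 2).tendsto _).comp (hw (cellL ε k)).enorm
      simpa using this
    simpa using ENNReal.Tendsto.const_mul h1 (a := ENNReal.ofReal (3 / ε ^ 2)) (Or.inr (by simp))
  filter_upwards [(ENNReal.tendsto_nhds_zero.1 hS) _ hη2] with i hi
  calc _ ≤ ∫⁻ x, (Metric.ball 0 (N * ε)).indicator 1 x * ‖fn (U i) x‖ₑ ^ 2 ∂halfVol := by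
        refine lintegral_mono fun x => mul_le_mul_left (indicator_le_indicator_of_subset
          (Metric.ball_subset_ball ((div_le_iff₀ hε).1 hN)) (fun _ => zero_le) x) _
    _ ≤ _ := lintegral_ball_le hε N (U i)
    _ ≤ η / 2 + η / 2 := add_le_add hi (le_trans (by gcongr; exact enorm_le_ofReal hM i) hε1)
    _ = η := ENNReal.add_halves η

/-- The embedding of `H⁺` into `L⁴` is compact: it turns weak into strong convergence. -/
theorem tendsto_lintegral_pow_four (hM : ∀ i, ‖U i‖ ≤ M)
    (hw : ∀ ℓ : HPlus →L[ℝ] ℝ, Tendsto (fun i => ℓ (U i)) l (𝓝 0)) :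
    Tendsto (fun i => ∫⁻ x, ‖fn (U i) x‖ₑ ^ 4 ∂halfVol) l (𝓝 0) := by
  rw [ENNReal.tendsto_nhds_zero]
  intro η hη
  have hη2 : 0 < η / 2 := ENNReal.half_pos hη.ne'
  -- The radius makes the tail small uniformly in `i`; only the ball requires the weak convergence.
  obtain ⟨R, hR1, hR⟩ : ∃ R : ℝ, ENNReal.ofReal (8 / R) * ENNReal.ofReal M ^ 4 ≤ η / 2 ∧ 0 < R := by
    have hc : Tendsto (fun R : ℝ => ENNReal.ofReal (8 / R) * ENNReal.ofReal M ^ 4) atTop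
        (𝓝 0) := by
      have h1 : Tendsto (fun R : ℝ => ENNReal.ofReal (8 / R)) atTop (𝓝 0) := by
        have h2 : Tendsto (fun R : ℝ => 8 / R) atTop (𝓝 0) := tendsto_const_nhds.div_atTop tendsto_id
        simpa using ENNReal.tendsto_ofReal h2
      simpa using ENNReal.Tendsto.mul_const h1 (b := ENNReal.ofReal M ^ 4)
        (Or.inr (by finiteness))
    exact (((ENNReal.tendsto_nhds_zero.1 hc) _ hη2).and (eventually_gt_atTop 0)).exists
  have hball : Tendsto (fun i => (∫⁻ x, (Metric.ball 0 (R + 1)).indicator 1 x * ‖fn (U i) x‖ₑ ^ 2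
      ∂halfVol) * (((2 + 1).factorial : ℝ≥0∞) ^ 2 * ENNReal.ofReal M ^ (2 * (2 + 1)))) l (𝓝 0) := by
    simpa using ENNReal.Tendsto.mul_const (tendsto_lintegral_ball hM hw (R + 1))
      (b := ((2 + 1).factorial : ℝ≥0∞) ^ 2 * ENNReal.ofReal M ^ (2 * (2 + 1)))
        (Or.inr (by finiteness))
  filter_upwards [(ENNReal.tendsto_nhds_zero.1 hball) ((η / 2) ^ 2) (by
    exact pos_iff_ne_zero.2 (pow_ne_zero 2 hη2.ne'))] with i hi
  have m0 : AEMeasurable (fun x => ‖fn (U i) x‖ₑ) halfVol :=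
    (Lp.aestronglyMeasurable (fn (U i))).enorm
  have mB : Measurable ((Metric.ball (0 : Plane) (R + 1)).indicator (1 : Plane → ℝ≥0∞)) :=
    measurable_one.indicator measurableSet_ball
  have mT : Measurable ({x : Plane | R < ‖x‖}.indicator (1 : Plane → ℝ≥0∞)) :=
    measurable_one.indicator (measurableSet_lt measurable_const measurable_norm)
  -- On the ball `u⁴ = u · u³`: the first factor tends to zero in `L²` of the ball, the second is
  -- bounded in `L²` by the embedding into `L⁶`, which is the even embedding with `m = 2`.
  have hB : ∫⁻ x, (Metric.ball 0 (R + 1)).indicator 1 x * ‖fn (U i) x‖ₑ ^ 4 ∂halfVol ≤ η / 2 := by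
    refine (ENNReal.pow_le_pow_left_iff two_ne_zero).1 (le_trans ?_ hi)
    have := sq_lintegral_mul_le (μ := halfVol)
      (f := fun x => (Metric.ball 0 (R + 1)).indicator 1 x * ‖fn (U i) x‖ₑ)
      (g := fun x => ‖fn (U i) x‖ₑ ^ 3) (by fun_prop) (by fun_prop)
    have e1 : ∀ x, ((Metric.ball 0 (R + 1)).indicator 1 x : ℝ≥0∞) ^ 2
        = (Metric.ball (0 : Plane) (R + 1)).indicator 1 x := fun x => by
      by_cases hx : x ∈ Metric.ball (0 : Plane) (R + 1) <;>
        simp only [hx, indicator_of_mem, indicator_of_notMem, not_false_eq_true, Pi.one_apply] <;>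
        norm_num
    simp only [mul_pow, e1, ← pow_mul] at this
    have e2 : ∀ x, ((Metric.ball 0 (R + 1)).indicator 1 x : ℝ≥0∞) * ‖fn (U i) x‖ₑ
        * ‖fn (U i) x‖ₑ ^ 3 = (Metric.ball (0 : Plane) (R + 1)).indicator 1 x
          * ‖fn (U i) x‖ₑ ^ 4 := fun x => by ring
    simp only [e2] at this
    refine this.trans (mul_le_mul' le_rfl ?_)
    refine (lintegral_pow_even_le 2 (U i)).trans ?_
    gcongr
    exact enorm_le_ofReal hM i
  calc ∫⁻ x, ‖fn (U i) x‖ₑ ^ 4 ∂halfVol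
      ≤ ∫⁻ x, ((Metric.ball 0 (R + 1)).indicator 1 x * ‖fn (U i) x‖ₑ ^ 4
          + {x : Plane | R < ‖x‖}.indicator 1 x * ‖fn (U i) x‖ₑ ^ 4) ∂halfVol := by
        refine lintegral_mono fun x => ?_
        rw [← add_mul]
        refine le_mul_of_one_le_left' ?_
        by_cases hx : R < ‖x‖
        · have : x ∈ {x : Plane | R < ‖x‖} := hx
          simp [this]
        · have : x ∈ Metric.ball (0 : Plane) (R + 1) := by
            rw [mem_ball_zero_iff]; linarith
          simp [this]
    _ = _ := lintegral_add_left' (by fun_prop) _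
    _ ≤ η / 2 + η / 2 := add_le_add hB (le_trans (lintegral_tail_le hR (U i))
        (le_trans (by gcongr; exact enorm_le_ofReal hM i) hR1))
    _ = η := ENNReal.add_halves η

end Compactness

/-! ### The Nehari method in a Hilbert space -/

section Abstract

variable {X : Type*} [NormedAddCommGroup X] [InnerProductSpace ℝ X]

/-- Along an ultrafilter, every bounded sequence in a Hilbert space has a weak limit. -/
theorem exists_weak_limit [CompleteSpace X] {x : ℕ → X} {M : ℝ} (hM : ∀ n, ‖x n‖ ≤ M)
    (l : Ultrafilter ℕ) : ∃ w : X, ∀ ℓ : X →L[ℝ] ℝ, Tendsto (fun n => ℓ (x n)) l (𝓝 (ℓ w)) := by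
  set y : ℕ → WeakDual ℝ X := fun n => StrongDual.toWeakDual (InnerProductSpace.toDual ℝ X (x n))
  have hy : ∀ n, y n ∈ WeakDual.toStrongDual ⁻¹' Metric.closedBall (0 : StrongDual ℝ X) M := fun n => by
    change InnerProductSpace.toDual ℝ X (x n) ∈ Metric.closedBall (0 : StrongDual ℝ X) M
    simpa using hM n
  -- The Banach–Alaoglu theorem. With an ultrafilter compactness gives a limit directly, without
  -- subsequences or separability.
  obtain ⟨φ, -, hφ⟩ := (WeakDual.isCompact_closedBall (𝕜 := ℝ) (0 : StrongDual ℝ X) M).ultrafilter_le_nhds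
    (l.map y) (by
      rw [le_principal_iff]
      exact Eventually.of_forall (f := (l : Filter ℕ)) hy)
  refine ⟨(InnerProductSpace.toDual ℝ X).symm (WeakDual.toStrongDual φ), fun ℓ => ?_⟩
  set z := (InnerProductSpace.toDual ℝ X).symm ℓ with hz
  have e : ∀ v, ℓ v = inner ℝ v z := fun v => by
    rw [real_inner_comm, hz, InnerProductSpace.toDual_symm_apply]
  simp only [e]
  have h1 : Tendsto (fun n => y n z) l (𝓝 (φ z)) :=
    ((WeakDual.eval_continuous z).tendsto φ).comp hφ
  rw [InnerProductSpace.toDual_symm_apply]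
  exact h1

/-- The structure of an energy functional `E(u) = B(u, u) / 2 - J(u)` for which the Nehari method
works. -/
structure NehariSetting (B : X →L[ℝ] X →L[ℝ] ℝ) (J : X → ℝ) (J' : X → X →L[ℝ] ℝ) : Prop where
  symm : ∀ u v, B u v = B v u
  coercive : ∃ c : ℝ, 0 < c ∧ ∀ u, c * ‖u‖ ^ 2 ≤ B u u
  strictDeriv : ∀ u, HasStrictFDerivAt J (J' u) u
  weakCont : ∀ (l : Filter ℕ) (x : ℕ → X) (w : X) (M : ℝ), (∀ n, ‖x n‖ ≤ M) →
    (∀ ℓ : X →L[ℝ] ℝ, Tendsto (fun n => ℓ (x n)) l (𝓝 (ℓ w))) →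
    Tendsto (fun n => J (x n)) l (𝓝 (J w))
  map_zero : J 0 = 0
  convex : ∀ u, u ≠ 0 → StrictConvexOn ℝ (Ici 0) fun r => J (√r • u)
  exists_neg : ∀ u, u ≠ 0 → ∃ t : ℝ, 0 < t ∧ 1 / 2 * B (t • u) (t • u) - J (t • u) < 0
  exists_pos : ∀ u, u ≠ 0 → ∃ t : ℝ, 0 < t ∧ 0 < 1 / 2 * B (t • u) (t • u) - J (t • u)

namespace NehariSetting

variable {B : X →L[ℝ] X →L[ℝ] ℝ} {J : X → ℝ} {J' : X → X →L[ℝ] ℝ} {E : X → ℝ}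

theorem strictDeriv_energy (H : NehariSetting B J J') (hE : ∀ u, E u = 1 / 2 * B u u - J u) (u : X) :
    HasStrictFDerivAt E (B u - J' u) u := by
  have h1 : HasStrictFDerivAt (fun u => B u u) (2 • B u) u := by
    have := (B.hasStrictFDerivAt (x := u)).clm_apply (hasStrictFDerivAt_id u)
    refine this.congr_fderiv ?_
    ext v
    simp [H.symm v u, two_mul]
  have h2 := (h1.const_mul (1 / 2)).sub (H.strictDeriv u)
  have e : E = fun u => 1 / 2 * B u u - J u := funext hE
  rw [e]
  refine h2.congr_fderiv ?_
  ext v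
  simp

theorem pos (H : NehariSetting B J J') {u : X} (hu : u ≠ 0) : 0 < B u u := by
  obtain ⟨c, hc, h⟩ := H.coercive
  exact lt_of_lt_of_le (mul_pos hc (pow_pos (norm_pos_iff.2 hu) 2)) (h u)

/-- In the parameter `r = t²` the quadratic part of the energy is linear, so strict convexity of `J`
alone decides. -/
theorem strictConcave (H : NehariSetting B J J') (hE : ∀ u, E u = 1 / 2 * B u u - J u) {u : X}
    (hu : u ≠ 0) : StrictConcaveOn ℝ (Ici 0) fun r => E (√r • u) := by
  have h1 : ConcaveOn ℝ (Ici 0) fun r : ℝ => r * (1 / 2 * B u u) :=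
    (LinearMap.mulRight ℝ (1 / 2 * B u u)).concaveOn (convex_Ici 0)
  refine (h1.add_strictConcaveOn (H.convex u hu).neg).congr fun r hr => ?_
  have : √r * √r = r := Real.mul_self_sqrt hr
  simp only [Pi.add_apply, Pi.neg_apply, hE, map_smul, FunLike.coe_smul, Pi.smul_apply, smul_eq_mul]
  linear_combination (-(1 / 2) * B u u) * this

theorem continuous_energy (H : NehariSetting B J J') (hE : ∀ u, E u = 1 / 2 * B u u - J u) :
    Continuous E :=
  continuous_iff_continuousAt.2 fun u => (H.strictDeriv_energy hE u).hasFDerivAt.continuousAt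

/-- On the ray through a point of the Nehari manifold, the energy is maximal only at that
point. -/
theorem lt_of_nehari (H : NehariSetting B J J') (hE : ∀ u, E u = 1 / 2 * B u u - J u) {u : X}
    (hu : u ≠ 0) (h0 : B u u - J' u u = 0) {t : ℝ} (ht : 0 ≤ t) (ht1 : t ≠ 1) :
    E (t • u) < E u := by
  have hk := H.strictConcave hE hu
  -- The Nehari condition says that the ray function is stationary at `r = 1`, and a strictly
  -- concave function lies strictly below its tangent away from the point of contact.
  have hd : HasDerivAt (fun r => E (√r • u)) 0 1 := by
    have h1 : HasDerivAt (fun r => √r • u) ((1 / (2 * √1)) • u) 1 :=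
      (Real.hasDerivAt_sqrt one_ne_zero).smul_const u
    have h2 : HasFDerivAt E (B u - J' u) ((fun r => √r • u) 1) := by
      simpa using (H.strictDeriv_energy hE u).hasFDerivAt
    have h3 := h2.comp_hasDerivAt 1 h1
    refine h3.congr_deriv ?_
    simp [h0]
  have hr : t ^ 2 ≠ 1 := fun h => ht1 (by nlinarith)
  have e1 : E u = E (√1 • u) := by simp
  have e2 : E (t • u) = E (√(t ^ 2) • u) := by rw [Real.sqrt_sq ht]
  rw [e1, e2]
  rcases lt_or_gt_of_ne hr with h | h
  · have := hk.lt_slope_of_hasDerivAt (sq_nonneg t) (zero_le_one' ℝ) h hd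
    rw [slope_def_field, lt_div_iff₀ (by linarith)] at this
    linarith
  · have := hk.slope_lt_of_hasDerivAt (zero_le_one' ℝ) (sq_nonneg t) h hd
    rw [slope_def_field, div_lt_iff₀ (by linarith)] at this
    linarith

theorem le_of_nehari (H : NehariSetting B J J') (hE : ∀ u, E u = 1 / 2 * B u u - J u) {u : X}
    (hu : u ≠ 0) (h0 : B u u - J' u u = 0) {t : ℝ} (ht : 0 ≤ t) : E (t • u) ≤ E u := by
  rcases eq_or_ne t 1 with rfl | h
  · simp
  · exact (H.lt_of_nehari hE hu h0 ht h).le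

/-- Every ray meets the Nehari manifold in the point of maximal energy. -/
theorem exists_max (H : NehariSetting B J J') (hE : ∀ u, E u = 1 / 2 * B u u - J u) {u : X}
    (hu : u ≠ 0) : ∃ t : ℝ, 0 < t ∧ B (t • u) u - J' (t • u) u = 0 ∧
      (∀ s : ℝ, 0 ≤ s → E (s • u) ≤ E (t • u)) ∧ 0 < E (t • u) := by
  obtain ⟨t₁, ht₁, h₁⟩ := H.exists_neg u hu
  obtain ⟨t₂, ht₂, h₂⟩ := H.exists_pos u hu
  rw [← hE] at h₁ h₂
  have hE0 : E 0 = 0 := by rw [hE, H.map_zero]; simp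
  have hcont : Continuous fun t : ℝ => E (t • u) :=
    (H.continuous_energy hE).comp (continuous_id.smul continuous_const)
  have hk := (H.strictConcave hE hu).concaveOn
  -- A concave function of `r` that is `0` at the origin and negative at `t₁²` cannot be positive
  -- further out. The maximum over the ray is thus the maximum over the compact interval `[0, t₁]`.
  have hfar : ∀ s, t₁ < s → E (s • u) ≤ 0 := by
    intro s hs
    by_contra! hcon
    have := hk.min_le_of_mem_Icc (x := 0) (y := s ^ 2) (z := t₁ ^ 2) self_mem_Ici (sq_nonneg s)
      ⟨sq_nonneg t₁, by gcongr⟩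
    simp only [Real.sqrt_zero, zero_smul, hE0, Real.sqrt_sq ht₁.le, Real.sqrt_sq (ht₁.trans hs).le]
      at this
    rw [min_eq_left hcon.le] at this
    linarith
  obtain ⟨t, htm, hmax⟩ := isCompact_Icc.exists_isMaxOn (nonempty_Icc.2 ht₁.le) hcont.continuousOn
  have ht₂' : t₂ ≤ t₁ := by
    by_contra! hcon
    linarith [hfar t₂ hcon]
  have hpos : 0 < E (t • u) := h₂.trans_le (hmax ⟨ht₂.le, ht₂'⟩)
  have hall : ∀ s : ℝ, 0 ≤ s → E (s • u) ≤ E (t • u) := fun s hs => by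
    rcases le_or_gt s t₁ with h | h
    · exact hmax ⟨hs, h⟩
    · exact (hfar s h).trans hpos.le
  have ht : 0 < t := lt_of_le_of_ne htm.1 fun h => by
    rw [← h, zero_smul, hE0] at hpos
    exact lt_irrefl _ hpos
  refine ⟨t, ht, ?_, hall, hpos⟩
  have hd : HasDerivAt (fun s : ℝ => E (s • u)) ((B (t • u) - J' (t • u)) u) t := by
    have := (H.strictDeriv_energy hE (t • u)).hasFDerivAt.comp_hasDerivAt t
      ((hasDerivAt_id t).smul_const u)
    exact this.congr_deriv (by simp)
  refine IsLocalMax.hasDerivAt_eq_zero ?_ hd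
  filter_upwards [Ioi_mem_nhds ht] with s hs
  exact hall s (le_of_lt hs)

/-- A point of least energy on the Nehari manifold is a critical point of the energy. -/
theorem deriv_eq_zero (H : NehariSetting B J J') (hE : ∀ u, E u = 1 / 2 * B u u - J u) {u : X}
    (hu : u ≠ 0) (h0 : B u u - J' u u = 0)
    (hmin : ∀ w, w ≠ 0 → ∀ t : ℝ, (∀ s : ℝ, 0 ≤ s → E (s • w) ≤ E (t • w)) → E u ≤ E (t • w))
    (v : X) : (B u - J' u) v = 0 := by
  suffices h : ∀ v, 0 ≤ (B u - J' u) v by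
    have := h (-v)
    rw [map_neg] at this
    linarith [h v]
  intro v
  choose! T hT using fun (w : X) (hw : w ≠ 0) => H.exists_max hE hw
  have cE := H.continuous_energy hE
  set w : ℝ → X := fun s => u + s • v with hw
  have cw : Continuous w := by fun_prop
  have w0 : w 0 = u := by simp [hw]
  have hne : ∀ᶠ s in 𝓝 (0 : ℝ), w s ≠ 0 := (cw.tendsto 0).eventually_ne (by rwa [w0])
  -- The strict inequalities `E ((1 ± δ) u) < E u` persist for `w s` near `u`. If the maximizer `T
  -- (w s)` were outside `(1 - δ, 1 + δ)`, then `1 + δ` or `1 - δ` would lie between `1` and it, and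
  -- concavity would make the energy there at least `E (w s)`.
  have hlim : Tendsto (fun s => T (w s)) (𝓝 0) (𝓝 1) := by
    rw [Metric.tendsto_nhds]
    intro δ₀ hδ₀
    obtain ⟨δ, hδ, hδ1, hδδ⟩ : ∃ δ : ℝ, 0 < δ ∧ δ < 1 ∧ δ ≤ δ₀ :=
      ⟨min δ₀ (1 / 2), by positivity, (min_le_right _ _).trans_lt (by norm_num), min_le_left _ _⟩
    have hlt : ∀ a : ℝ, 0 ≤ a → a ≠ 1 → ∀ᶠ s in 𝓝 (0 : ℝ), E (a • w s) < E (w s) := by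
      intro a ha ha1
      refine Tendsto.eventually_lt ((cE.comp (cw.const_smul a)).tendsto 0) ((cE.comp cw).tendsto 0) ?_
      simp only [Function.comp_apply, Pi.smul_apply, w0]
      exact H.lt_of_nehari hE hu h0 ha ha1
    filter_upwards [hne, hlt (1 + δ) (by linarith) (by linarith), hlt (1 - δ) (by linarith)
      (by linarith)] with s hs h1 h2
    obtain ⟨hp, -, hmx, -⟩ := hT (w s) hs
    have hk := (H.strictConcave hE hs).concaveOn
    have hm1 := hmx 1 zero_le_one
    rw [one_smul] at hm1
    refine lt_of_lt_of_le ?_ hδδ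
    rw [Real.dist_eq, abs_lt]
    constructor
    · by_contra! hcon
      have := hk.min_le_of_mem_Icc (x := T (w s) ^ 2) (y := 1) (z := (1 - δ) ^ 2)
        (mem_Ici.2 (sq_nonneg _))
        (zero_le_one' ℝ) ⟨pow_le_pow_left₀ hp.le (by linarith) 2, by nlinarith⟩
      simp only [Real.sqrt_sq hp.le, Real.sqrt_one, one_smul,
        Real.sqrt_sq (show 0 ≤ 1 - δ by linarith), min_eq_right hm1] at this
      linarith
    · by_contra! hcon
      have := hk.min_le_of_mem_Icc (x := 1) (y := T (w s) ^ 2) (z := (1 + δ) ^ 2)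
        (zero_le_one' ℝ) (mem_Ici.2 (sq_nonneg _)) ⟨by nlinarith, pow_le_pow_left₀ (by linarith) (by linarith) 2⟩
      simp only [Real.sqrt_sq hp.le, Real.sqrt_one, one_smul,
        Real.sqrt_sq (show 0 ≤ 1 + δ by linarith), min_eq_left hm1] at this
      linarith
  -- Energies are compared at `T (w s) • w s` and `T (w s) • u`. Both points vary, which is why
  -- strict differentiability at `u` is used.
  have hpair : Tendsto (fun s => (T (w s) • w s, T (w s) • u)) (𝓝 0) (𝓝 (u, u)) := by
    have h1 := hlim.smul (cw.tendsto 0)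
    have h2 := hlim.smul_const u
    rw [w0, one_smul] at h1
    rw [one_smul] at h2
    exact h1.prodMk_nhds h2
  have hsd := (H.strictDeriv_energy hE u).isLittleO
  by_contra! hcon
  -- Makes the error `ε ‖v‖` at most half of the supposedly negative derivative; the `+ 1` keeps the
  -- denominator positive. The difference of the two energies is then negative, but `E u` separates
  -- them in the opposite order: minimality on one side, maximality on the ray of `u` on the other.
  set ε := -(B u - J' u) v / (2 * (‖v‖ + 1)) with hε
  have hε0 : 0 < ε := div_pos (by linarith) (by positivity)
  have hev := hpair.eventually (hsd.def hε0)
  have hev' : ∀ᶠ s in 𝓝[>] (0 : ℝ), False := by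
    filter_upwards [nhdsWithin_le_nhds hev, nhdsWithin_le_nhds hne, self_mem_nhdsWithin]
      with s hs hsn (hs0 : 0 < s)
    obtain ⟨hp, -, hmx, -⟩ := hT (w s) hsn
    have a1 := hmin (w s) hsn _ hmx
    have a2 := H.le_of_nehari hE hu h0 hp.le
    have e : T (w s) • w s - T (w s) • u = (T (w s) * s) • v := by
      simp only [hw, smul_add, smul_smul]; abel
    rw [e, map_smul, smul_eq_mul, norm_smul, Real.norm_eq_abs, Real.norm_eq_abs,
      abs_of_pos (mul_pos hp hs0)] at hs
    have a3 := (abs_le.1 hs).2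
    have hts := mul_pos hp hs0
    have a4 : ε * ‖v‖ ≤ -(B u - J' u) v / 2 := by
      rw [hε, div_mul_eq_mul_div, div_le_div_iff₀ (by positivity) two_pos]
      nlinarith
    nlinarith [mul_le_mul_of_nonneg_left a4 hts.le, mul_neg_of_pos_of_neg hts hcon]
  exact (hev'.exists).elim fun _ h => h

/-- Existence of a ground state. -/
theorem exists_ground_state [CompleteSpace X] [Nontrivial X] (H : NehariSetting B J J')
    (hE : ∀ u, E u = 1 / 2 * B u u - J u) :
    ∃ v, v ≠ 0 ∧ (∀ w, (B v - J' v) w = 0) ∧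
      ∀ w, w ≠ 0 → ∀ t : ℝ, (∀ s : ℝ, 0 ≤ s → E (s • w) ≤ E (t • w)) → E v ≤ E (t • w) := by
  choose! T hT using fun (w : X) (hw : w ≠ 0) => H.exists_max hE hw
  set S : Set ℝ := (fun w => E (T w • w)) '' {w | w ≠ 0} with hS
  obtain ⟨w₀, hw₀⟩ := exists_ne (0 : X)
  have hSne : S.Nonempty := ⟨_, w₀, hw₀, rfl⟩
  have hSbdd : BddBelow S := ⟨0, by rintro _ ⟨w, hw, rfl⟩; exact (hT w hw).2.2.2.le⟩
  obtain ⟨y, -, hylim, hyS⟩ := exists_seq_tendsto_sInf hSne hSbdd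
  choose x hx0 hxy using hyS
  obtain ⟨c, hc, hcoer⟩ := H.coercive
  -- Normalizing the directions by the form makes the sequence bounded at once; no bound for the
  -- maximizers on the Nehari manifold is needed.
  set b : ℕ → ℝ := fun n => √(B (x n) (x n)) with hb
  have hbpos : ∀ n, 0 < b n := fun n => Real.sqrt_pos.2 (H.pos (hx0 n))
  set z : ℕ → X := fun n => (b n)⁻¹ • x n with hz
  have hBz : ∀ n, B (z n) (z n) = 1 := fun n => by
    have hbb : b n * b n = B (x n) (x n) := Real.mul_self_sqrt (H.pos (hx0 n)).le
    simp only [hz, map_smul, FunLike.coe_smul, Pi.smul_apply, smul_eq_mul, ← hbb]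
    have := (hbpos n).ne'
    field_simp
  have hzM : ∀ n, ‖z n‖ ≤ √(1 / c) := fun n => by
    refine Real.le_sqrt_of_sq_le ?_
    rw [le_div_iff₀ hc, mul_comm, ← hBz n]
    exact hcoer _
  -- Every point of the ray, not only the maximizer, lies below the maximum `y n`. These
  -- inequalities for all `t` survive the weak limit because `J` is weakly continuous.
  have hzE : ∀ n (t : ℝ), 0 ≤ t → 1 / 2 * t ^ 2 - J (t • z n) ≤ y n := fun n t ht => by
    have h1 : E (t • z n) ≤ y n := by
      have := (hT _ (hx0 n)).2.2.1 (t * (b n)⁻¹) (mul_nonneg ht (inv_nonneg.2 (hbpos n).le))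
      rw [← smul_smul] at this
      rw [← hxy n]; exact this
    rw [hE] at h1
    simp only [map_smul, FunLike.coe_smul, Pi.smul_apply, smul_eq_mul, hBz] at h1
    linarith
  obtain ⟨w, hw⟩ := exists_weak_limit hzM (hyperfilter ℕ)
  have hylim' : Tendsto y (hyperfilter ℕ) (𝓝 (sInf S)) := hylim.mono_left Nat.hyperfilter_le_atTop
  have hwE : ∀ t : ℝ, 0 ≤ t → 1 / 2 * t ^ 2 - J (t • w) ≤ sInf S := fun t ht => by
    have h1 : Tendsto (fun n => J (t • z n)) (hyperfilter ℕ) (𝓝 (J (t • w))) := by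
      refine H.weakCont _ (fun n => t • z n) (t • w) (t * √(1 / c)) (fun n => ?_) (fun ℓ => ?_)
      · rw [norm_smul, Real.norm_of_nonneg ht]
        exact mul_le_mul_of_nonneg_left (hzM n) ht
      · simpa only [map_smul] using (hw ℓ).const_smul t
    exact le_of_tendsto_of_tendsto (h1.const_sub _) hylim'
      (Eventually.of_forall fun n => hzE n t ht)
  -- For `w = 0` the limit inequality would read `t² / 2 ≤ sInf S` for all `t ≥ 0`, which fails at
  -- `t = |sInf S| + 2`.
  have hw0 : w ≠ 0 := by
    rintro rfl
    have h1 := hwE (|sInf S| + 2) (by positivity)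
    rw [smul_zero, H.map_zero] at h1
    nlinarith [le_abs_self (sInf S), abs_nonneg (sInf S)]
  -- Weak lower semicontinuity of the form, from expanding `0 ≤ B (z n - w) (z n - w)`.
  have hBw : B w w ≤ 1 := by
    have h1 : Tendsto (fun n => 2 * B w (z n) - B w w) (hyperfilter ℕ) (𝓝 (2 * B w w - B w w)) :=
      ((hw (B w)).const_mul 2).sub_const _
    have h2 : ∀ n, 2 * B w (z n) - B w w ≤ 1 := fun n => by
      have h3 : 0 ≤ B (z n - w) (z n - w) := le_trans (by positivity) (hcoer (z n - w))
      simp only [map_sub, FunLike.coe_sub, Pi.sub_apply, hBz, H.symm (z n) w] at h3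
      linarith
    have := le_of_tendsto h1 (Eventually.of_forall h2)
    linarith
  have hmin : ∀ u, u ≠ 0 → ∀ t : ℝ, (∀ s : ℝ, 0 ≤ s → E (s • u) ≤ E (t • u)) →
      E (T w • w) ≤ E (t • u) := fun u hu t ht => by
    have h1 := hwE (T w) (hT w hw0).1.le
    have h2 : sInf S ≤ E (T u • u) := csInf_le hSbdd ⟨u, hu, rfl⟩
    have h3 := ht (T u) (hT u hu).1.le
    refine le_trans ?_ (h1.trans (h2.trans h3))
    rw [hE]
    simp only [map_smul, FunLike.coe_smul, Pi.smul_apply, smul_eq_mul]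
    nlinarith [mul_le_mul_of_nonneg_left hBw (sq_nonneg (T w))]
  have hv : T w • w ≠ 0 := smul_ne_zero (hT w hw0).1.ne' hw0
  have h0 : B (T w • w) (T w • w) - J' (T w • w) (T w • w) = 0 := by
    rw [map_smul (B (T w • w)), map_smul (J' (T w • w)), ← smul_sub, (hT w hw0).2.1, smul_zero]
  exact ⟨_, hv, H.deriv_eq_zero hE hv h0 hmin, hmin⟩

end NehariSetting

end Abstract

/-! ### Superlinear functions and their primitives -/

/-- A continuous function of superlinear and polynomial growth whose quotient by the identity is
monotone on both half-lines and vanishes at the origin. -/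
structure IsSuperlinear (g : ℝ → ℝ) (m : ℕ) : Prop where
  continuous : Continuous g
  map_zero : g 0 = 0
  growth : ∀ η : ℝ, 0 < η → ∃ C : ℝ, 0 ≤ C ∧ ∀ t, |g t| ≤ η * |t| + C * |t| ^ (m + 2)
  limit_zero : Tendsto (fun t => g t / t) (𝓝[≠] 0) (𝓝 0)
  strictMono_pos : StrictMonoOn (fun t => g t / t) (Ioi 0)
  strictAnti_neg : StrictAntiOn (fun t => g t / t) (Iio 0)
  limit_top : Tendsto (fun t => g t / t) atTop atTop
  limit_bot : Tendsto (fun t => g t / t) atBot atTop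

namespace IsSuperlinear

variable {g : ℝ → ℝ} {m : ℕ}

/-- Reduces statements about the negative half-line to the positive one. -/
theorem reflect (h : IsSuperlinear g m) : IsSuperlinear (fun t => -g (-t)) m := by
  have e : (fun t => -g (-t) / t) = (fun t => g t / t) ∘ Neg.neg := by
    ext t
    simp [neg_div, div_neg]
  constructor
  · exact (h.continuous.comp continuous_neg).neg
  · simp [h.map_zero]
  · intro η hη
    obtain ⟨C, hC, hb⟩ := h.growth η hη
    exact ⟨C, hC, fun t => by simpa using hb (-t)⟩
  · rw [e]
    refine h.limit_zero.comp ?_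
    refine tendsto_nhdsWithin_iff.2 ⟨?_, ?_⟩
    · exact tendsto_nhdsWithin_of_tendsto_nhds (by simpa using continuous_neg.tendsto (0 : ℝ))
    · filter_upwards [self_mem_nhdsWithin] with t ht
      simpa using ht
  · rw [e]
    intro a ha b hb hab
    exact h.strictAnti_neg (mem_Iio.2 (neg_lt_zero.2 hb)) (mem_Iio.2 (neg_lt_zero.2 ha))
      (neg_lt_neg hab)
  · rw [e]
    intro a ha b hb hab
    exact h.strictMono_pos (mem_Ioi.2 (neg_pos.2 hb)) (mem_Ioi.2 (neg_pos.2 ha))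
      (neg_lt_neg hab)
  · rw [e]; exact h.limit_bot.comp tendsto_neg_atTop_atBot
  · rw [e]; exact h.limit_top.comp tendsto_neg_atBot_atTop

theorem primitive_reflect (t : ℝ) : primitive (fun t => -g (-t)) t = primitive g (-t) := by
  simp only [primitive, intervalIntegral.integral_neg]
  rw [intervalIntegral.integral_comp_neg (fun x => g x), neg_zero, intervalIntegral.integral_symm,
    neg_neg]

/-- The quotient increases strictly from its limit `0`; the comparison point `t / 2` is what makes
the inequality strict. -/
theorem pos_of_pos (h : IsSuperlinear g m) {t : ℝ} (ht : 0 < t) : 0 < g t := by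
  have h1 : 0 ≤ g (t / 2) / (t / 2) := by
    have hlim : Tendsto (fun t => g t / t) (𝓝[>] 0) (𝓝 0) :=
      h.limit_zero.mono_left (nhdsWithin_mono 0 fun x (hx : 0 < x) => ne_of_gt hx)
    refine le_of_tendsto hlim ?_
    filter_upwards [Ioo_mem_nhdsGT (half_pos ht)] with s hs
    exact (h.strictMono_pos hs.1 (half_pos ht) hs.2).le
  have h2 := h.strictMono_pos (half_pos ht) ht (half_lt_self ht)
  exact (div_pos_iff_of_pos_right ht).1 (h1.trans_lt h2)

theorem hasDerivAt_primitive (h : IsSuperlinear g m) (t : ℝ) :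
    HasDerivAt (primitive g) (g t) t :=
  intervalIntegral.integral_hasDerivAt_right (h.continuous.intervalIntegrable _ _)
    (h.continuous.stronglyMeasurableAtFilter _ _) h.continuous.continuousAt

theorem continuous_primitive (h : IsSuperlinear g m) : Continuous (primitive g) :=
  continuous_iff_continuousAt.2 fun t => (h.hasDerivAt_primitive t).continuousAt

theorem primitive_nonneg (h : IsSuperlinear g m) (t : ℝ) : 0 ≤ primitive g t := by
  have key : ∀ {g : ℝ → ℝ}, IsSuperlinear g m → ∀ t, 0 ≤ t → 0 ≤ primitive g t := by
    intro g h t ht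
    refine intervalIntegral.integral_nonneg ht fun s hs => ?_
    rcases hs.1.eq_or_lt with h0 | h0
    · rw [← h0, h.map_zero]
    · exact (h.pos_of_pos h0).le
  rcases le_total 0 t with ht | ht
  · exact key h t ht
  · have := key h.reflect (-t) (neg_nonneg.2 ht)
    rwa [primitive_reflect, neg_neg] at this

theorem exists_le_primitive (h : IsSuperlinear g m) (K : ℝ) :
    ∃ T : ℝ, 0 < T ∧ ∀ t, T ≤ |t| → K * t ^ 2 ≤ primitive g t := by
  have key : ∀ {g : ℝ → ℝ}, IsSuperlinear g m → ∃ T : ℝ, 0 < T ∧ ∀ t, T ≤ t →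
      K * t ^ 2 ≤ primitive g t := by
    intro g h
    -- Only the integral over `[t / 2, t]` is used, where `∫ 4 |K| s = (3 / 2) |K| t² ≥ K t²`; the
    -- integral up to `t / 2` is nonnegative.
    obtain ⟨T, hT⟩ := eventually_atTop.1 (h.limit_top.eventually_ge_atTop (4 * |K|))
    refine ⟨2 * max T 1, by positivity, fun t ht => ?_⟩
    have ht1 : 1 ≤ t / 2 := by linarith [le_max_right T 1]
    have htT : T ≤ t / 2 := by linarith [le_max_left T 1]
    have h1 : primitive g t = primitive g (t / 2) + ∫ s in (t / 2)..t, g s :=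
      (intervalIntegral.integral_add_adjacent_intervals (h.continuous.intervalIntegrable _ _)
        (h.continuous.intervalIntegrable _ _)).symm
    have h2 : ∫ s in (t / 2)..t, (4 * |K|) * s ≤ ∫ s in (t / 2)..t, g s := by
      refine intervalIntegral.integral_mono_on (by linarith)
        (Continuous.intervalIntegrable (by fun_prop) _ _)
        (h.continuous.intervalIntegrable _ _) fun s hs => ?_
      have hs0 : 0 < s := by linarith [hs.1]
      exact (le_div_iff₀ hs0).1 (hT s (htT.trans hs.1))
    rw [intervalIntegral.integral_const_mul, integral_id] at h2
    have h3 := h.primitive_nonneg (t / 2)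
    have h4 := le_abs_self K
    nlinarith [mul_le_mul_of_nonneg_right h4 (sq_nonneg t), mul_nonneg (abs_nonneg K) (sq_nonneg t)]
  obtain ⟨T₁, hT₁, h₁⟩ := key h
  obtain ⟨T₂, hT₂, h₂⟩ := key h.reflect
  refine ⟨max T₁ T₂, by positivity, fun t ht => ?_⟩
  rcases le_total 0 t with h0 | h0
  · rw [abs_of_nonneg h0] at ht
    exact h₁ t ((le_max_left _ _).trans ht)
  · rw [abs_of_nonpos h0] at ht
    have := h₂ (-t) ((le_max_right _ _).trans ht)
    rwa [primitive_reflect, neg_neg, neg_sq] at this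

/-- By the chain rule the derivative is the quotient `g(s) / s` at `s = √r τ` times `τ² / 2`, so
this is the monotonicity of the quotient in another form. -/
theorem strictConvex_primitive_sqrt (h : IsSuperlinear g m) {τ : ℝ} (hτ : τ ≠ 0) :
    StrictConvexOn ℝ (Ici 0) fun r => primitive g (√r * τ) := by
  have key : ∀ {g : ℝ → ℝ}, IsSuperlinear g m → ∀ τ : ℝ, 0 < τ →
      StrictConvexOn ℝ (Ici 0) fun r => primitive g (√r * τ) := by
    intro g h τ hτ
    refine StrictMonoOn.strictConvexOn_of_deriv (convex_Ici 0)
      (h.continuous_primitive.comp (by fun_prop)).continuousOn ?_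
    rw [interior_Ici]
    have hd : ∀ r ∈ Ioi (0 : ℝ), deriv (fun r => primitive g (√r * τ)) r
        = g (√r * τ) / (√r * τ) * (τ ^ 2 / 2) := by
      intro r hr
      have hr' : 0 < √r := Real.sqrt_pos.2 hr
      have := (h.hasDerivAt_primitive (√r * τ)).comp r
        ((Real.hasDerivAt_sqrt (ne_of_gt hr)).mul_const τ)
      rw [show (fun r => primitive g (√r * τ)) = primitive g ∘ fun r => √r * τ from rfl, this.deriv]
      field_simp
    intro a ha b hb hab
    rw [hd a ha, hd b hb]
    refine mul_lt_mul_of_pos_right ?_ (by positivity)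
    have ha' : 0 < √a := Real.sqrt_pos.2 ha
    have hab' : √a < √b := Real.sqrt_lt_sqrt (le_of_lt ha) hab
    exact h.strictMono_pos (mul_pos ha' hτ) (mul_pos (ha'.trans hab') hτ)
      (mul_lt_mul_of_pos_right hab' hτ)
  rcases lt_or_gt_of_ne hτ with h0 | h0
  · have := key h.reflect (-τ) (neg_pos.2 h0)
    simpa only [primitive_reflect, mul_neg, neg_neg] using this
  · exact key h τ h0

theorem convex_primitive_sqrt (h : IsSuperlinear g m) (τ : ℝ) :
    ConvexOn ℝ (Ici 0) fun r => primitive g (√r * τ) := by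
  rcases eq_or_ne τ 0 with rfl | hτ
  · simp only [mul_zero]
    exact convexOn_const _ (convex_Ici 0)
  · exact (h.strictConvex_primitive_sqrt hτ).convexOn

theorem primitive_sub (h : IsSuperlinear g m) (a b : ℝ) :
    primitive g a - primitive g b = ∫ s in b..a, g s :=
  intervalIntegral.integral_interval_sub_left (h.continuous.intervalIntegrable _ _)
    (h.continuous.intervalIntegrable _ _)

theorem abs_le_max_of_mem_uIoc {a b s z : ℝ} (hs : s ∈ uIoc b a) :
    |s - z| ≤ max |a - z| |b - z| := by
  rw [uIoc, mem_Ioc] at hs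
  rcases le_total a b with h | h
  · rw [min_eq_right h, max_eq_left h] at hs
    rw [abs_le]
    constructor
    · linarith [neg_abs_le (a - z), le_max_left |a - z| |b - z|]
    · linarith [le_abs_self (b - z), le_max_right |a - z| |b - z|]
  · rw [min_eq_left h, max_eq_right h] at hs
    rw [abs_le]
    constructor
    · linarith [neg_abs_le (b - z), le_max_right |a - z| |b - z|]
    · linarith [le_abs_self (a - z), le_max_left |a - z| |b - z|]

theorem max_pow_le {x y : ℝ} (hx : 0 ≤ x) (hy : 0 ≤ y) (k : ℕ) : max x y ^ k ≤ x ^ k + y ^ k := by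
  rcases le_total x y with h | h
  · rw [max_eq_right h]; linarith [pow_nonneg hx k]
  · rw [max_eq_left h]; linarith [pow_nonneg hy k]

theorem abs_primitive_sub_le (h : IsSuperlinear g m) {η : ℝ} (hη : 0 < η) :
    ∃ C : ℝ, 0 ≤ C ∧ ∀ a b, |primitive g a - primitive g b| ≤
      (η * (|a| + |b|) + C * (|a| ^ (m + 2) + |b| ^ (m + 2))) * |a - b| := by
  obtain ⟨C, hC, hb⟩ := h.growth η hη
  refine ⟨C, hC, fun a b => ?_⟩
  rw [h.primitive_sub]
  refine intervalIntegral.norm_integral_le_of_norm_le_const (E := ℝ) fun s hs => ?_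
  have h1 := abs_le_max_of_mem_uIoc (z := 0) hs
  simp only [sub_zero] at h1
  refine (hb s).trans ?_
  gcongr
  · exact h1.trans (max_le (by linarith [abs_nonneg b]) (by linarith [abs_nonneg a]))
  · exact (pow_le_pow_left₀ (abs_nonneg s) h1 _).trans (max_pow_le (abs_nonneg a) (abs_nonneg b) _)

theorem pow_le_add_pow_succ {d : ℝ} (hd : 0 ≤ d) (k : ℕ) : d ^ (k + 1) ≤ d + d ^ (k + 2) := by
  rcases le_total d 1 with h | h
  · have := pow_le_pow_of_le_one hd h (show 1 ≤ k + 1 by omega)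
    rw [pow_one] at this
    linarith [pow_nonneg hd (k + 2)]
  · linarith [pow_le_pow_right₀ h (show k + 1 ≤ k + 2 by omega)]

/-- A modulus of continuity for superlinear functions. -/
theorem abs_sub_le (h : IsSuperlinear g m) {ε : ℝ} (hε : 0 < ε) :
    ∃ C : ℝ, 0 ≤ C ∧ ∀ s z, |g s - g z| ≤
      ε * (|z| + |z| ^ (m + 3)) + C * (|s - z| + |s - z| ^ (m + 3)) := by
  -- The `6` is spent in the case of small `z`, where `2 η |s| + 2 η |z| ≤ 6 η |z|` because `|s| ≤ 2
  -- |z|`.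
  obtain ⟨η, hη, hηε⟩ : ∃ η : ℝ, 0 < η ∧ 6 * η = ε := ⟨ε / 6, by positivity, by ring⟩
  obtain ⟨C₁, hC₁, hb⟩ := h.growth η hη
  obtain ⟨ρ, hρ, hρb⟩ : ∃ ρ : ℝ, 0 < ρ ∧ C₁ * (2 * ρ) ^ (m + 1) ≤ η := by
    have hc : Tendsto (fun ρ : ℝ => C₁ * (2 * ρ) ^ (m + 1)) (𝓝[>] 0) (𝓝 0) := by
      have : Continuous fun ρ : ℝ => C₁ * (2 * ρ) ^ (m + 1) := by fun_prop
      exact tendsto_nhdsWithin_of_tendsto_nhds (by simpa using this.tendsto 0)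
    obtain ⟨ρ, h1, h2⟩ := ((hc.eventually_le_const hη).and self_mem_nhdsWithin).exists
    exact ⟨ρ, h2, h1⟩
  -- Beyond `R` one extra power of `|z|` dominates the growth constant; this is why the exponent
  -- rises from `m + 2` to `m + 3`.
  set R : ℝ := C₁ * (2 ^ (m + 2) + 1) / η + ρ with hR
  have hRρ : ρ ≤ R := by
    have : 0 ≤ C₁ * (2 ^ (m + 2) + 1) / η := by positivity
    linarith
  have hR0 : 0 < R := hρ.trans_le hRρ
  obtain ⟨δ, hδ, hδb⟩ := Metric.uniformContinuousOn_iff.1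
    ((isCompact_Icc (a := -(2 * R)) (b := 2 * R)).uniformContinuousOn_of_continuous
      h.continuous.continuousOn) (η * ρ) (by positivity)
  -- If `d = |s - z|` satisfies `K d < |z|`, then `d < |z|`, and moreover `d < δ` whenever `|z| ≤
  -- R`.
  set K : ℝ := max 1 (R / δ) with hK
  have hK1 : 1 ≤ K := le_max_left _ _
  set C : ℝ := η * (2 * K + 1) + C₁ * ((K + 1) ^ (m + 2) + K ^ (m + 2)) + η + C₁ * 2 ^ (m + 2) +
    2 * η with hC
  have hC0 : 0 ≤ C := by positivity
  refine ⟨C, hC0, fun s z => ?_⟩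
  set d := |s - z| with hd
  have hd0 : 0 ≤ d := abs_nonneg _
  have hsz : |s| ≤ |z| + d := by
    have := abs_add_le z (s - z)
    rwa [add_sub_cancel] at this
  have hz0 := abs_nonneg z
  have htot : |g s - g z| ≤ η * (|s| + |z|) + C₁ * (|s| ^ (m + 2) + |z| ^ (m + 2)) := by
    have h1 := hb s
    have h2 := hb z
    have h3 := abs_sub (g s) (g z)
    linarith
  have hdm := pow_le_add_pow_succ hd0 (m + 1)
  have hdn : 0 ≤ d ^ (m + 3) := by positivity
  have hzn : 0 ≤ |z| ^ (m + 3) := by positivity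
  -- When `z` is comparable to the increment, both values are bounded by powers of `d`, and the
  -- intermediate power `m + 2` lies below `d + d ^ (m + 3)`.
  by_cases hzd : |z| ≤ K * d
  · have h1 : |s| ≤ (K + 1) * d := by linarith
    have h2 : |s| ^ (m + 2) ≤ (K + 1) ^ (m + 2) * d ^ (m + 2) := by
      rw [← mul_pow]; exact pow_le_pow_left₀ (abs_nonneg s) h1 _
    have h3 : |z| ^ (m + 2) ≤ K ^ (m + 2) * d ^ (m + 2) := by
      rw [← mul_pow]; exact pow_le_pow_left₀ hz0 hzd _
    have h4 : η * (|s| + |z|) ≤ η * (2 * K + 1) * d := by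
      rw [mul_assoc]; gcongr; linarith
    have h5 : C₁ * (|s| ^ (m + 2) + |z| ^ (m + 2)) ≤
        C₁ * ((K + 1) ^ (m + 2) + K ^ (m + 2)) * d ^ (m + 2) := by
      rw [mul_assoc]; gcongr; linarith
    have h6 : C₁ * ((K + 1) ^ (m + 2) + K ^ (m + 2)) * d ^ (m + 2) ≤
        C₁ * ((K + 1) ^ (m + 2) + K ^ (m + 2)) * (d + d ^ (m + 3)) := by gcongr
    have h7 : η * (2 * K + 1) * d ≤ η * (2 * K + 1) * (d + d ^ (m + 3)) := by
      gcongr; linarith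
    have h8 : 0 ≤ (η + C₁ * 2 ^ (m + 2) + 2 * η) * (d + d ^ (m + 3)) := by positivity
    have h9 : 0 ≤ ε * (|z| + |z| ^ (m + 3)) := by positivity
    have : C * (d + d ^ (m + 3)) = η * (2 * K + 1) * (d + d ^ (m + 3)) +
      C₁ * ((K + 1) ^ (m + 2) + K ^ (m + 2)) * (d + d ^ (m + 3)) +
      (η + C₁ * 2 ^ (m + 2) + 2 * η) * (d + d ^ (m + 3)) := by rw [hC]; ring
    linarith
  push Not at hzd
  have hdz : d < |z| := lt_of_le_of_lt (le_mul_of_one_le_left hd0 hK1) hzd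
  have hCd : 0 ≤ C * (d + d ^ (m + 3)) := by positivity
  have hεz : ε * (|z| + |z| ^ (m + 3)) = 6 * η * |z| + 6 * η * |z| ^ (m + 3) := by
    rw [← hηε]; ring
  have hηz : 0 ≤ η * |z| := by positivity
  have hηzn : 0 ≤ η * |z| ^ (m + 3) := by positivity
  -- For relatively small increments: near the origin `g` is `o(t)`, on the compact middle range
  -- uniform continuity applies, and for large `z` the higher power wins.
  rcases lt_or_ge |z| ρ with hzρ | hzρ
  · have small : ∀ t, |t| ≤ 2 * ρ → |g t| ≤ 2 * η * |t| := fun t ht => by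
      have h1 : C₁ * |t| ^ (m + 2) ≤ η * |t| := by
        rw [pow_succ, ← mul_assoc]
        gcongr
        exact le_trans (by gcongr) hρb
      linarith [hb t]
    have h1 := small s (by linarith)
    have h2 := small z (by linarith)
    have h3 := abs_sub (g s) (g z)
    have h4 : 2 * η * |s| ≤ 2 * η * (2 * |z|) := by gcongr; linarith
    linarith
  rcases le_or_gt |z| R with hzR | hzR
  · have hdδ : d < δ := by
      have h1 : R / δ * d < R := lt_of_le_of_lt
        (mul_le_mul_of_nonneg_right (le_max_right _ _) hd0) (hzd.trans_le hzR)
      rw [div_mul_eq_mul_div, div_lt_iff₀ hδ] at h1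
      exact lt_of_mul_lt_mul_left h1 hR0.le
    have hmem : ∀ t, |t| ≤ 2 * R → t ∈ Icc (-(2 * R)) (2 * R) := fun t ht => abs_le.1 ht
    have := hδb s (hmem s (by linarith)) z (hmem z (by linarith)) hdδ
    rw [Real.dist_eq] at this
    have h2 : η * ρ ≤ η * |z| := by gcongr
    linarith
  · have h1 : |s| ^ (m + 2) ≤ 2 ^ (m + 2) * |z| ^ (m + 2) := by
      rw [← mul_pow]; exact pow_le_pow_left₀ (abs_nonneg s) (by linarith) _
    have h2 : C₁ * (2 ^ (m + 2) + 1) ≤ η * |z| := by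
      have : C₁ * (2 ^ (m + 2) + 1) / η ≤ |z| := by linarith
      rwa [div_le_iff₀ hη, mul_comm |z|] at this
    have h3 : C₁ * (|s| ^ (m + 2) + |z| ^ (m + 2)) ≤ η * |z| ^ (m + 3) := by
      calc _ ≤ C₁ * (2 ^ (m + 2) * |z| ^ (m + 2) + |z| ^ (m + 2)) := by gcongr
        _ = C₁ * (2 ^ (m + 2) + 1) * |z| ^ (m + 2) := by ring
        _ ≤ η * |z| * |z| ^ (m + 2) := by gcongr
        _ = _ := by ring
    have h4 : η * (|s| + |z|) ≤ η * (3 * |z|) := by gcongr; linarith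
    linarith

/-- The remainder of the first-order expansion of the primitive. -/
theorem abs_primitive_sub_sub_le (h : IsSuperlinear g m) {ε : ℝ} (hε : 0 < ε) :
    ∃ C : ℝ, 0 ≤ C ∧ ∀ a b z, |primitive g a - primitive g b - g z * (a - b)| ≤
      (ε * (|z| + |z| ^ (m + 3)) + C * ((|a - z| + |b - z|) + (|a - z| ^ (m + 3) +
        |b - z| ^ (m + 3)))) * |a - b| := by
  obtain ⟨C, hC, hb⟩ := h.abs_sub_le hε
  refine ⟨C, hC, fun a b z => ?_⟩
  have e : primitive g a - primitive g b - g z * (a - b) = ∫ s in b..a, (g s - g z) := by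
    rw [intervalIntegral.integral_sub (h.continuous.intervalIntegrable _ _)
      intervalIntegrable_const, h.primitive_sub, intervalIntegral.integral_const, smul_eq_mul,
      mul_comm]
  rw [e]
  refine intervalIntegral.norm_integral_le_of_norm_le_const (E := ℝ) fun s hs => ?_
  have h1 := abs_le_max_of_mem_uIoc (z := z) hs
  refine (hb s z).trans ?_
  gcongr
  · exact h1.trans (max_le (by linarith [abs_nonneg (b - z)]) (by linarith [abs_nonneg (a - z)]))
  · exact (pow_le_pow_left₀ (abs_nonneg _) h1 _).trans (max_pow_le (abs_nonneg _) (abs_nonneg _) _)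

end IsSuperlinear

/-- The superlinear part of the nonlinearity. -/
theorem exists_isSuperlinear {p : ℝ} {f : ℝ → ℝ} (hf : Continuous f) (hA1 : GrowthBound p f)
    (hA2 : QuotientCondition f) (hp : 2 < p) :
    ∃ (b : ℝ) (m : ℕ), 0 ≤ b ∧ IsSuperlinear (fun t => f t + b * t) m := by
  obtain ⟨a, ha, hlim⟩ := hA2.limit_zero
  obtain ⟨C, hC, hb⟩ := hA1
  have hp0 : p ≠ 0 := by linarith
  have hf0 : f 0 = 0 := by
    have := hb 0
    rw [abs_zero, Real.zero_rpow hp0, add_zero, mul_zero] at this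
    exact abs_nonpos_iff.1 this
  have hq : ∀ t, t ≠ 0 → (f t + -a * t) / t = f t / t - a := fun t ht => by
    field_simp; ring
  have hlim0 : Tendsto (fun t => (f t + -a * t) / t) (𝓝[≠] 0) (𝓝 0) := by
    have h1 := hlim.sub_const a
    rw [sub_self] at h1
    refine h1.congr' ?_
    filter_upwards [self_mem_nhdsWithin] with t ht
    exact (hq t ht).symm
  -- Subtracting the limit slope makes the quotient vanish at `0`. The exponent is rounded up to an
  -- integer so that natural powers suffice throughout.
  refine ⟨-a, ⌈p⌉₊, by linarith, by fun_prop, by simp [hf0], ?_, hlim0, ?_, ?_, ?_, ?_⟩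
  · intro η hη
    obtain ⟨ρ, hρ, hρb⟩ := Metric.eventually_nhds_iff.1 (eventually_nhdsWithin_iff.1
      (hlim0.abs.eventually_le_const (by simpa using hη)))
    set k := ⌈p⌉₊ + 2
    have hpk : p ≤ (k : ℝ) := (Nat.le_ceil p).trans (by exact_mod_cast Nat.le_add_right _ 2)
    -- For `|t| < ρ` the linear term is enough by the limit at `0`. For `|t| ≥ ρ` both `|t|` and
    -- `|t| ^ p` are bounded by multiples of `(|t| / ρ) ^ k`, which gives the constant.
    refine ⟨((C + |a|) * ρ + C * ρ ^ p) / ρ ^ k, by positivity, fun t => ?_⟩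
    rcases eq_or_ne t 0 with rfl | ht
    · simp [hf0, k]
    have ht0 : 0 < |t| := abs_pos.2 ht
    rcases lt_or_ge |t| ρ with hlt | hge
    · have h1 := hρb (y := t) (by simpa [Real.dist_eq] using hlt) ht
      rw [abs_div, div_le_iff₀ ht0] at h1
      have : 0 ≤ ((C + |a|) * ρ + C * ρ ^ p) / ρ ^ k * |t| ^ k := by positivity
      linarith
    · have hx : 1 ≤ |t| / ρ := (one_le_div hρ).2 hge
      have h1 : |f t + -a * t| ≤ (C + |a|) * |t| + C * |t| ^ p := by
        have := abs_add_le (f t) (-a * t)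
        rw [abs_mul, abs_neg] at this
        linarith [hb t]
      have h2 : |t| ≤ ρ * (|t| / ρ) ^ k := by
        have := le_self_pow₀ hx (show k ≠ 0 by omega)
        calc |t| = ρ * (|t| / ρ) := by field_simp
          _ ≤ _ := by gcongr
      have h3 : |t| ^ p ≤ ρ ^ p * (|t| / ρ) ^ k := by
        have h4 : (|t| / ρ) ^ p ≤ (|t| / ρ) ^ (k : ℝ) := Real.rpow_le_rpow_of_exponent_le hx hpk
        rw [Real.rpow_natCast] at h4
        calc |t| ^ p = ρ ^ p * (|t| / ρ) ^ p := by
              rw [← Real.mul_rpow hρ.le (by positivity)]; congr 1; field_simp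
          _ ≤ _ := by gcongr
      have h5 : (C + |a|) * |t| + C * |t| ^ p ≤
          ((C + |a|) * ρ + C * ρ ^ p) * (|t| / ρ) ^ k := by
        calc _ ≤ (C + |a|) * (ρ * (|t| / ρ) ^ k) + C * (ρ ^ p * (|t| / ρ) ^ k) := by gcongr
          _ = _ := by ring
      have h6 : ((C + |a|) * ρ + C * ρ ^ p) * (|t| / ρ) ^ k =
        ((C + |a|) * ρ + C * ρ ^ p) / ρ ^ k * |t| ^ k := by rw [div_pow]; ring
      have : 0 ≤ η * |t| := by positivity
      linarith
  · intro x hx y hy hxy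
    have := hA2.strictMono_pos hx hy hxy
    simp only [hq x (ne_of_gt hx), hq y (ne_of_gt hy)]
    simpa using this
  · intro x hx y hy hxy
    have := hA2.strictAnti_neg hx hy hxy
    simp only [hq x (ne_of_lt hx), hq y (ne_of_lt hy)]
    simpa using this
  · refine (tendsto_atTop_add_const_right _ (-a) hA2.limit_top).congr' ?_
    filter_upwards [eventually_gt_atTop 0] with t ht
    rw [hq t ht.ne', sub_eq_add_neg]
  · refine (tendsto_atTop_add_const_right _ (-a) hA2.limit_bot).congr' ?_
    filter_upwards [eventually_lt_atBot 0] with t ht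
    rw [hq t ht.ne, sub_eq_add_neg]

/-! ### Regularity and weak continuity of the potential energy -/

theorem fn_sub_ae (U V : HPlus) : ∀ᵐ x ∂halfVol, fn (U - V) x = fn U x - fn V x :=
  Lp.coeFn_sub (fn U) (fn V)

theorem fn_smul_ae (c : ℝ) (U : HPlus) : ∀ᵐ x ∂halfVol, fn (c • U) x = c * fn U x :=
  Lp.coeFn_smul c (fn U)

theorem aestronglyMeasurable_fn (U : HPlus) : AEStronglyMeasurable (fn U) halfVol :=
  Lp.aestronglyMeasurable _

theorem memLp_abs_pow (k : ℕ) (W : HPlus) : MemLp (fun x => |fn W x| ^ (k + 1)) 2 halfVol := by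
  refine ⟨(continuous_abs.comp_aestronglyMeasurable (aestronglyMeasurable_fn W)).pow _, ?_⟩
  rw [eLpNorm_lt_top_iff_lintegral_rpow_enorm_lt_top (by simp) (by simp)]
  refine lt_of_le_of_lt (le_of_eq ?_) ((lintegral_pow_even_le k W).trans_lt (by finiteness))
  refine lintegral_congr fun x => ?_
  rw [ENNReal.toReal_ofNat, ENNReal.rpow_ofNat, enorm_pow, Real.enorm_abs, ← pow_mul, mul_comm]

theorem norm_abs_pow_le (k : ℕ) (W : HPlus) :
    ‖(memLp_abs_pow k W).toLp _‖ ≤ (k + 1).factorial * ‖W‖ ^ (k + 1) := by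
  have h1 : ‖(memLp_abs_pow k W).toLp _‖ₑ ^ 2 ≤ (((k + 1).factorial : ℝ≥0∞) * ‖W‖ₑ ^ (k + 1)) ^ 2 := by
    rw [← lintegral_enorm_sq_toLp]
    refine le_trans (le_of_eq ?_) ((lintegral_pow_even_le k W).trans (le_of_eq (by ring)))
    refine lintegral_congr fun x => ?_
    rw [enorm_pow, Real.enorm_abs, ← pow_mul, mul_comm]
  have h2 := (ENNReal.pow_le_pow_left_iff two_ne_zero).1 h1
  rw [← ofReal_norm, ← ofReal_norm, ← ENNReal.ofReal_pow (norm_nonneg _), ← ENNReal.ofReal_natCast,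
    ← ENNReal.ofReal_mul (by positivity)] at h2
  exact (ENNReal.ofReal_le_ofReal_iff (by positivity)).1 h2

theorem integrable_pow_mul (k : ℕ) (W V : HPlus) :
    Integrable (fun x => |fn W x| ^ (k + 1) * |fn V x|) halfVol :=
  (memLp_abs_pow k W).integrable_mul (Lp.memLp (fn V)).abs

theorem integral_pow_mul_le (k : ℕ) (W V : HPlus) :
    ∫ x, |fn W x| ^ (k + 1) * |fn V x| ∂halfVol ≤ (k + 1).factorial * ‖W‖ ^ (k + 1) * ‖V‖ := by
  have hV : MemLp (fun x => |fn V x|) 2 halfVol := (Lp.memLp (fn V)).abs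
  have hn : ‖hV.toLp _‖ = ‖fn V‖ := by
    rw [Lp.norm_toLp, Lp.norm_def]
    congr 1
    exact eLpNorm_norm (fn V)
  have e : ∫ x, |fn W x| ^ (k + 1) * |fn V x| ∂halfVol
      = inner ℝ (hV.toLp _) ((memLp_abs_pow k W).toLp _) := by
    rw [← integral_mul_eq_inner]
    refine integral_congr_ae ?_
    filter_upwards [(memLp_abs_pow k W).coeFn_toLp] with x hx
    rw [hx]
  rw [e]
  refine (real_inner_le_norm _ _).trans ?_
  rw [hn, mul_comm]
  gcongr
  · exact norm_abs_pow_le k W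
  · exact norm_coordL_le 0 V

theorem integrable_mul_abs (W V : HPlus) : Integrable (fun x => |fn W x| * |fn V x|) halfVol := by
  simpa using integrable_pow_mul 0 W V

theorem integral_mul_abs_le (W V : HPlus) :
    ∫ x, |fn W x| * |fn V x| ∂halfVol ≤ ‖W‖ * ‖V‖ := by
  simpa using integral_pow_mul_le 0 W V

theorem integral_mul_add_mul {α : Type*} [MeasurableSpace α] {μ : Measure α} {a b c d : α → ℝ}
    (ha : Integrable a μ) (hb : Integrable b μ) (hc : Integrable c μ) (hd : Integrable d μ)
    (s t : ℝ) : ∫ x, (s * (a x + b x) + t * (c x + d x)) ∂μ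
      = s * (∫ x, a x ∂μ + ∫ x, b x ∂μ) + t * (∫ x, c x ∂μ + ∫ x, d x ∂μ) := by
  have h1 : Integrable (fun x => a x + b x) μ := ha.add hb
  have h2 : Integrable (fun x => c x + d x) μ := hc.add hd
  rw [integral_add (h1.const_mul s) (h2.const_mul t), integral_const_mul, integral_const_mul,
    integral_add ha hb, integral_add hc hd]

/-- The potential energy `∫ G(u)`. -/
def potential (g : ℝ → ℝ) (U : HPlus) : ℝ := ∫ x, primitive g (fn U x) ∂halfVol

section Potential

variable {g : ℝ → ℝ} {m : ℕ}

theorem primitive_zero (g : ℝ → ℝ) : primitive g 0 = 0 := intervalIntegral.integral_same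

theorem IsSuperlinear.exists_abs_primitive_le (h : IsSuperlinear g m) {η : ℝ} (hη : 0 < η) :
    ∃ C : ℝ, 0 ≤ C ∧ ∀ t, |primitive g t| ≤ η * (|t| * |t|) + C * (|t| ^ (m + 2) * |t|) := by
  obtain ⟨C, hC, hb⟩ := h.abs_primitive_sub_le hη
  refine ⟨C, hC, fun t => ?_⟩
  have := hb t 0
  simp only [primitive_zero, sub_zero, abs_zero] at this
  rw [zero_pow (by omega)] at this
  linarith

theorem IsSuperlinear.integrable_primitive (h : IsSuperlinear g m) (U : HPlus) :
    Integrable (fun x => primitive g (fn U x)) halfVol := by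
  obtain ⟨C, hC, hb⟩ := h.exists_abs_primitive_le one_pos
  refine Integrable.mono' (((integrable_mul_abs U U).const_mul 1).add
    ((integrable_pow_mul (m + 1) U U).const_mul C))
    (h.continuous_primitive.comp_aestronglyMeasurable (aestronglyMeasurable_fn U))
    (ae_of_all _ fun x => hb _)

theorem IsSuperlinear.memLp_comp (h : IsSuperlinear g m) (U : HPlus) :
    MemLp (fun x => g (fn U x)) 2 halfVol := by
  obtain ⟨C, hC, hb⟩ := h.growth 1 one_pos
  have h1 : MemLp (fun x => 1 * |fn U x|) 2 halfVol := by
    simpa using (memLp_abs_pow 0 U).const_mul 1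
  have h2 : MemLp (fun x => C * |fn U x| ^ (m + 2)) 2 halfVol := (memLp_abs_pow (m + 1) U).const_mul C
  refine (h1.add h2).mono' (h.continuous.comp_aestronglyMeasurable (aestronglyMeasurable_fn U))
    (ae_of_all _ fun x => hb _)

theorem IsSuperlinear.integrable_comp_mul (h : IsSuperlinear g m) (U V : HPlus) :
    Integrable (fun x => g (fn U x) * fn V x) halfVol :=
  (h.memLp_comp U).integrable_mul (Lp.memLp (fn V))

/-- The derivative `v ↦ ∫ g(u) v` of the potential energy. -/
def potentialDeriv (h : IsSuperlinear g m) (U : HPlus) : HPlus →L[ℝ] ℝ :=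
  (innerSL ℝ ((h.memLp_comp U).toLp _)).comp (coordL 0)

theorem potentialDeriv_apply (h : IsSuperlinear g m) (U V : HPlus) :
    potentialDeriv h U V = ∫ x, g (fn U x) * fn V x ∂halfVol := by
  change inner ℝ ((h.memLp_comp U).toLp _) (fn V) = _
  rw [← integral_mul_eq_inner]
  simp only [mul_comm]

/-- The potential energy is continuously differentiable. -/
theorem hasStrictFDerivAt_potential (h : IsSuperlinear g m) (U : HPlus) :
    HasStrictFDerivAt (potential g) (potentialDeriv h U) U := by
  rw [hasStrictFDerivAt_iff_isLittleO, Asymptotics.isLittleO_iff]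
  intro c hc
  set n := m + 3 with hn
  set N : ℝ := (n.factorial : ℝ)
  -- Order of choices: `ε` depends on `‖U‖`, the constant `C` depends on `ε`, and the neighbourhood
  -- of `U` is taken last so that the `C` terms are small in it.
  obtain ⟨ε, hε, hεc⟩ : ∃ ε : ℝ, 0 < ε ∧ ε * (‖U‖ + N * ‖U‖ ^ n) ≤ c / 2 := by
    refine ⟨c / 2 / (‖U‖ + N * ‖U‖ ^ n + 1), by positivity, ?_⟩
    rw [div_mul_eq_mul_div, div_le_iff₀ (by positivity)]
    exact mul_le_mul_of_nonneg_left (by linarith) (by positivity)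
  obtain ⟨C, hC, hb⟩ := h.abs_primitive_sub_sub_le hε
  have hsmall : ∀ᶠ p : HPlus × HPlus in 𝓝 (U, U), C * ((‖p.1 - U‖ + ‖p.2 - U‖) +
      (N * ‖p.1 - U‖ ^ n + N * ‖p.2 - U‖ ^ n)) ≤ c / 2 := by
    have hcont : Continuous fun p : HPlus × HPlus => C * ((‖p.1 - U‖ + ‖p.2 - U‖) +
      (N * ‖p.1 - U‖ ^ n + N * ‖p.2 - U‖ ^ n)) := by fun_prop
    have := hcont.tendsto (U, U)
    simp only [sub_self, norm_zero, add_zero, ne_eq, hn, Nat.add_eq_zero_iff, OfNat.ofNat_ne_zero,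
      and_false, not_false_eq_true, zero_pow, mul_zero] at this
    exact this.eventually_le_const (half_pos hc)
  filter_upwards [hsmall] with p hp
  obtain ⟨A, A'⟩ := p
  simp only at hp ⊢
  set V := A - A'
  have i1 := integrable_mul_abs U V
  have i2 := integrable_pow_mul (m + 2) U V
  have i3 := integrable_mul_abs (A - U) V
  have i4 := integrable_mul_abs (A' - U) V
  have i5 := integrable_pow_mul (m + 2) (A - U) V
  have i6 := integrable_pow_mul (m + 2) (A' - U) V
  have e : potential g A - potential g A' - potentialDeriv h U V =
      ∫ x, (primitive g (fn A x) - primitive g (fn A' x) - g (fn U x) * fn V x) ∂halfVol := by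
    have i0 : Integrable (fun x => primitive g (fn A x) - primitive g (fn A' x)) halfVol :=
      (h.integrable_primitive A).sub (h.integrable_primitive A')
    rw [integral_sub i0 (h.integrable_comp_mul U V), integral_sub (h.integrable_primitive A)
      (h.integrable_primitive A'), potentialDeriv_apply]
    rfl
  have hbound : ‖potential g A - potential g A' - potentialDeriv h U V‖ ≤
      ∫ x, (ε * (|fn U x| * |fn V x| + |fn U x| ^ (m + 2 + 1) * |fn V x|) +
        C * ((|fn (A - U) x| * |fn V x| + |fn (A' - U) x| * |fn V x|) +
        (|fn (A - U) x| ^ (m + 2 + 1) * |fn V x| + |fn (A' - U) x| ^ (m + 2 + 1) * |fn V x|))) ∂halfVol := by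
    rw [e]
    refine norm_integral_le_of_norm_le (((i1.add i2).const_mul ε).add
      (((i3.add i4).add (i5.add i6)).const_mul C)) ?_
    filter_upwards [fn_sub_ae A A', fn_sub_ae A U, fn_sub_ae A' U] with x h1 h2 h3
    rw [h1, h2, h3]
    refine (hb (fn A x) (fn A' x) (fn U x)).trans (le_of_eq ?_)
    ring
  have i34 : Integrable (fun x => |fn (A - U) x| * |fn V x| + |fn (A' - U) x| * |fn V x|) halfVol :=
    i3.add i4
  have i56 : Integrable (fun x => |fn (A - U) x| ^ (m + 2 + 1) * |fn V x|
    + |fn (A' - U) x| ^ (m + 2 + 1) * |fn V x|) halfVol := i5.add i6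
  rw [integral_mul_add_mul i1 i2 i34 i56 ε C, integral_add i3 i4, integral_add i5 i6] at hbound
  have b1 := integral_mul_abs_le U V
  have b2 := integral_pow_mul_le (m + 2) U V
  have b3 := integral_mul_abs_le (A - U) V
  have b4 := integral_mul_abs_le (A' - U) V
  have b5 := integral_pow_mul_le (m + 2) (A - U) V
  have b6 := integral_pow_mul_le (m + 2) (A' - U) V
  refine hbound.trans ?_
  calc _ ≤ ε * (‖U‖ * ‖V‖ + N * ‖U‖ ^ n * ‖V‖) + C * ((‖A - U‖ * ‖V‖ + ‖A' - U‖ * ‖V‖) +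
        (N * ‖A - U‖ ^ n * ‖V‖ + N * ‖A' - U‖ ^ n * ‖V‖)) := by gcongr
    _ = (ε * (‖U‖ + N * ‖U‖ ^ n) + C * ((‖A - U‖ + ‖A' - U‖) +
        (N * ‖A - U‖ ^ n + N * ‖A' - U‖ ^ n))) * ‖V‖ := by ring
    _ ≤ (c / 2 + c / 2) * ‖V‖ := by gcongr
    _ = c * ‖V‖ := by ring

/-- Mixed moments with a factor that vanishes in the limit in `L⁴`. -/
theorem tendsto_integral_pow_mul {ι : Type*} {l : Filter ι} {U V : ι → HPlus} {M : ℝ}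
    (hM : ∀ i, ‖U i‖ ≤ M) (k : ℕ)
    (hV : Tendsto (fun i => ∫⁻ x, ‖fn (V i) x‖ₑ ^ 4 ∂halfVol) l (𝓝 0)) :
    Tendsto (fun i => ∫ x, |fn (U i) x| ^ (k + 2) * |fn (V i) x| ∂halfVol) l (𝓝 0) := by
  set K : ℝ≥0∞ := (ENNReal.ofReal M ^ 2) ^ 2 * (((2 * k + 1 + 1).factorial : ℝ≥0∞) ^ 2 *
    ENNReal.ofReal M ^ (2 * (2 * k + 1 + 1)))
  have hK : K ≠ ⊤ := by simp only [K]; finiteness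
  have hle : ∀ i, (∫⁻ x, ‖fn (U i) x‖ₑ ^ (k + 2) * ‖fn (V i) x‖ₑ ∂halfVol) ^ 4 ≤
      K * ∫⁻ x, ‖fn (V i) x‖ₑ ^ 4 ∂halfVol := fun i => by
    have mU : AEMeasurable (fun x => ‖fn (U i) x‖ₑ) halfVol := (aestronglyMeasurable_fn _).enorm
    have mV : AEMeasurable (fun x => ‖fn (V i) x‖ₑ) halfVol := (aestronglyMeasurable_fn _).enorm
    -- Two applications of the Cauchy–Schwarz inequality: `(∫ u^(k+2) v)² ≤ ∫ u² · ∫ u^(2k+2) v²`,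
    -- and then `(∫ u^(2k+2) v²)² ≤ ∫ u^(4k+4) · ∫ v⁴`.
    have h1 := sq_lintegral_mul_le mU ((mU.pow_const (k + 1)).mul mV)
    have h2 := sq_lintegral_mul_le (mU.pow_const (2 * k + 2)) (mV.pow_const 2)
    have e1 : ∫⁻ x, ‖fn (U i) x‖ₑ ^ (k + 2) * ‖fn (V i) x‖ₑ ∂halfVol = ∫⁻ x, ‖fn (U i) x‖ₑ *
        ((fun x => ‖fn (U i) x‖ₑ ^ (k + 1)) * fun x => ‖fn (V i) x‖ₑ) x ∂halfVol :=
      lintegral_congr fun x => by simp only [Pi.mul_apply]; ring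
    have e2 : ∫⁻ x, ((fun x => ‖fn (U i) x‖ₑ ^ (k + 1)) * fun x => ‖fn (V i) x‖ₑ) x ^ 2 ∂halfVol
        = ∫⁻ x, ‖fn (U i) x‖ₑ ^ (2 * k + 2) * ‖fn (V i) x‖ₑ ^ 2 ∂halfVol :=
      lintegral_congr fun x => by simp only [Pi.mul_apply]; ring
    have e3 : ∫⁻ x, (‖fn (U i) x‖ₑ ^ (2 * k + 2)) ^ 2 ∂halfVol
        = ∫⁻ x, ‖fn (U i) x‖ₑ ^ (2 * (2 * k + 1 + 1)) ∂halfVol :=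
      lintegral_congr fun x => by ring
    have e4 : ∫⁻ x, (‖fn (V i) x‖ₑ ^ 2) ^ 2 ∂halfVol = ∫⁻ x, ‖fn (V i) x‖ₑ ^ 4 ∂halfVol :=
      lintegral_congr fun x => by ring
    rw [e1, show (4 : ℕ) = 2 * 2 by norm_num, pow_mul]
    have hU := enorm_le_ofReal hM i
    calc _ ≤ _ := pow_le_pow_left' h1 2
      _ = (∫⁻ x, ‖fn (U i) x‖ₑ ^ 2 ∂halfVol) ^ 2 *
        (∫⁻ x, ‖fn (U i) x‖ₑ ^ (2 * k + 2) * ‖fn (V i) x‖ₑ ^ 2 ∂halfVol) ^ 2 := by rw [e2, mul_pow]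
      _ ≤ (ENNReal.ofReal M ^ 2) ^ 2 * ((((2 * k + 1 + 1).factorial : ℝ≥0∞) ^ 2 *
          ENNReal.ofReal M ^ (2 * (2 * k + 1 + 1))) * ∫⁻ x, ‖fn (V i) x‖ₑ ^ 4 ∂halfVol) := by
        refine mul_le_mul' (pow_le_pow_left' ?_ 2) (h2.trans ?_)
        · rw [lintegral_enorm_sq]
          exact pow_le_pow_left' ((enorm_coordL_le 0 (U i)).trans hU) 2
        · rw [e3, e4]
          exact mul_le_mul' ((lintegral_pow_even_le (2 * k + 1) (U i)).trans
            (mul_le_mul' le_rfl (pow_le_pow_left' hU _))) le_rfl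
      _ = _ := by simp only [K]; ring
  have hlim : Tendsto (fun i => ∫⁻ x, ‖fn (U i) x‖ₑ ^ (k + 2) * ‖fn (V i) x‖ₑ ∂halfVol) l (𝓝 0) := by
    have h0 : Tendsto (fun i => K * ∫⁻ x, ‖fn (V i) x‖ₑ ^ 4 ∂halfVol) l (𝓝 0) := by
      simpa using ENNReal.Tendsto.const_mul hV (Or.inr hK)
    rw [ENNReal.tendsto_nhds_zero] at h0 ⊢
    intro η hη
    filter_upwards [h0 (η ^ 4) (pos_iff_ne_zero.2 (pow_ne_zero 4 hη.ne'))] with i hi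
    exact (ENNReal.pow_le_pow_left_iff four_ne_zero).1 ((hle i).trans hi)
  have e : ∀ i, ∫ x, |fn (U i) x| ^ (k + 2) * |fn (V i) x| ∂halfVol
      = (∫⁻ x, ‖fn (U i) x‖ₑ ^ (k + 2) * ‖fn (V i) x‖ₑ ∂halfVol).toReal := fun i => by
    rw [integral_eq_lintegral_of_nonneg_ae (ae_of_all _ fun x => by positivity)
      (integrable_pow_mul (k + 1) (U i) (V i)).aestronglyMeasurable]
    congr 1
    refine lintegral_congr fun x => ?_
    rw [ENNReal.ofReal_mul (by positivity), ENNReal.ofReal_pow (abs_nonneg _),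
      ← Real.enorm_eq_ofReal_abs, ← Real.enorm_eq_ofReal_abs]
  simp only [e]
  have := (ENNReal.tendsto_toReal ENNReal.zero_ne_top).comp hlim
  rw [ENNReal.toReal_zero] at this
  exact this

/-- The potential energy is weakly continuous. -/
theorem tendsto_potential (h : IsSuperlinear g m) {l : Filter ℕ} {U : ℕ → HPlus} {W : HPlus} {M : ℝ}
    (hM : ∀ n, ‖U n‖ ≤ M) (hw : ∀ ℓ : HPlus →L[ℝ] ℝ, Tendsto (fun n => ℓ (U n)) l (𝓝 (ℓ W))) :
    Tendsto (fun n => potential g (U n)) l (𝓝 (potential g W)) := by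
  set V : ℕ → HPlus := fun n => U n - W
  set M' := M + ‖W‖
  have hV : ∀ n, ‖V n‖ ≤ M' := fun n => (norm_sub_le _ _).trans (add_le_add (hM n) le_rfl)
  have hM0 : 0 ≤ M := (norm_nonneg _).trans (hM 0)
  have hM' : 0 ≤ M' := add_nonneg hM0 (norm_nonneg _)
  have h4 := tendsto_lintegral_pow_four hV (l := l) fun ℓ => by
    simpa [V] using (hw ℓ).sub_const (ℓ W)
  have t1 := tendsto_integral_pow_mul hM m h4
  have t2 := tendsto_integral_pow_mul (U := fun _ : ℕ => W) (fun _ => le_rfl) m h4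
  rw [Metric.tendsto_nhds]
  intro ε hε
  -- The quadratic terms are merely bounded, with no convergence in `L²` used; they are made small
  -- by `η`, available since `g(t) = o(t)` at `0`. Only the higher-order terms use the compactness
  -- in `L⁴`.
  obtain ⟨η, hη, hηε⟩ : ∃ η : ℝ, 0 < η ∧ η * (M' * M') ≤ ε / 2 := by
    refine ⟨ε / 2 / (M' * M' + 1), by positivity, ?_⟩
    rw [div_mul_eq_mul_div, div_le_iff₀ (by positivity)]
    gcongr
    linarith
  obtain ⟨C, hC, hb⟩ := h.abs_primitive_sub_le hη
  have t3 := (t1.add t2).const_mul C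
  simp only [add_zero, mul_zero] at t3
  filter_upwards [t3.eventually_lt_const (half_pos hε)] with n hn
  have i1 := integrable_mul_abs (U n) (V n)
  have i2 := integrable_mul_abs W (V n)
  have i3 := integrable_pow_mul (m + 1) (U n) (V n)
  have i4 := integrable_pow_mul (m + 1) W (V n)
  have hbound : ‖potential g (U n) - potential g W‖ ≤
      ∫ x, (η * (|fn (U n) x| * |fn (V n) x| + |fn W x| * |fn (V n) x|) +
        C * (|fn (U n) x| ^ (m + 1 + 1) * |fn (V n) x| + |fn W x| ^ (m + 1 + 1) * |fn (V n) x|))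
        ∂halfVol := by
    rw [potential, potential, ← integral_sub (h.integrable_primitive _) (h.integrable_primitive _)]
    refine norm_integral_le_of_norm_le (((i1.add i2).const_mul η).add
      ((i3.add i4).const_mul C)) ?_
    filter_upwards [fn_sub_ae (U n) W] with x h1
    rw [h1]
    refine (hb (fn (U n) x) (fn W x)).trans (le_of_eq ?_)
    ring
  rw [integral_mul_add_mul i1 i2 i3 i4 η C] at hbound
  have b1 := integral_mul_abs_le (U n) (V n)
  have b2 := integral_mul_abs_le W (V n)
  have b3 : ‖U n‖ * ‖V n‖ + ‖W‖ * ‖V n‖ ≤ M' * M' := by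
    rw [← add_mul]
    gcongr
    · exact add_le_add (hM n) le_rfl
    · exact hV n
  rw [Real.dist_eq, ← Real.norm_eq_abs]
  refine lt_of_le_of_lt hbound ?_
  have b4 : η * (∫ x, |fn (U n) x| * |fn (V n) x| ∂halfVol + ∫ x, |fn W x| * |fn (V n) x| ∂halfVol)
      ≤ ε / 2 := le_trans (by gcongr; linarith) hηε
  linarith

end Potential

/-! ### Nonzero elements of `H⁺` and coercivity of the form -/

/-- The fundamental lemma of the calculus of variations. -/
theorem HasWeakPartial.eq_zero {i : Fin 2} {g : L2Half} (h : HasWeakPartial i 0 g) : g = 0 := by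
  have hopen : IsOpen halfPlane := isOpen_lt continuous_const (by fun_prop)
  have hloc : LocallyIntegrableOn g halfPlane halfVol :=
    ((Lp.memLp g).locallyIntegrable (by norm_num)).locallyIntegrableOn _
  have h0 := hopen.ae_eq_zero_of_integral_contDiff_smul_eq_zero hloc fun φ h1 h2 h3 => by
    have h4 := h φ ⟨h1, h2, h3⟩
    have h5 : ∫ x, (0 : L2Half) x * classicalPartial i φ x ∂halfVol = 0 := by
      refine integral_eq_zero_of_ae ?_
      filter_upwards [Lp.coeFn_zero ℝ 2 halfVol] with x hx
      rw [hx, Pi.zero_apply, zero_mul]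
    simp only [smul_eq_mul, mul_comm (φ _)]
    linarith
  refine Lp.ext ?_
  filter_upwards [h0, ae_restrict_mem measurableSet_halfPlane, Lp.coeFn_zero ℝ 2 halfVol]
    with x h1 h2 h3
  rw [h1 h2, h3, Pi.zero_apply]

/-- An element of `H⁺` is determined by its underlying function. -/
theorem eq_zero_of_fn_eq_zero {U : HPlus} (h : fn U = 0) : U = 0 := by
  have h1 : fnD1 U = 0 := by
    have := U.2.1.1 0
    change HasWeakPartial 0 (fn U) (fnD1 U) at this
    rw [h] at this
    exact this.eq_zero
  have h2 : fnD2 U = 0 := by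
    have := U.2.1.1 1
    change HasWeakPartial 1 (fn U) (fnD2 U) at this
    rw [h] at this
    exact this.eq_zero
  have h3 : fnAngle U = 0 := by
    have : (fnAngle U : Plane → ℝ) =ᵐ[halfVol] fun x => x 0 * fnD2 U x - x 1 * fnD1 U x := U.2.2
    rw [h1, h2] at this
    refine Lp.ext ?_
    filter_upwards [this, Lp.coeFn_zero ℝ 2 halfVol] with x hx h0
    rw [hx, h0]
    simp
  have := norm_sq_eq_sum U
  rw [h, h1, h2, h3] at this
  simpa using this

theorem not_ae_fn_eq_zero {U : HPlus} (hU : U ≠ 0) : ¬ ∀ᵐ x ∂halfVol, fn U x = 0 := fun h => by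
  refine hU (eq_zero_of_fn_eq_zero (Lp.ext ?_))
  filter_upwards [h, Lp.coeFn_zero ℝ 2 halfVol] with x h1 h2
  rw [h1, h2, Pi.zero_apply]

/-- A bump centred at `(1, 0)` with outer radius `1 / 2` stays inside the half-plane. The
minimization needs at least one ray. -/
instance : Nontrivial HPlus := by
  let f : ContDiffBump (point (1, 0)) := ⟨1 / 4, 1 / 2, by norm_num, by norm_num⟩
  have hf : IsTestFunction f := by
    refine ⟨f.contDiff, f.hasCompactSupport, ?_⟩
    rw [f.tsupport_eq]
    intro x hx
    have h1 : |(x - point (1, 0)) 0| ≤ 1 / 2 :=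
      (abs_coord_le _ 0).trans (mem_closedBall_iff_norm.1 hx)
    rw [PiLp.sub_apply, point_zero] at h1
    change 0 < x 0
    linarith [(abs_le.1 h1).1]
  refine ⟨testElem f hf, 0, fun h => ?_⟩
  have h1 : hf.memLp.toLp f = 0 := congrArg fn h
  have h2 : ∫ x, f x ∂halfVol = 0 := by
    refine integral_eq_zero_of_ae ?_
    filter_upwards [hf.memLp.coeFn_toLp, Lp.coeFn_zero ℝ 2 halfVol] with x h3 h4
    rw [← h3, h1, h4]
  rw [setIntegral_halfVol_eq fun x hx => hf.eq_zero_of_nonpos hx] at h2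
  exact (f.integral_pos (μ := volume)).ne' h2

/-- The pairing `∫ ∂ᵢ u ∂ᵢ v` of components as a bounded bilinear form. -/
def coordForm (i : Fin 4) : HPlus →L[ℝ] HPlus →L[ℝ] ℝ :=
  (LinearMap.mk₂ ℝ (fun U V => inner ℝ (coordL i U) (coordL i V))
    (fun _ _ _ => by rw [map_add, inner_add_left])
    (fun _ _ _ => by rw [map_smul, real_inner_smul_left, smul_eq_mul])
    (fun _ _ _ => by rw [map_add, inner_add_right])
    (fun _ _ _ => by rw [map_smul, real_inner_smul_right, smul_eq_mul])).mkContinuous₂ 1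
    fun U V => by
      rw [one_mul, LinearMap.mk₂_apply]
      exact (norm_inner_le_norm _ _).trans
        (mul_le_mul (norm_coordL_le i U) (norm_coordL_le i V) (norm_nonneg _) (norm_nonneg _))

/-- The energy form shifted by a multiple of the `L²` inner product. -/
def shiftedForm (lam b : ℝ) : HPlus →L[ℝ] HPlus →L[ℝ] ℝ :=
  coordForm 1 + coordForm 2 + (1 / lam ^ 2) • coordForm 3 + b • coordForm 0

theorem shiftedForm_eq_inner (lam b : ℝ) (U V : HPlus) :
    shiftedForm lam b U V = inner ℝ (fnD1 U) (fnD1 V) + inner ℝ (fnD2 U) (fnD2 V) +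
      1 / lam ^ 2 * inner ℝ (fnAngle U) (fnAngle V) + b * inner ℝ (fn U) (fn V) := rfl

theorem inner_eq_integral (u v : L2Half) : inner ℝ u v = ∫ x, u x * v x ∂halfVol := by
  simp [L2.inner_def, mul_comm]

theorem integrable_mul (u v : L2Half) : Integrable (fun x => u x * v x) halfVol :=
  (Lp.memLp u).integrable_mul (Lp.memLp v)

theorem shiftedForm_apply (lam b : ℝ) (U V : HPlus) :
    shiftedForm lam b U V = energyForm lam U V + b * ∫ x, fn U x * fn V x ∂halfVol := by
  have h1 := integrable_mul (fnD1 U) (fnD1 V)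
  have h2 := integrable_mul (fnD2 U) (fnD2 V)
  have h3 := integrable_mul (fnAngle U) (fnAngle V)
  have h12 : Integrable (fun x => fnD1 U x * fnD1 V x + fnD2 U x * fnD2 V x) halfVol := h1.add h2
  rw [shiftedForm_eq_inner, energyForm, integral_add h12 (h3.const_mul _), integral_add h1 h2,
    integral_const_mul]
  simp only [inner_eq_integral]

theorem shiftedForm_self (lam b : ℝ) (U : HPlus) :
    shiftedForm lam b U U = ‖fnD1 U‖ ^ 2 + ‖fnD2 U‖ ^ 2 + 1 / lam ^ 2 * ‖fnAngle U‖ ^ 2 +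
      b * ‖fn U‖ ^ 2 := by
  simp only [shiftedForm_eq_inner, real_inner_self_eq_norm_sq]

/-- Since `b` may be `0`, the `L²` part of the norm has to be paid for by the angular derivative,
through the angular Poincaré inequality; `d` is the resulting constant in `‖u‖² + ‖∂_θ u‖² ≤ d ‖∂_θ
u‖²`. -/
theorem exists_shiftedForm_ge {lam b : ℝ} (hlam : 0 < lam) (hb : 0 ≤ b) :
    ∃ c : ℝ, 0 < c ∧ ∀ U, c * ‖U‖ ^ 2 ≤ shiftedForm lam b U U := by
  set d := 1 + (4 * Real.pi) ^ 2 with hd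
  have hd0 : 0 < d := by positivity
  refine ⟨min 1 (1 / lam ^ 2 / d), by positivity, fun U => ?_⟩
  rw [shiftedForm_self, norm_sq_eq_sum]
  set c := min 1 (1 / lam ^ 2 / d)
  have hc0 : 0 ≤ c := by positivity
  have h1 : c ≤ 1 := min_le_left _ _
  have h2 : c * d ≤ 1 / lam ^ 2 := (le_div_iff₀ hd0).1 (min_le_right _ _)
  have h3 : ‖fn U‖ ^ 2 ≤ (4 * Real.pi) ^ 2 * ‖fnAngle U‖ ^ 2 := by
    rw [← mul_pow]
    exact pow_le_pow_left₀ (norm_nonneg _) (norm_fn_le_norm_fnAngle U) 2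
  have h4 : c * (‖fn U‖ ^ 2 + ‖fnAngle U‖ ^ 2) ≤ 1 / lam ^ 2 * ‖fnAngle U‖ ^ 2 := by
    calc _ ≤ c * (d * ‖fnAngle U‖ ^ 2) := by gcongr; rw [hd]; linarith
      _ = c * d * ‖fnAngle U‖ ^ 2 := by ring
      _ ≤ _ := by gcongr
  have h5 : c * (‖fnD1 U‖ ^ 2 + ‖fnD2 U‖ ^ 2) ≤ ‖fnD1 U‖ ^ 2 + ‖fnD2 U‖ ^ 2 :=
    mul_le_of_le_one_left (by positivity) h1
  have h6 : 0 ≤ b * ‖fn U‖ ^ 2 := by positivity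
  linarith

/-- Provides a set on which `|u|` is bounded below and which carries mass; scaling `u` pushes its
values there into the range where the primitive is large. If no level worked, the levels `1 / (n +
1)` would force `u = 0` almost everywhere. -/
theorem exists_level {U : HPlus} (hU : U ≠ 0) : ∃ δ : ℝ, 0 < δ ∧
    0 < ∫ x, {x | δ ≤ |fn U x|}.indicator (fun x => fn U x ^ 2) x ∂halfVol := by
  by_contra! hcon
  have hms : ∀ δ : ℝ, MeasurableSet {x | δ ≤ |fn U x|} := fun δ =>
    measurableSet_le measurable_const (Lp.stronglyMeasurable (fn U)).measurable.abs
  have h0 : ∀ n : ℕ, ∀ᵐ x ∂halfVol, {x | 1 / ((n : ℝ) + 1) ≤ |fn U x|}.indicator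
      (fun x => fn U x ^ 2) x = 0 := fun n => by
    have hnn : ∀ x, 0 ≤ {x | 1 / ((n : ℝ) + 1) ≤ |fn U x|}.indicator (fun x => fn U x ^ 2) x :=
      fun x => indicator_nonneg (fun x _ => sq_nonneg _) x
    exact (integral_eq_zero_iff_of_nonneg hnn ((Lp.memLp (fn U)).integrable_sq.indicator
      (hms _))).1 ((hcon _ (by positivity)).antisymm (integral_nonneg hnn))
  refine not_ae_fn_eq_zero hU ?_
  filter_upwards [ae_all_iff.2 h0] with x hx
  by_contra hne
  obtain ⟨n, hn⟩ := exists_nat_one_div_lt (abs_pos.2 hne)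
  have := hx n
  rw [indicator_of_mem (by exact hn.le)] at this
  exact hne (pow_eq_zero_iff two_ne_zero |>.1 this)

/-! ### The potential energy along rays -/

section Potential

variable {g : ℝ → ℝ} {m : ℕ}

theorem potential_zero (g : ℝ → ℝ) : potential g 0 = 0 := by
  refine integral_eq_zero_of_ae ?_
  filter_upwards [Lp.coeFn_zero ℝ 2 halfVol] with x hx
  change primitive g ((0 : L2Half) x) = 0
  rw [hx, Pi.zero_apply, primitive_zero]

theorem potential_smul (g : ℝ → ℝ) (t : ℝ) (U : HPlus) :
    potential g (t • U) = ∫ x, primitive g (t * fn U x) ∂halfVol := by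
  refine integral_congr_ae ?_
  filter_upwards [fn_smul_ae t U] with x hx
  rw [hx]

theorem IsSuperlinear.integrable_primitive_mul (h : IsSuperlinear g m) (t : ℝ) (U : HPlus) :
    Integrable (fun x => primitive g (t * fn U x)) halfVol := by
  refine (h.integrable_primitive (t • U)).congr ?_
  filter_upwards [fn_smul_ae t U] with x hx
  rw [hx]

/-- Convexity holds pointwise. Equality of the integrals would force equality almost everywhere,
contradicting strict convexity wherever `u ≠ 0`. -/
theorem strictConvexOn_potential (h : IsSuperlinear g m) {U : HPlus} (hU : U ≠ 0) :
    StrictConvexOn ℝ (Ici 0) fun r => potential g (√r • U) := by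
  refine ⟨convex_Ici 0, fun r hr s hs hrs a b ha hb hab => ?_⟩
  simp only [potential_smul, smul_eq_mul]
  by_contra! hcon
  have i1 := h.integrable_primitive_mul (√r) U
  have i2 := h.integrable_primitive_mul (√s) U
  have i3 := h.integrable_primitive_mul (√(a * r + b * s)) U
  have i12 : Integrable (fun x => a * primitive g (√r * fn U x) + b * primitive g (√s * fn U x))
    halfVol := (i1.const_mul a).add (i2.const_mul b)
  have hnn : ∀ x, 0 ≤ a * primitive g (√r * fn U x) + b * primitive g (√s * fn U x) -
      primitive g (√(a * r + b * s) * fn U x) := fun x =>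
    sub_nonneg.2 ((h.convex_primitive_sqrt (fn U x)).2 hr hs ha.le hb.le hab)
  have h0 : ∫ x, (a * primitive g (√r * fn U x) + b * primitive g (√s * fn U x) -
      primitive g (√(a * r + b * s) * fn U x)) ∂halfVol = 0 := by
    refine le_antisymm ?_ (integral_nonneg hnn)
    rw [integral_sub i12 i3, integral_add (i1.const_mul a) (i2.const_mul b), integral_const_mul,
      integral_const_mul]
    linarith
  have h1 := (integral_eq_zero_iff_of_nonneg hnn (i12.sub i3)).1 h0
  refine not_ae_fn_eq_zero hU ?_
  filter_upwards [h1] with x hx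
  by_contra hne
  have := (h.strictConvex_primitive_sqrt hne).2 hr hs hrs ha hb hab
  simp only [smul_eq_mul] at this
  simp only [Pi.zero_apply] at hx
  linarith

theorem exists_lt_potential (h : IsSuperlinear g m) {U : HPlus} (hU : U ≠ 0) (M : ℝ) :
    ∃ t : ℝ, 0 < t ∧ M * t ^ 2 < potential g (t • U) := by
  obtain ⟨δ, hδ, hI⟩ := exists_level hU
  set I := ∫ x, {x | δ ≤ |fn U x|}.indicator (fun x => fn U x ^ 2) x ∂halfVol with hIdef
  -- With this `K` and `t = T / δ`, the level set alone contributes `K t² I = (M + 1) t²`; elsewhere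
  -- the primitive is nonnegative.
  set K := (M + 1) / I
  obtain ⟨T, hT, hK⟩ := h.exists_le_primitive K
  have ht : 0 < T / δ := div_pos hT hδ
  refine ⟨T / δ, ht, ?_⟩
  have hms : MeasurableSet {x | δ ≤ |fn U x|} :=
    measurableSet_le measurable_const (Lp.stronglyMeasurable (fn U)).measurable.abs
  have h1 : ∫ x, K * (T / δ) ^ 2 * {x | δ ≤ |fn U x|}.indicator (fun x => fn U x ^ 2) x ∂halfVol
      ≤ potential g ((T / δ) • U) := by
    rw [potential_smul]
    refine integral_mono (((Lp.memLp (fn U)).integrable_sq.indicator hms).const_mul _)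
      (h.integrable_primitive_mul _ _) fun x => ?_
    by_cases hx : δ ≤ |fn U x|
    · have := hK (T / δ * fn U x) (by
        rw [abs_mul, abs_of_pos ht, div_mul_eq_mul_div, le_div_iff₀ hδ]
        gcongr)
      rw [mul_pow, ← mul_assoc] at this
      rw [indicator_of_mem (by exact hx)]
      exact this
    · rw [indicator_of_notMem (by exact hx), mul_zero]
      exact h.primitive_nonneg _
  rw [integral_const_mul, ← hIdef] at h1
  have h2 : K * (T / δ) ^ 2 * I = (M + 1) * (T / δ) ^ 2 := by
    simp only [K]; field_simp
  rw [h2] at h1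
  have : 0 < (T / δ) ^ 2 := by positivity
  linarith

theorem exists_potential_le (h : IsSuperlinear g m) {η : ℝ} (hη : 0 < η) :
    ∃ C : ℝ, 0 ≤ C ∧ ∀ U, potential g U ≤ (η + C * ‖U‖ ^ (m + 1)) * ‖U‖ ^ 2 := by
  obtain ⟨C, hC, hb⟩ := h.exists_abs_primitive_le hη
  refine ⟨C * (m + 1 + 1).factorial, by positivity, fun U => ?_⟩
  have i1 := integrable_mul_abs U U
  have i2 := integrable_pow_mul (m + 1) U U
  have h1 : potential g U ≤
      ∫ x, (η * (|fn U x| * |fn U x|) + C * (|fn U x| ^ (m + 1 + 1) * |fn U x|)) ∂halfVol :=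
    integral_mono (h.integrable_primitive U) ((i1.const_mul η).add (i2.const_mul C)) fun x =>
      (le_abs_self _).trans (hb _)
  rw [integral_add (i1.const_mul η) (i2.const_mul C), integral_const_mul, integral_const_mul] at h1
  refine h1.trans ?_
  calc _ ≤ η * (‖U‖ * ‖U‖) + C * ((m + 1 + 1).factorial * ‖U‖ ^ (m + 1 + 1) * ‖U‖) := by
        gcongr
        · exact integral_mul_abs_le U U
        · exact integral_pow_mul_le (m + 1) U U
    _ = _ := by ring

theorem nehariSetting {lam b : ℝ} (hlam : 0 < lam) (hb : 0 ≤ b) (h : IsSuperlinear g m) :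
    NehariSetting (shiftedForm lam b) (potential g) (potentialDeriv h) where
  symm U V := by simp only [shiftedForm_eq_inner, real_inner_comm]
  coercive := exists_shiftedForm_ge hlam hb
  strictDeriv := hasStrictFDerivAt_potential h
  weakCont _ _ _ _ hM hw := tendsto_potential h hM hw
  map_zero := potential_zero g
  convex _ hU := strictConvexOn_potential h hU
  exists_neg U hU := by
    obtain ⟨t, ht, hlt⟩ := exists_lt_potential h hU (1 / 2 * shiftedForm lam b U U)
    refine ⟨t, ht, ?_⟩
    simp only [map_smul, FunLike.coe_smul, Pi.smul_apply, smul_eq_mul]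
    linarith
  exists_pos U hU := by
    obtain ⟨c, hc, hcoer⟩ := exists_shiftedForm_ge hlam hb
    -- Of the coercivity constant `c / 2`, one quarter of `c` goes to `η` and the other, strictly,
    -- to the higher-order term for small `t`.
    obtain ⟨C, hC, hle⟩ := exists_potential_le h (show 0 < c / 4 by positivity)
    have hlim : Tendsto (fun t : ℝ => C * ‖t • U‖ ^ (m + 1)) (𝓝[>] 0) (𝓝 0) := by
      have : Continuous fun t : ℝ => C * ‖t • U‖ ^ (m + 1) := by fun_prop
      exact tendsto_nhdsWithin_of_tendsto_nhds (by simpa using this.tendsto 0)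
    obtain ⟨t, hlt, ht⟩ := ((hlim.eventually_lt_const (show 0 < c / 4 by positivity)).and
      self_mem_nhdsWithin).exists
    refine ⟨t, ht, ?_⟩
    have ht0 : 0 < t := ht
    have hn : 0 < ‖t • U‖ ^ 2 := pow_pos (norm_pos_iff.2 (smul_ne_zero ht0.ne' hU)) 2
    have h1 := hcoer (t • U)
    have h2 := hle (t • U)
    have h3 := mul_lt_mul_of_pos_right hlt hn
    linarith

end Potential

/-! ### The ground state level and the weak equation -/

section GroundState

variable {f : ℝ → ℝ} {lam b : ℝ} {m : ℕ}

theorem primitive_add_mul (hf : Continuous f) (b t : ℝ) :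
    primitive (fun t => f t + b * t) t = primitive f t + b / 2 * t ^ 2 := by
  rw [primitive, intervalIntegral.integral_add (hf.intervalIntegrable _ _)
    (Continuous.intervalIntegrable (by fun_prop) _ _), intervalIntegral.integral_const_mul,
    integral_id, primitive]
  ring

/-- The term `b / 2 ∫ u²` is added to the form and to the potential and cancels in the difference.
-/
theorem energy_eq (hf : Continuous f) (h : IsSuperlinear (fun t => f t + b * t) m) (U : HPlus) :
    energy f lam U = 1 / 2 * shiftedForm lam b U U - potential (fun t => f t + b * t) U := by
  have h1 : ∫ x, primitive f (fn U x) ∂halfVol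
      = potential (fun t => f t + b * t) U - b / 2 * ∫ x, fn U x ^ 2 ∂halfVol := by
    rw [potential, ← integral_const_mul, ← integral_sub (h.integrable_primitive U)
      ((Lp.memLp (fn U)).integrable_sq.const_mul _)]
    refine integral_congr_ae (ae_of_all _ fun x => ?_)
    simp only [primitive_add_mul hf]
    ring
  rw [energy, h1, shiftedForm_apply]
  simp only [← sq]
  ring

/-- Fréchet derivatives are unique, so the existential derivative in the definition is the explicit
one. -/
theorem mem_nehari_iff {B : HPlus →L[ℝ] HPlus →L[ℝ] ℝ} {J : HPlus → ℝ}
    {J' : HPlus → HPlus →L[ℝ] ℝ} (H : NehariSetting B J J')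
    (hE : ∀ U, energy f lam U = 1 / 2 * B U U - J U) {U : HPlus} :
    U ∈ nehari f lam ↔ U ≠ 0 ∧ B U U - J' U U = 0 := by
  have hd := (H.strictDeriv_energy hE U).hasFDerivAt
  refine and_congr_right fun _ => ⟨?_, fun h => ⟨_, hd, h⟩⟩
  rintro ⟨L, hL, h0⟩
  rwa [hL.unique hd] at h0

/-- The ground state level is the mountain pass level along rays. -/
theorem groundLevel_eq {B : HPlus →L[ℝ] HPlus →L[ℝ] ℝ} {J : HPlus → ℝ}
    {J' : HPlus → HPlus →L[ℝ] ℝ} (H : NehariSetting B J J')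
    (hE : ∀ U, energy f lam U = 1 / 2 * B U U - J U) :
    groundLevel f lam =
      ⨅ (U : HPlus) (_ : U ≠ 0), ⨆ (t : ℝ) (_ : 0 ≤ t), (energy f lam (t • U) : EReal) := by
  -- Each ray contains a Nehari point, whose energy is at most the supremum on that ray; conversely,
  -- on the ray through a Nehari point the supremum is at most the energy there.
  refine le_antisymm (le_iInf₂ fun U hU => ?_) (le_iInf₂ fun U hU => ?_)
  · obtain ⟨t, ht, h0, -, -⟩ := H.exists_max hE hU
    have hmem : t • U ∈ nehari f lam := by
      refine (mem_nehari_iff H hE).2 ⟨smul_ne_zero ht.ne' hU, ?_⟩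
      rw [map_smul (B (t • U)), map_smul (J' (t • U)), ← smul_sub, h0, smul_zero]
    exact (iInf₂_le _ hmem).trans
      (le_iSup₂ (f := fun (t : ℝ) (_ : 0 ≤ t) => (energy f lam (t • U) : EReal)) t ht.le)
  · obtain ⟨hU0, h0⟩ := (mem_nehari_iff H hE).1 hU
    exact (iInf₂_le U hU0).trans
      (iSup₂_le fun t ht => EReal.coe_le_coe_iff.2 (H.le_of_nehari hE hU0 h0 ht))

/-- The abstract minimizer is minimal among maxima over rays; every Nehari point is such a maximum,
attained at parameter `1`. -/
theorem exists_energy_eq_groundLevel {B : HPlus →L[ℝ] HPlus →L[ℝ] ℝ} {J : HPlus → ℝ}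
    {J' : HPlus → HPlus →L[ℝ] ℝ} (H : NehariSetting B J J')
    (hE : ∀ U, energy f lam U = 1 / 2 * B U U - J U) :
    ∃ V : HPlus, V ≠ 0 ∧ (∀ W, (B V - J' V) W = 0) ∧
      (energy f lam V : EReal) = groundLevel f lam := by
  obtain ⟨V, hV, hcrit, hmin⟩ := H.exists_ground_state hE
  refine ⟨V, hV, hcrit, le_antisymm (le_iInf₂ fun U hU => ?_)
    (iInf₂_le V ((mem_nehari_iff H hE).2 ⟨hV, hcrit V⟩))⟩
  obtain ⟨hU0, h0⟩ := (mem_nehari_iff H hE).1 hU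
  have := hmin U hU0 1 fun s hs => by
    rw [one_smul]
    exact H.le_of_nehari hE hU0 h0 hs
  rw [one_smul] at this
  exact EReal.coe_le_coe_iff.2 this

/-- The `L²` terms with the factor `b` on both sides of the critical point equation cancel. -/
theorem isWeakSolution_of_critical (h : IsSuperlinear (fun t => f t + b * t) m) {V : HPlus}
    (hV : ∀ W, (shiftedForm lam b V - potentialDeriv h V) W = 0) : IsWeakSolution f lam V := by
  intro W
  have i1 := h.integrable_comp_mul V W
  have i2 := (integrable_mul (fn V) (fn W)).const_mul b
  have e : (fun x => f (fn V x) * fn W x) =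
      fun x => (f (fn V x) + b * fn V x) * fn W x - b * (fn V x * fn W x) := by
    funext x; ring
  rw [e]
  refine ⟨i1.sub i2, ?_⟩
  have h1 := hV W
  rw [sub_apply, shiftedForm_apply, potentialDeriv_apply] at h1
  rw [integral_sub i1 i2, integral_const_mul]
  linarith

end GroundState

end SpiralingHalfPlane

end

theorem theorem3p3 (p lam : ℝ) (hp : 2 < p) (hlam : 0 < lam) (f : ℝ → ℝ) (hf : Continuous f)
    (hA1 : SpiralingHalfPlane.GrowthBound p f) (hA2 : SpiralingHalfPlane.QuotientCondition f) :
    SpiralingHalfPlane.groundLevel f lam =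
        (⨅ (U : SpiralingHalfPlane.HPlus) (_ : U ≠ 0), ⨆ (t : ℝ) (_ : 0 ≤ t),
          (SpiralingHalfPlane.energy f lam (t • U) : EReal)) ∧
      ∃ V : SpiralingHalfPlane.HPlus, V ≠ 0 ∧ SpiralingHalfPlane.IsWeakSolution f lam V ∧
        (SpiralingHalfPlane.energy f lam V : EReal) = SpiralingHalfPlane.groundLevel f lam := by
  obtain ⟨b, m, hb, h⟩ := SpiralingHalfPlane.exists_isSuperlinear hf hA1 hA2 hp
  have H := SpiralingHalfPlane.nehariSetting hlam hb h
  have hE := SpiralingHalfPlane.energy_eq (lam := lam) hf h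
  obtain ⟨V, hV, hcrit, hlev⟩ := SpiralingHalfPlane.exists_energy_eq_groundLevel H hE
  exact ⟨SpiralingHalfPlane.groundLevel_eq H hE, V, hV,
    SpiralingHalfPlane.isWeakSolution_of_critical h hcrit, hlev⟩
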